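/- Let $R>0$, $C>0$, $M>0$, $m_0\ge 0$ and $\alpha>1$. Consider the spherically symmetric Einstein--scalar field equations in null coordinates for functions $r,\phi,m$ of $(u,v)$: with $\nu=\partial_u r$, $\lambda=\partial_v r$, $\zeta=r\partial_u\phi$, $\theta=r\partial_v\phi$, $\mu=2m/r$, $$\partial_u\lambda=\lambda\,\frac{2\nu}{1-\mu}\frac{m}{r^2},\quad \partial_v\nu=\nu\,\frac{2\lambda}{1-\mu}\frac{m}{r^2},\quad \partial_u m=\tfrac12(1-\mu)\Big(\frac{\zeta}{\nu}\Big)^2\nu,\quad \partial_v m=\tfrac12(1-\mu)\Big(\frac{\theta}{\lambda}\Big)^2\lambda,\quad \partial_u\theta=-\frac{\zeta\lambda}{r},\quad \partial_v\zeta=-\frac{\theta\nu}{r}.$$ Prescribe characteristic data as follows: $r(-R,R)=R$, $m(-R,R)=m_0$; on $u=-R$, $C^2$ functions $r(-R,\cdot),\phi(-R,\cdot)$ on $[R,\infty)$ with $\lambda=1$, $|r\phi|\le C$ and $m\le M$; on $v=R$, $C^2$ functions $r(\cdot,R),\phi(\cdot,R)$ on $(-\infty,-R]$ with $\nu=-1$,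 $|\partial_u(r\phi)|\le C|u|^{-2}$ and $m\le M$. Here $\phi$ is continuous at the corner, and $m$ on the two segments is determined from $m_0$ by the two mass equations. A development of the data is a set $D\subset(-\infty,-R]\times[R,\infty)$, open in the subspace topology, containing both initial segments, and containing with $(u,v)$ every point $(\tilde u,\tilde v)$ of the wedge with $\tilde u\ge u$, $\tilde v\le v$, together with $C^2$ functions $r,\phi,m$ on $D$ that agree with the data on the segments and solve the equations (with $r>0$ and $\nu,\lambda,1-\mu\ne0$, so that these make sense). The maximal development is the development that contains every other development and agrees with it on its domain. Suppose that $$R>\max\left\{\Big(\frac{4\alpha}{\alpha-1}\Big)^2,\ \Big(\frac{1+16\alpha^4M}{\alpha}\Big)^2,\ \frac{8\alpha^2M}{\log\alpha},\ \frac{6\alpha^2C^2}{(\alpha-1)M},\ \frac{4\alpha M}{1-\alpha^{-1}}\right\}.$$ Then the maximal development exists, its domain is $D=(-\infty,-R]\times[R,\infty)$, and everywhere on it $$|r\phi|\le\alpha C,\quad |\nu\phi+\zeta|\le(1+\alpha^4M)C|u|^{-2},\quad -\alpha\le\nu\le-1,\quad 1\le\lambda\le\alpha,\quad 1-\mu\ge(2\alpha)^{-1}.$$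 If moreover, for some constant $\tilde C$, $|\lambda\phi+\theta|(-R,v)\le\tilde Cv^{-2}$ for all $v\ge R$, then $|\lambda\phi+\theta|(u,v)\le(\tilde C+\alpha^4MC)v^{-2}$ for all $(u,v)\in D$. -/

import Mathlib

open Set

noncomputable section

namespace GammaProblem

/-- The wedge `(-∞, -R] × [R, ∞)` of null coordinates `(u, v)`. -/
def wedge (R : ℝ) : Set (ℝ × ℝ) := Iic (-R) ×ˢ Ici R

/-- Partial derivative in `u` along the slice `(-∞, -R]` (one-sided at `u = -R`). -/
def partialU (R : ℝ) (f : ℝ → ℝ → ℝ) (u v : ℝ) : ℝ :=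
  derivWithin (fun u' => f u' v) (Iic (-R)) u

/-- Partial derivative in `v` along the slice `[R, ∞)` (one-sided at `v = R`). -/
def partialV (R : ℝ) (f : ℝ → ℝ → ℝ) (u v : ℝ) : ℝ :=
  derivWithin (fun v' => f u v') (Ici R) v

/-- The unknowns: area radius `r`, scalar field `φ`, Hawking mass `m`, as functions of `(u, v)`.
Only their values on the domain under consideration matter. -/
structure Fields where
  r : ℝ → ℝ → ℝ
  φ : ℝ → ℝ → ℝ
  m : ℝ → ℝ → ℝ

namespace Fields

/-- `ν = ∂_u r`. -/
def nu (S : Fields) (R u v : ℝ) : ℝ := partialU R S.r u v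

/-- `λ = ∂_v r`. -/
def lam (S : Fields) (R u v : ℝ) : ℝ := partialV R S.r u v

/-- `ζ = r ∂_u φ`. -/
def zeta (S : Fields) (R u v : ℝ) : ℝ := S.r u v * partialU R S.φ u v

/-- `θ = r ∂_v φ`. -/
def theta (S : Fields) (R u v : ℝ) : ℝ := S.r u v * partialV R S.φ u v

/-- The mass aspect function `μ = 2m/r`. -/
def mu (S : Fields) (u v : ℝ) : ℝ := 2 * S.m u v / S.r u v

/-- `r`, `φ`, `m` are `C²` on `D` (up to the part of the boundary of the wedge contained in `D`). -/
structure IsRegularOn (S : Fields) (D : Set (ℝ × ℝ)) : Prop where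
  r_c2 : ContDiffOn ℝ 2 (Function.uncurry S.r) D
  phi_c2 : ContDiffOn ℝ 2 (Function.uncurry S.φ) D
  m_c2 : ContDiffOn ℝ 2 (Function.uncurry S.m) D

/-- The spherically symmetric Einstein-scalar field equations in null coordinates, as a first
order system.  The equations `∂_u r = ν`, `∂_v r = λ` are the definitions of `ν`, `λ`.  The first
four clauses say that no denominator of the system vanishes. -/
structure SolvesEinsteinScalar (S : Fields) (R : ℝ) (D : Set (ℝ × ℝ)) : Prop where
  r_pos : ∀ u v, (u, v) ∈ D → 0 < S.r u v
  one_sub_mu_ne : ∀ u v, (u, v) ∈ D → 1 - S.mu u v ≠ 0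
  nu_ne : ∀ u v, (u, v) ∈ D → S.nu R u v ≠ 0
  lam_ne : ∀ u v, (u, v) ∈ D → S.lam R u v ≠ 0
  du_lam : ∀ u v, (u, v) ∈ D → HasDerivWithinAt (fun u' => S.lam R u' v)
    (S.lam R u v * (2 * S.nu R u v / (1 - S.mu u v) * (S.m u v / S.r u v ^ 2))) (Iic (-R)) u
  dv_nu : ∀ u v, (u, v) ∈ D → HasDerivWithinAt (fun v' => S.nu R u v')
    (S.nu R u v * (2 * S.lam R u v / (1 - S.mu u v) * (S.m u v / S.r u v ^ 2))) (Ici R) v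
  du_m : ∀ u v, (u, v) ∈ D → HasDerivWithinAt (fun u' => S.m u' v)
    (1 / 2 * (1 - S.mu u v) * (S.zeta R u v / S.nu R u v) ^ 2 * S.nu R u v) (Iic (-R)) u
  dv_m : ∀ u v, (u, v) ∈ D → HasDerivWithinAt (fun v' => S.m u v')
    (1 / 2 * (1 - S.mu u v) * (S.theta R u v / S.lam R u v) ^ 2 * S.lam R u v) (Ici R) v
  du_theta : ∀ u v, (u, v) ∈ D → HasDerivWithinAt (fun u' => S.theta R u' v)
    (-(S.zeta R u v * S.lam R u v / S.r u v)) (Iic (-R)) u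
  dv_zeta : ∀ u v, (u, v) ∈ D → HasDerivWithinAt (fun v' => S.zeta R u v')
    (-(S.theta R u v * S.nu R u v / S.r u v)) (Ici R) v

end Fields

/-- Characteristic data on `u = -R` (functions of `v ∈ [R, ∞)`, suffix `Out`) and on `v = R`
(functions of `u ∈ (-∞, -R]`, suffix `In`).  The freely prescribed functions are `r` and `φ`;
the mass on the two segments is determined by its value `m₀` at the corner and the mass equations
restricted to the segments (where `λ = 1`, respectively `ν = -1`). -/
structure CharData (R C M m₀ : ℝ) where
  rOut : ℝ → ℝ
  φOut : ℝ → ℝ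
  mOut : ℝ → ℝ
  rIn : ℝ → ℝ
  φIn : ℝ → ℝ
  mIn : ℝ → ℝ
  rOut_c2 : ContDiffOn ℝ 2 rOut (Ici R)
  φOut_c2 : ContDiffOn ℝ 2 φOut (Ici R)
  rIn_c2 : ContDiffOn ℝ 2 rIn (Iic (-R))
  φIn_c2 : ContDiffOn ℝ 2 φIn (Iic (-R))
  rOut_corner : rOut R = R
  rIn_corner : rIn (-R) = R
  φ_corner : φOut R = φIn (-R)
  mOut_corner : mOut R = m₀
  mIn_corner : mIn (-R) = m₀
  /-- `∂_v m = ½ (1 - μ) θ²` on `u = -R`. -/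
  mOut_deriv : ∀ v ∈ Ici R, HasDerivWithinAt mOut
    (1 / 2 * (1 - 2 * mOut v / rOut v) * (rOut v * derivWithin φOut (Ici R) v) ^ 2) (Ici R) v
  /-- `∂_u m = -½ (1 - μ) ζ²` on `v = R`. -/
  mIn_deriv : ∀ u ∈ Iic (-R), HasDerivWithinAt mIn
    (-(1 / 2 * (1 - 2 * mIn u / rIn u) * (rIn u * derivWithin φIn (Iic (-R)) u) ^ 2)) (Iic (-R)) u
  /-- `λ = 1` on `u = -R`. -/
  rOut_deriv : ∀ v ∈ Ici R, HasDerivWithinAt rOut 1 (Ici R) v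
  rφOut_le : ∀ v ∈ Ici R, |rOut v * φOut v| ≤ C
  mOut_le : ∀ v ∈ Ici R, mOut v ≤ M
  /-- `ν = -1` on `v = R`. -/
  rIn_deriv : ∀ u ∈ Iic (-R), HasDerivWithinAt rIn (-1) (Iic (-R)) u
  /-- `|∂_u (r φ)| ≤ C |u|⁻²` on `v = R`. -/
  rφIn_deriv_le : ∀ u ∈ Iic (-R),
    |derivWithin (fun u' => rIn u' * φIn u') (Iic (-R)) u| ≤ C / |u| ^ 2
  mIn_le : ∀ u ∈ Iic (-R), mIn u ≤ M

/-- A development of the data `d`: a relatively open subset `D` of the wedge that contains both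
initial segments and, with `(u, v)`, all points `(u', v')` of the wedge with `u' ≥ u`, `v' ≤ v`,
together with regular functions on `D` that attain the data and solve the equations. -/
structure IsDevelopment {R C M m₀ : ℝ} (d : CharData R C M m₀) (D : Set (ℝ × ℝ)) (S : Fields) :
    Prop where
  subset_wedge : D ⊆ wedge R
  rel_open : ∃ U : Set (ℝ × ℝ), IsOpen U ∧ D = U ∩ wedge R
  out_mem : ∀ v ∈ Ici R, (-R, v) ∈ D
  in_mem : ∀ u ∈ Iic (-R), (u, R) ∈ D
  r_out : ∀ v ∈ Ici R, S.r (-R) v = d.rOut v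
  φ_out : ∀ v ∈ Ici R, S.φ (-R) v = d.φOut v
  m_out : ∀ v ∈ Ici R, S.m (-R) v = d.mOut v
  r_in : ∀ u ∈ Iic (-R), S.r u R = d.rIn u
  φ_in : ∀ u ∈ Iic (-R), S.φ u R = d.φIn u
  m_in : ∀ u ∈ Iic (-R), S.m u R = d.mIn u
  regular : S.IsRegularOn D
  solves : S.SolvesEinsteinScalar R D
  past_set : ∀ u v u' v', (u, v) ∈ D → (u', v') ∈ wedge R → u ≤ u' → v' ≤ v → (u', v') ∈ D

/-- The maximal development: a development that contains every other one and agrees with it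
wherever the latter is defined. -/
structure IsMaximalDevelopment {R C M m₀ : ℝ} (d : CharData R C M m₀) (D : Set (ℝ × ℝ))
    (S : Fields) : Prop where
  isDevelopment : IsDevelopment d D S
  maximal : ∀ (D' : Set (ℝ × ℝ)) (S' : Fields), IsDevelopment d D' S' →
    D' ⊆ D ∧ ∀ u v, (u, v) ∈ D' → S'.r u v = S.r u v ∧ S'.φ u v = S.φ u v ∧ S'.m u v = S.m u v

/-- The explicit lower bound required of `R`. -/
def radiusBound (α C M : ℝ) : ℝ :=
  max ((4 * α / (α - 1)) ^ 2) <| max (((1 + 16 * α ^ 4 * M) / α) ^ 2) <|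
    max (8 * α ^ 2 * M / Real.log α) <| max (6 * α ^ 2 * C ^ 2 / ((α - 1) * M)) <|
      4 * α * M / (1 - α⁻¹)

end GammaProblem

end

/-! The unknowns are collected in the state (r, λ, ν, rφ, ∂_u(rφ), m). Each component is evolved in
one null direction only, from the initial segment transverse to that direction: λ, rφ, m in u from u
= -R, and r, ν, ∂_u(rφ) in v from v = R. The point of rφ is that ∂_u∂_v(rφ) = φ ∂_u∂_v r, where
∂_u∂_v r = λν · 2m/(r²(1-μ)). As long as λ, |ν|, m and rφ are bounded and μ ≤ 1/2, these sources are
O(r⁻²) for r and O(r⁻³) for rφ. Since λ ≥ 1 gives r ≥ v - R - u, they are integrable along both null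
directions, and every integral is small when R is large.

Existence needs no continuation argument. The state is truncated to the box of expected bounds,
which makes the right-hand sides globally bounded and Lipschitz, so `exists_goursat_solution` (a
contraction in a weighted sup norm) solves the truncated system on the whole plane. The truncated
sources satisfy the box estimates automatically, so integrating them shows that on the wedge the
solution lies in the box. There the truncation is inactive and the true equations hold: this is
`CharData.exists_state`. Inside the box λ and |ν| are bounded by β = min(3/2, √α) rather than α;
this sharper bound closes the estimate of ∂_u(rφ) with the constant α⁴MC.

What remains is to see that the state is a development. The equation for ∂_v m was not used, and
holds because it propagates from u = -R (`ReducedSystem.dv_m`). The C² regularity follows by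
differentiating the integrated equations, where ∂_uν and ∂_vλ come from explicit exponentials
(`ReducedSystem.contDiffOn_two`).

Maximality is uniqueness: on a compact characteristic rectangle the difference of two developments
satisfies a homogeneous Goursat inequality (`IsDevelopment.state_eq`). A development on the whole
wedge therefore contains and extends every other one. The bound on ∂_v(rφ) comes from integrating
the same O(r⁻³) source in u (`abs_dvRPhi_sub_le`). -/

/-! ### The Goursat problem with bounded Lipschitz nonlinearity. -/

-- Integrating against an exponential weight gains the factor 1/L, which makes the Picard map a
-- contraction for L large, with no restriction on the size of the domain.
open Filter Topology MeasureTheory intervalIntegral in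
theorem abs_intervalIntegral_le_of_exp_bound {L D c x : ℝ} (hL : 0 < L) (hD : 0 ≤ D) {g : ℝ → ℝ}
    (hg : ∀ s, |g s| ≤ D * Real.exp (L * |s - c|)) :
    |∫ s in c..x, g s| ≤ D / L * Real.exp (L * |x - c|) := by
  have key : ∀ {y : ℝ} {f : ℝ → ℝ}, 0 ≤ y → (∀ s, |f s| ≤ D * Real.exp (L * |s|)) →
      |∫ s in (0 : ℝ)..y, f s| ≤ D / L * Real.exp (L * y) := by
    intro y f hy hf
    have h1 : |∫ s in (0 : ℝ)..y, f s| ≤ ∫ s in (0 : ℝ)..y, D * Real.exp (L * s) := by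
      rw [← Real.norm_eq_abs]
      refine intervalIntegral.norm_integral_le_of_norm_le hy ?_ ?_
      · refine Eventually.of_forall fun s hs => ?_
        have := hf s
        rwa [abs_of_pos hs.1] at this
      · exact (by fun_prop : Continuous fun s => D * Real.exp (L * s)).intervalIntegrable _ _
    have h2 : ∫ s in (0 : ℝ)..y, D * Real.exp (L * s)
        = D / L * Real.exp (L * y) - D / L * Real.exp (L * 0) := by
      refine integral_eq_sub_of_hasDerivAt (f := fun s => D / L * Real.exp (L * s)) ?_ ?_
      · intro s _
        have := (((hasDerivAt_id s).const_mul L).exp).const_mul (D / L)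
        refine this.congr_deriv ?_
        simp only [id]
        field_simp
      · exact (by fun_prop : Continuous fun s => D * Real.exp (L * s)).intervalIntegrable _ _
    have h3 : 0 ≤ D / L * Real.exp (L * 0) := by positivity
    linarith
  rcases le_total c x with h | h
  · have := key (y := x - c) (f := fun s => g (s + c)) (by linarith) (fun s => by simpa using hg (s + c))
    rw [intervalIntegral.integral_comp_add_right] at this
    simpa [abs_of_nonneg (sub_nonneg.2 h)] using this
  · have := key (y := c - x) (f := fun s => g (c - s)) (by linarith)
      (fun s => by simpa using hg (c - s))
    rw [intervalIntegral.integral_comp_sub_left] at this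
    rw [intervalIntegral.integral_symm, abs_neg, abs_of_nonpos (sub_nonpos.2 h)]
    simpa using this

open MeasureTheory intervalIntegral BoundedContinuousFunction in
/-- Global solvability of a first order Goursat system with bounded Lipschitz nonlinearity. -/
theorem exists_goursat_solution {ι : Type*} [Fintype ι] (u₀ v₀ : ℝ) (dir : ι → Bool)
    (d : ι → ℝ → ℝ → ℝ) (hd : ∀ i, Continuous fun p : ℝ × ℝ => d i p.1 p.2)
    (F : ι → ℝ → ℝ → (ι → ℝ) → ℝ)
    (hF : ∀ i, Continuous fun q : ℝ × ℝ × (ι → ℝ) => F i q.1 q.2.1 q.2.2) (B K : ℝ)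
    (hB : ∀ i u v x, |F i u v x| ≤ B)
    (hK : ∀ i u v x y, |F i u v x - F i u v y| ≤ K * ‖x - y‖) :
    ∃ X : ℝ → ℝ → ι → ℝ, (Continuous fun p : ℝ × ℝ => X p.1 p.2) ∧
      ∀ i u v, X u v i = d i u v +
        if dir i then ∫ s in u₀..u, F i s v (X s v) else ∫ s in v₀..v, F i u s (X u s) := by
  classical
  wlog hB0 : 0 ≤ B generalizing B
  · exact this |B| (fun i u v x => (hB i u v x).trans (le_abs_self B)) (abs_nonneg B)
  wlog hK0 : 0 ≤ K generalizing K
  · exact this |K| (fun i u v x y => (hK i u v x y).trans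
      (mul_le_mul_of_nonneg_right (le_abs_self K) (norm_nonneg _))) (abs_nonneg K)
  set L : ℝ := 2 * K + 1 with hLdef
  have hL : 0 < L := by positivity
  -- One weight growing in both directions serves components evolved in u and in v alike; L = 2K + 1
  -- forces K/L ≤ 1/2.
  let w : ℝ → ℝ → ℝ := fun u v => Real.exp (L * (|u - u₀| + |v - v₀|))
  have hwc : Continuous fun p : ℝ × ℝ => w p.1 p.2 := by fun_prop
  have hw0 : ∀ u v, 0 < w u v := fun u v => Real.exp_pos _
  have hw1 : ∀ u v, 1 ≤ w u v := fun u v => Real.one_le_exp (by positivity)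
  let I : (ℝ → ℝ → ι → ℝ) → ℝ → ℝ → ι → ℝ := fun X u v i =>
    if dir i then ∫ s in u₀..u, F i s v (X s v) else ∫ s in v₀..v, F i u s (X u s)
  have hIc : ∀ X : ℝ → ℝ → ι → ℝ, (Continuous fun p : ℝ × ℝ => X p.1 p.2) →
      Continuous fun p : ℝ × ℝ => I X p.1 p.2 := by
    intro X hX
    refine continuous_pi fun i => ?_
    by_cases hi : dir i
    · simp only [I, hi, if_true]
      refine continuous_parametric_intervalIntegral_of_continuous
        (f := fun (p : ℝ × ℝ) s => F i s p.2 (X s p.2)) ?_ continuous_fst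
      exact (hF i).comp ((continuous_snd).prodMk ((continuous_snd.comp continuous_fst).prodMk
        (hX.comp (continuous_snd.prodMk (continuous_snd.comp continuous_fst)))))
    · simp only [I, hi]
      refine continuous_parametric_intervalIntegral_of_continuous
        (f := fun (p : ℝ × ℝ) s => F i p.1 s (X p.1 s)) ?_ continuous_snd
      exact (hF i).comp ((continuous_fst.comp continuous_fst).prodMk (continuous_snd.prodMk
        (hX.comp ((continuous_fst.comp continuous_fst).prodMk continuous_snd))))
  have hFX : ∀ X : ℝ → ℝ → ι → ℝ, (Continuous fun p : ℝ × ℝ => X p.1 p.2) → ∀ i,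
      Continuous fun p : ℝ × ℝ => F i p.1 p.2 (X p.1 p.2) := fun X hX i =>
    (hF i).comp (continuous_fst.prodMk (continuous_snd.prodMk hX))
  -- weighted integral estimate
  have hIbound : ∀ (D : ℝ), 0 ≤ D → ∀ (g : ι → ℝ → ℝ → ℝ), (∀ i u v, |g i u v| ≤ D * w u v) →
      ∀ i u v, |if dir i then ∫ s in u₀..u, g i s v else ∫ s in v₀..v, g i u s|
        ≤ D / L * w u v := by
    intro D hD g hg i u v
    have e : ∀ a b : ℝ, Real.exp (L * (a + b)) = Real.exp (L * a) * Real.exp (L * b) := by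
      intro a b; rw [mul_add, Real.exp_add]
    by_cases hi : dir i
    · simp only [hi, if_true]
      have := abs_intervalIntegral_le_of_exp_bound (L := L) (D := D * Real.exp (L * |v - v₀|))
        (c := u₀) (x := u) hL (by positivity) (g := fun s => g i s v) (fun s => by
          refine (hg i s v).trans (le_of_eq ?_)
          simp only [w, e]; ring)
      refine this.trans (le_of_eq ?_)
      simp only [w, e]; ring
    · simp only [hi]
      have := abs_intervalIntegral_le_of_exp_bound (L := L) (D := D * Real.exp (L * |u - u₀|))
        (c := v₀) (x := v) hL (by positivity) (g := fun s => g i u s) (fun s => by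
          refine (hg i u s).trans (le_of_eq ?_)
          simp only [w, e]; ring)
      refine this.trans (le_of_eq ?_)
      simp only [w, e]; ring
  -- The fixed-point variable is Y = (X - d)/w. It is bounded although d need not be, so the space
  -- of bounded continuous functions is available.
  let toX : ((ℝ × ℝ) →ᵇ (ι → ℝ)) → ℝ → ℝ → ι → ℝ := fun Y u v i => d i u v + w u v * Y (u, v) i
  have htoX : ∀ Y, Continuous fun p : ℝ × ℝ => toX Y p.1 p.2 := by
    intro Y
    refine continuous_pi fun i => ?_
    exact (hd i).add (hwc.mul ((continuous_apply i).comp Y.continuous))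
  have hTc : ∀ Y, Continuous fun p : ℝ × ℝ => (w p.1 p.2)⁻¹ • I (toX Y) p.1 p.2 := fun Y =>
    (hwc.inv₀ fun p => (hw0 _ _).ne').smul (hIc _ (htoX Y))
  have hTb : ∀ Y, ∀ p : ℝ × ℝ, ‖(w p.1 p.2)⁻¹ • I (toX Y) p.1 p.2‖ ≤ B / L := by
    intro Y p
    rw [norm_smul, norm_inv, Real.norm_of_nonneg (hw0 _ _).le, inv_mul_le_iff₀ (hw0 _ _)]
    refine (pi_norm_le_iff_of_nonneg (mul_nonneg (hw0 _ _).le (by positivity))).2 fun i => ?_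
    rw [mul_comm]
    exact hIbound B hB0 (fun i u v => F i u v (toX Y u v)) (fun i u v => (hB _ _ _ _).trans
      (le_mul_of_one_le_right hB0 (hw1 u v))) i p.1 p.2
  let T : ((ℝ × ℝ) →ᵇ (ι → ℝ)) → ((ℝ × ℝ) →ᵇ (ι → ℝ)) := fun Y =>
    BoundedContinuousFunction.ofNormedAddCommGroup _ (hTc Y) (B / L) (hTb Y)
  have hT : ContractingWith (1 / 2) T := by
    refine ⟨by rw [← NNReal.coe_lt_coe]; norm_num, LipschitzWith.of_dist_le_mul fun Y Y' => ?_⟩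
    have hh : (0 : ℝ) ≤ ((1 / 2 : NNReal) : ℝ) * dist Y Y' := by positivity
    refine (BoundedContinuousFunction.dist_le hh).2 fun p => ?_
    have hsub : T Y p - T Y' p = (w p.1 p.2)⁻¹ • (I (toX Y) p.1 p.2 - I (toX Y') p.1 p.2) := by
      simp only [T, BoundedContinuousFunction.coe_ofNormedAddCommGroup, smul_sub]
    rw [dist_eq_norm, hsub, norm_smul, norm_inv, Real.norm_of_nonneg (hw0 _ _).le,
      inv_mul_le_iff₀ (hw0 _ _)]
    refine (pi_norm_le_iff_of_nonneg (mul_nonneg (hw0 _ _).le hh)).2 fun i => ?_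
    have hd0 : 0 ≤ K * dist Y Y' := by positivity
    have h1 := hIbound (K * dist Y Y') hd0
      (fun i u v => F i u v (toX Y u v) - F i u v (toX Y' u v)) (fun i u v => by
        refine (hK i u v _ _).trans ?_
        rw [mul_assoc]
        refine mul_le_mul_of_nonneg_left ?_ hK0
        refine (pi_norm_le_iff_of_nonneg (mul_nonneg dist_nonneg (hw0 _ _).le)).2 fun j => ?_
        have : toX Y u v j - toX Y' u v j = w u v * (Y (u, v) j - Y' (u, v) j) := by
          simp only [toX]; ring
        rw [Pi.sub_apply, this, norm_mul, Real.norm_of_nonneg (hw0 _ _).le, mul_comm]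
        refine mul_le_mul_of_nonneg_right ?_ (hw0 _ _).le
        calc ‖Y (u, v) j - Y' (u, v) j‖ = ‖(Y (u, v) - Y' (u, v)) j‖ := rfl
          _ ≤ ‖Y (u, v) - Y' (u, v)‖ := norm_le_pi_norm _ j
          _ = dist (Y (u, v)) (Y' (u, v)) := (dist_eq_norm _ _).symm
          _ ≤ dist Y Y' := BoundedContinuousFunction.dist_coe_le_dist _) i p.1 p.2
    have h2 : (I (toX Y) p.1 p.2 - I (toX Y') p.1 p.2) i
        = if dir i then ∫ s in u₀..p.1, (F i s p.2 (toX Y s p.2) - F i s p.2 (toX Y' s p.2))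
          else ∫ s in v₀..p.2, (F i p.1 s (toX Y p.1 s) - F i p.1 s (toX Y' p.1 s)) := by
      have c1 := hFX _ (htoX Y) i
      have c2 := hFX _ (htoX Y') i
      by_cases hi : dir i
      · simp only [I, hi, if_true, Pi.sub_apply]
        rw [intervalIntegral.integral_sub]
        · exact (c1.comp (continuous_id.prodMk continuous_const)).intervalIntegrable _ _
        · exact (c2.comp (continuous_id.prodMk continuous_const)).intervalIntegrable _ _
      · simp only [I, hi, Pi.sub_apply]
        rw [if_neg (by simp), if_neg (by simp), if_neg (by simp), intervalIntegral.integral_sub]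
        · exact (c1.comp (continuous_const.prodMk continuous_id)).intervalIntegrable _ _
        · exact (c2.comp (continuous_const.prodMk continuous_id)).intervalIntegrable _ _
    rw [h2, Real.norm_eq_abs]
    refine h1.trans ?_
    rw [mul_comm]
    refine mul_le_mul_of_nonneg_left ?_ (hw0 _ _).le
    rw [div_le_iff₀ hL]
    have : (0 : ℝ) ≤ dist Y Y' := dist_nonneg
    simp only [NNReal.coe_div, NNReal.coe_one, NNReal.coe_ofNat, hLdef]
    nlinarith
  let Y := ContractingWith.fixedPoint T hT
  have hY : T Y = Y := hT.fixedPoint_isFixedPt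
  refine ⟨toX Y, htoX Y, fun i u v => ?_⟩
  have h1 : w u v * Y (u, v) i = I (toX Y) u v i := by
    have : T Y (u, v) i = Y (u, v) i := by rw [hY]
    rw [← this]
    simp only [T, BoundedContinuousFunction.coe_ofNormedAddCommGroup, Pi.smul_apply, smul_eq_mul]
    rw [mul_inv_cancel_left₀ (hw0 u v).ne']
  change d i u v + w u v * Y (u, v) i = _
  rw [h1]

/-! ### One-sided calculus on half-lines. -/

/-- An order-connected set of reals that is a retract of the line. -/
structure IsLineRetract (s : Set ℝ) : Prop where
  ordConnected : s.OrdConnected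
  exists_retraction : ∃ p : ℝ → ℝ, Continuous p ∧ (∀ x, p x ∈ s) ∧ ∀ x ∈ s, p x = x

theorem isLineRetract_Iic (b : ℝ) : IsLineRetract (Iic b) :=
  ⟨ordConnected_Iic, fun x => min x b, by fun_prop, fun x => min_le_right x b,
    fun _ hx => min_eq_left hx⟩

theorem isLineRetract_Ici (b : ℝ) : IsLineRetract (Ici b) :=
  ⟨ordConnected_Ici, fun x => max x b, by fun_prop, fun x => le_max_right x b,
    fun _ hx => max_eq_left hx⟩

namespace IsLineRetract

variable {s t : Set ℝ}

theorem uIcc_subset (hs : IsLineRetract s) {a b : ℝ} (ha : a ∈ s) (hb : b ∈ s) : uIcc a b ⊆ s :=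
  hs.ordConnected.uIcc_subset ha hb

theorem intervalIntegrable (hs : IsLineRetract s) {f : ℝ → ℝ} (hf : ContinuousOn f s) {a b : ℝ}
    (ha : a ∈ s) (hb : b ∈ s) : IntervalIntegrable f MeasureTheory.volume a b :=
  (hf.mono (hs.uIcc_subset ha hb)).intervalIntegrable

/-- First fundamental theorem of calculus, one-sided at the end points of `s`. -/
theorem hasDerivWithinAt_integral (hs : IsLineRetract s) {g : ℝ → ℝ} (hg : ContinuousOn g s)
    {a x : ℝ} (ha : a ∈ s) (hx : x ∈ s) :
    HasDerivWithinAt (fun x => ∫ y in a..x, g y) (g x) s x := by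
  obtain ⟨p, hp, hps, hpid⟩ := hs.exists_retraction
  have hgp : Continuous (g ∘ p) := by
    rw [← continuousOn_univ]
    exact hg.comp hp.continuousOn fun y _ => hps y
  have e : ∀ y ∈ s, ∫ z in a..y, g z = ∫ z in a..y, (g ∘ p) z := fun y hy =>
    intervalIntegral.integral_congr fun z hz => by
      simp only [Function.comp, hpid z (hs.uIcc_subset ha hy hz)]
  have h := (hgp.integral_hasStrictDerivAt a x).hasDerivAt.hasDerivWithinAt (s := s)
  simp only [Function.comp, hpid x hx] at h
  exact h.congr e (e x hx)

/-- Second fundamental theorem of calculus, one-sided at the end points of `s`. -/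
theorem integral_eq_sub (hs : IsLineRetract s) {f f' : ℝ → ℝ}
    (hf : ∀ x ∈ s, HasDerivWithinAt f (f' x) s x) (hf' : ContinuousOn f' s)
    {a b : ℝ} (ha : a ∈ s) (hb : b ∈ s) : ∫ x in a..b, f' x = f b - f a := by
  refine intervalIntegral.integral_eq_sub_of_hasDeriv_right ?_ ?_ (hs.intervalIntegrable hf' ha hb)
  · exact fun x hx => ((hf x (hs.uIcc_subset ha hb hx)).continuousWithinAt).mono
      (hs.uIcc_subset ha hb)
  · intro x hx
    have hxs : s ∈ nhds x := Filter.mem_of_superset (Icc_mem_nhds hx.1 hx.2)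
      (hs.uIcc_subset ha hb)
    exact ((hf x (mem_of_mem_nhds hxs)).hasDerivAt hxs).hasDerivWithinAt

/-- Continuous functions on a product of retracts extend continuously. -/
theorem exists_extension (hs : IsLineRetract s) (ht : IsLineRetract t) {H : ℝ → ℝ → ℝ}
    (hH : ContinuousOn (Function.uncurry H) (s ×ˢ t)) :
    ∃ G : ℝ → ℝ → ℝ, Continuous (Function.uncurry G) ∧ ∀ x ∈ s, ∀ y ∈ t, G x y = H x y := by
  obtain ⟨p, hp, hps, hpid⟩ := hs.exists_retraction
  obtain ⟨q, hq, hqt, hqid⟩ := ht.exists_retraction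
  refine ⟨fun x y => H (p x) (q y), ?_, fun x hx y hy => by
    simp only [hpid x hx, hqid y hy]⟩
  rw [← continuousOn_univ]
  exact hH.comp (f := fun z : ℝ × ℝ => (p z.1, q z.2)) (by fun_prop)
    fun z _ => ⟨hps z.1, hqt z.2⟩

theorem continuousOn_integral_right (hs : IsLineRetract s) (ht : IsLineRetract t)
    {H : ℝ → ℝ → ℝ} (hH : ContinuousOn (Function.uncurry H) (s ×ˢ t)) {c : ℝ} (hc : c ∈ t) :
    ContinuousOn (Function.uncurry fun x y => ∫ z in c..y, H x z) (s ×ˢ t) := by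
  obtain ⟨G, hG, hGH⟩ := hs.exists_extension ht hH
  have : Continuous (Function.uncurry fun x y => ∫ z in c..y, G x z) :=
    intervalIntegral.continuous_parametric_intervalIntegral_of_continuous
      (f := fun (p : ℝ × ℝ) z => G p.1 z)
      (hG.comp ((continuous_fst.comp continuous_fst).prodMk continuous_snd)) continuous_snd
  refine this.continuousOn.congr fun p hp => ?_
  exact intervalIntegral.integral_congr fun z hz =>
    (hGH p.1 hp.1 z (ht.uIcc_subset hc hp.2 hz)).symm

theorem continuousOn_integral_left (hs : IsLineRetract s) (ht : IsLineRetract t)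
    {H : ℝ → ℝ → ℝ} (hH : ContinuousOn (Function.uncurry H) (s ×ˢ t)) {c : ℝ} (hc : c ∈ s) :
    ContinuousOn (Function.uncurry fun x y => ∫ z in c..x, H z y) (s ×ˢ t) := by
  have h := ht.continuousOn_integral_right hs (H := fun y x => H x y)
    (hH.comp continuous_swap.continuousOn fun _ hp => ⟨hp.2, hp.1⟩) hc
  exact h.comp continuous_swap.continuousOn fun _ hp => ⟨hp.2, hp.1⟩

/-- Differentiation under the integral sign on a product of retracts. -/
theorem hasDerivWithinAt_integral_right (hs : IsLineRetract s) (ht : IsLineRetract t)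
    {A H : ℝ → ℝ → ℝ} (hA : ContinuousOn (Function.uncurry A) (s ×ˢ t))
    (hH : ContinuousOn (Function.uncurry H) (s ×ˢ t))
    (hAH : ∀ x ∈ s, ∀ y ∈ t, HasDerivWithinAt (fun x' => A x' y) (H x y) s x)
    {c x y : ℝ} (hc : c ∈ t) (hx : x ∈ s) (hy : y ∈ t) :
    HasDerivWithinAt (fun x' => ∫ z in c..y, A x' z) (∫ z in c..y, H x z) s x := by
  obtain ⟨G, hG, hGH⟩ := hs.exists_extension ht hH
  have hsl : ∀ x' ∈ s, ContinuousOn (A x') t := fun x' hx' =>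
    hA.comp (f := fun z : ℝ => (x', z)) (by fun_prop) fun z hz => ⟨hx', hz⟩
  have hsl' : ∀ z ∈ t, ContinuousOn (fun x' => H x' z) s := fun z hz =>
    hH.comp (f := fun x' : ℝ => (x', z)) (by fun_prop) fun x' hx' => ⟨hx', hz⟩
  -- Write A as the integral of its x-derivative and swap the integrals. The continuous extension G
  -- makes the inner integral continuous on the whole line, so the fundamental theorem applies even
  -- at an end point of s.
  have e : ∀ x' ∈ s, ∫ z in c..y, A x' z
      = (∫ z in c..y, A x z) + ∫ w in x..x', ∫ z in c..y, G w z := by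
    intro x' hx'
    rw [MeasureTheory.intervalIntegral_intervalIntegral_swap, ← sub_eq_iff_eq_add',
      ← intervalIntegral.integral_sub (ht.intervalIntegrable (hsl x' hx') hc hy)
        (ht.intervalIntegrable (hsl x hx) hc hy)]
    · refine intervalIntegral.integral_congr fun z hz => ?_
      have hzt := ht.uIcc_subset hc hy hz
      rw [← hs.integral_eq_sub (fun w hw => hAH w hw z hzt) (hsl' z hzt) hx hx']
      exact intervalIntegral.integral_congr fun w hw =>
        (hGH w (hs.uIcc_subset hx hx' hw) z hzt).symm
    · exact (hG.continuousOn.integrableOn_compact (isCompact_uIcc.prod isCompact_uIcc)).mono_set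
        (prod_mono uIoc_subset_uIcc uIoc_subset_uIcc)
  have hGi : Continuous fun w => ∫ z in c..y, G w z :=
    intervalIntegral.continuous_parametric_intervalIntegral_of_continuous' hG c y
  have h := ((hGi.integral_hasStrictDerivAt x x).hasDerivAt.hasDerivWithinAt (s := s)).const_add
    (∫ z in c..y, A x z)
  have e2 : ∫ z in c..y, G x z = ∫ z in c..y, H x z :=
    intervalIntegral.integral_congr fun z hz => hGH x hx z (ht.uIcc_subset hc hy hz)
  rw [e2] at h
  exact h.congr e (e x hx)

theorem hasDerivWithinAt_integral_left (hs : IsLineRetract s) (ht : IsLineRetract t)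
    {A H : ℝ → ℝ → ℝ} (hA : ContinuousOn (Function.uncurry A) (s ×ˢ t))
    (hH : ContinuousOn (Function.uncurry H) (s ×ˢ t))
    (hAH : ∀ x ∈ s, ∀ y ∈ t, HasDerivWithinAt (fun y' => A x y') (H x y) t y)
    {c x y : ℝ} (hc : c ∈ s) (hx : x ∈ s) (hy : y ∈ t) :
    HasDerivWithinAt (fun y' => ∫ z in c..x, A z y') (∫ z in c..x, H z y) t y :=
  ht.hasDerivWithinAt_integral_right hs (A := fun y x => A x y) (H := fun y x => H x y)
    (hA.comp continuous_swap.continuousOn fun _ hp => ⟨hp.2, hp.1⟩)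
    (hH.comp continuous_swap.continuousOn fun _ hp => ⟨hp.2, hp.1⟩)
    (fun y hy x hx => hAH x hx y hy) hc hy hx

end IsLineRetract

/-! ### Differentiability from partial derivatives. -/

-- The increment is split at (x₀, y). Along x the mean value inequality uses continuity of `fu`;
-- along y only the derivative at the single point y₀ on the slice x₀ is needed.
open Filter Topology Asymptotics in
theorem hasFDerivWithinAt_of_partials {s t : Set ℝ} (hs : Convex ℝ s) {f fu : ℝ → ℝ → ℝ}
    {b x₀ y₀ : ℝ} (hx₀ : x₀ ∈ s)
    (hu : ∀ x ∈ s, ∀ y ∈ t, HasDerivWithinAt (fun x' => f x' y) (fu x y) s x)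
    (hv : HasDerivWithinAt (fun y' => f x₀ y') b t y₀)
    (hc : ContinuousWithinAt (Function.uncurry fu) (s ×ˢ t) (x₀, y₀)) :
    HasFDerivWithinAt (Function.uncurry f)
      (fu x₀ y₀ • ContinuousLinearMap.fst ℝ ℝ ℝ + b • ContinuousLinearMap.snd ℝ ℝ ℝ)
      (s ×ˢ t) (x₀, y₀) := by
  rw [hasFDerivWithinAt_iff_isLittleO, isLittleO_iff]
  intro ε hε
  have h1 : ∀ᶠ p : ℝ × ℝ in 𝓝[s ×ˢ t] (x₀, y₀),
      ‖f x₀ p.2 - f x₀ y₀ - (p.2 - y₀) * b‖ ≤ ε / 2 * ‖p.2 - y₀‖ := by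
    have := (isLittleO_iff.1 (hasDerivWithinAt_iff_isLittleO.1 hv)) (half_pos hε)
    have ht : Tendsto (Prod.snd : ℝ × ℝ → ℝ) (𝓝[s ×ˢ t] (x₀, y₀)) (𝓝[t] y₀) :=
      tendsto_nhdsWithin_iff.2 ⟨(continuous_snd.tendsto (x₀, y₀)).mono_left nhdsWithin_le_nhds,
        eventually_nhdsWithin_of_forall fun p hp => hp.2⟩
    simpa only [smul_eq_mul] using ht.eventually this
  obtain ⟨δ, hδ, hball⟩ := Metric.continuousWithinAt_iff.1 hc (ε / 2) (half_pos hε)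
  filter_upwards [h1, self_mem_nhdsWithin, mem_nhdsWithin_of_mem_nhds
    (Metric.ball_mem_nhds (x₀, y₀) hδ)] with p hp1 hpm hpb
  have hpb' : |p.1 - x₀| < δ ∧ |p.2 - y₀| < δ := by
    simpa [Prod.dist_eq, Real.dist_eq] using hpb
  have hseg : segment ℝ x₀ p.1 ⊆ s := hs.segment_subset hx₀ hpm.1
  have h2 : ‖(f p.1 p.2 - fu x₀ y₀ * p.1) - (f x₀ p.2 - fu x₀ y₀ * x₀)‖
      ≤ ε / 2 * ‖p.1 - x₀‖ := by
    refine (convex_segment x₀ p.1).norm_image_sub_le_of_norm_hasDerivWithin_le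
      (f := fun x => f x p.2 - fu x₀ y₀ * x) (f' := fun x => fu x p.2 - fu x₀ y₀) ?_ ?_
      (left_mem_segment ℝ x₀ p.1) (right_mem_segment ℝ x₀ p.1)
    · intro x hx
      have := (hu x (hseg hx) p.2 hpm.2).sub
        ((hasDerivWithinAt_id x s).const_mul (fu x₀ y₀))
      simp only [mul_one] at this
      exact this.mono hseg
    · intro x hx
      have hx' : |x - x₀| ≤ |p.1 - x₀| := by
        rw [segment_eq_uIcc] at hx
        exact abs_sub_left_of_mem_uIcc hx
      have := hball (x := (x, p.2)) ⟨hseg hx, hpm.2⟩ (by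
        simp only [Prod.dist_eq, Real.dist_eq, max_lt_iff]
        exact ⟨hx'.trans_lt hpb'.1, hpb'.2⟩)
      exact le_of_lt (by simpa [Function.uncurry, Real.dist_eq] using this)
  have h3 : ‖p.1 - x₀‖ ≤ ‖p - (x₀, y₀)‖ := norm_fst_le (p - (x₀, y₀))
  have h4 : ‖p.2 - y₀‖ ≤ ‖p - (x₀, y₀)‖ := norm_snd_le (p - (x₀, y₀))
  have h5 : Function.uncurry f p - Function.uncurry f (x₀, y₀)
      - (fu x₀ y₀ • ContinuousLinearMap.fst ℝ ℝ ℝ + b • ContinuousLinearMap.snd ℝ ℝ ℝ)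
        (p - (x₀, y₀))
      = ((f p.1 p.2 - fu x₀ y₀ * p.1) - (f x₀ p.2 - fu x₀ y₀ * x₀))
        + (f x₀ p.2 - f x₀ y₀ - (p.2 - y₀) * b) := by
    simp [Function.uncurry]
    ring
  rw [h5]
  refine (norm_add_le _ _).trans ?_
  nlinarith

/-- A function with `Cⁿ` partial derivatives on a product of intervals is `Cⁿ⁺¹`. -/
theorem contDiffOn_succ_of_partials {s t : Set ℝ} (hs : Convex ℝ s)
    (hsu : UniqueDiffOn ℝ s) (htu : UniqueDiffOn ℝ t) {f fu fv : ℝ → ℝ → ℝ} {n : ℕ}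
    (hu : ∀ x ∈ s, ∀ y ∈ t, HasDerivWithinAt (fun x' => f x' y) (fu x y) s x)
    (hv : ∀ x ∈ s, ∀ y ∈ t, HasDerivWithinAt (fun y' => f x y') (fv x y) t y)
    (hfu : ContDiffOn ℝ n (Function.uncurry fu) (s ×ˢ t))
    (hfv : ContDiffOn ℝ n (Function.uncurry fv) (s ×ˢ t)) :
    ContDiffOn ℝ (n + 1) (Function.uncurry f) (s ×ˢ t) := by
  rw [contDiffOn_succ_iff_hasFDerivWithinAt_of_uniqueDiffOn (hsu.prod htu)]
  refine ⟨by simp, fun p => fu p.1 p.2 • ContinuousLinearMap.fst ℝ ℝ ℝ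
    + fv p.1 p.2 • ContinuousLinearMap.snd ℝ ℝ ℝ, ?_, ?_⟩
  · exact (hfu.smul contDiffOn_const).add (hfv.smul contDiffOn_const)
  · rintro ⟨x, y⟩ ⟨hx, hy⟩
    exact hasFDerivWithinAt_of_partials hs hx hu (hv x hx y hy) (hfu.continuousOn (x, y) ⟨hx, hy⟩)

/-! ### Uniqueness for the Goursat problem. -/

open MeasureTheory in
/-- Uniqueness for homogeneous Goursat inequalities on a characteristic rectangle. -/
theorem eq_zero_of_goursat_inequality {ι : Type*} [Fintype ι] {a b c d : ℝ} (hab : a ≤ b)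
    (hcd : c ≤ d) (δ : ℝ → ℝ → ι → ℝ)
    (hδ : ContinuousOn (Function.uncurry δ) (Icc a b ×ˢ Icc c d)) {K : ℝ} (hK : 0 ≤ K)
    (h : ∀ i, ∀ u ∈ Icc a b, ∀ v ∈ Icc c d,
      |δ u v i| ≤ K * ∫ s in u..b, ‖δ s v‖ ∨ |δ u v i| ≤ K * ∫ s in c..v, ‖δ u s‖) :
    ∀ u ∈ Icc a b, ∀ v ∈ Icc c d, δ u v = 0 := by
  set L : ℝ := 2 * K + 1
  have hL : 0 < L := by positivity
  -- The weight grows away from the initial sides u = b and v = c. If N is the maximum of the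
  -- weighted norm, the inequality yields N ≤ (K/L) N ≤ N/2.
  let w : ℝ → ℝ → ℝ := fun u v => Real.exp (L * (v - u))
  have hw0 : ∀ u v, 0 < w u v := fun u v => Real.exp_pos _
  have hne : (Icc a b ×ˢ Icc c d).Nonempty :=
    ⟨(a, c), ⟨⟨le_rfl, hab⟩, ⟨le_rfl, hcd⟩⟩⟩
  have hcont : ContinuousOn (fun p : ℝ × ℝ => ‖δ p.1 p.2‖ / w p.1 p.2) (Icc a b ×ˢ Icc c d) :=
    hδ.norm.div (by fun_prop) fun p _ => (hw0 _ _).ne'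
  obtain ⟨p₀, hp₀, hmax⟩ := (isCompact_Icc.prod isCompact_Icc).exists_isMaxOn hne hcont
  set N := ‖δ p₀.1 p₀.2‖ / w p₀.1 p₀.2 with hN
  have hN0 : 0 ≤ N := div_nonneg (norm_nonneg _) (hw0 _ _).le
  have hle : ∀ u ∈ Icc a b, ∀ v ∈ Icc c d, ‖δ u v‖ ≤ N * w u v := fun u hu v hv =>
    (div_le_iff₀ (hw0 u v)).1 (hmax (show (u, v) ∈ Icc a b ×ˢ Icc c d from ⟨hu, hv⟩))
  have hint : ∀ {g : ℝ → ℝ} {x y : ℝ}, x ≤ y → ContinuousOn g (Icc x y) →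
      IntervalIntegrable g volume x y := fun hxy hg => by
    rw [← uIcc_of_le hxy] at hg
    exact hg.intervalIntegrable
  have key : ∀ i, ∀ u ∈ Icc a b, ∀ v ∈ Icc c d, |δ u v i| ≤ K * (N / L * w u v) := by
    intro i u hu v hv
    rcases h i u hu v hv with h1 | h1
    · refine h1.trans (mul_le_mul_of_nonneg_left ?_ hK)
      have h2 : ∫ s in u..b, ‖δ s v‖ ≤ ∫ s in u..b, N * w s v := by
        refine intervalIntegral.integral_mono_on hu.2 (hint hu.2 ?_) (hint hu.2 (by fun_prop)) ?_
        · exact (hδ.norm.comp (f := fun s : ℝ => (s, v)) (by fun_prop)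
            fun s hs => ⟨⟨hu.1.trans hs.1, hs.2⟩, hv⟩)
        · exact fun s hs => hle s ⟨hu.1.trans hs.1, hs.2⟩ v hv
      have h3 : ∫ s in u..b, N * w s v = -(N / L * w b v) - -(N / L * w u v) := by
        refine intervalIntegral.integral_eq_sub_of_hasDerivAt
          (f := fun s => -(N / L * w s v)) ?_ (hint hu.2 (by fun_prop))
        intro s _
        have := (((((hasDerivAt_id s).const_sub v).const_mul L).exp).const_mul (N / L)).neg
        refine this.congr_deriv ?_
        simp only [id, w]
        field_simp
      have : 0 ≤ N / L * w b v := by have := (hw0 b v).le; positivity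
      linarith
    · refine h1.trans (mul_le_mul_of_nonneg_left ?_ hK)
      have h2 : ∫ s in c..v, ‖δ u s‖ ≤ ∫ s in c..v, N * w u s := by
        refine intervalIntegral.integral_mono_on hv.1 (hint hv.1 ?_) (hint hv.1 (by fun_prop)) ?_
        · exact (hδ.norm.comp (f := fun s : ℝ => (u, s)) (by fun_prop)
            fun s hs => ⟨hu, ⟨hs.1, hs.2.trans hv.2⟩⟩)
        · exact fun s hs => hle u hu s ⟨hs.1, hs.2.trans hv.2⟩
      have h3 : ∫ s in c..v, N * w u s = N / L * w u v - N / L * w u c := by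
        refine intervalIntegral.integral_eq_sub_of_hasDerivAt
          (f := fun s => N / L * w u s) ?_ (hint hv.1 (by fun_prop))
        intro s _
        have := (((((hasDerivAt_id s).sub_const u).const_mul L).exp).const_mul (N / L))
        refine this.congr_deriv ?_
        simp only [id, w]
        field_simp
      have : 0 ≤ N / L * w u c := by have := (hw0 u c).le; positivity
      linarith
  have hNzero : N = 0 := by
    have h1 : ‖δ p₀.1 p₀.2‖ ≤ K * (N / L * w p₀.1 p₀.2) := by
      have := (hw0 p₀.1 p₀.2).le
      exact (pi_norm_le_iff_of_nonneg (by positivity)).2 fun i => key i _ hp₀.1 _ hp₀.2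
    have h2 : N ≤ K * (N / L) := by
      rw [hN, div_le_iff₀ (hw0 _ _), ← hN]
      linarith
    have h3 : K * (N / L) ≤ N / 2 := by
      rw [mul_div_assoc', div_le_div_iff₀ hL two_pos]
      simp only [L]; nlinarith
    linarith
  intro u hu v hv
  have := hle u hu v hv
  rw [hNzero, zero_mul] at this
  exact norm_le_zero_iff.1 this

/-! ### The first order system for the state, and its regular set. -/

namespace GammaProblem

/-- The common factor `∂_u ∂_v r` of the equations, in terms of the state
`(r, λ, ν, r φ, ∂_u (r φ), m)`. -/
noncomputable def radiusSource (x : Fin 6 → ℝ) : ℝ :=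
  x 1 * x 2 * (2 * x 5 / (x 0 ^ 2 * (1 - 2 * x 5 / x 0)))

/-- Right-hand sides of the evolution equations of the state `(r, λ, ν, r φ, ∂_u (r φ), m)`. -/
noncomputable def evolution (x : Fin 6 → ℝ) : Fin 6 → ℝ :=
  ![x 1, radiusSource x, radiusSource x, x 4, radiusSource x * (x 3 / x 0),
    1 / 2 * (1 - 2 * x 5 / x 0) * (x 4 - x 2 * (x 3 / x 0)) ^ 2 / x 2]

/-- Whether a component of the state is evolved in the direction of `u`. -/
def evolvesInU : Fin 6 → Bool := ![false, true, false, true, false, true]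

namespace Fields

/-- The state `(r, λ, ν, r φ, ∂_u (r φ), m)`. -/
noncomputable def state (S : Fields) (R u v : ℝ) : Fin 6 → ℝ :=
  ![S.r u v, S.lam R u v, S.nu R u v, S.r u v * S.φ u v,
    S.nu R u v * S.φ u v + S.zeta R u v, S.m u v]

end Fields

/-- States without a degenerate denominator. -/
def regularStates : Set (Fin 6 → ℝ) := {x | 0 < x 0 ∧ x 2 < 0 ∧ 0 < x 0 - 2 * x 5}

theorem one_sub_pos_of_mem_regularStates {x : Fin 6 → ℝ} (hx : x ∈ regularStates) :
    0 < 1 - 2 * x 5 / x 0 := by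
  rw [sub_pos, div_lt_one hx.1]; linarith [hx.2.2]

theorem contDiffOn_evolution : ContDiffOn ℝ 1 evolution regularStates := by
  have h0 : ∀ x ∈ regularStates, x 0 ≠ 0 := fun x hx => hx.1.ne'
  have h2 : ∀ x ∈ regularStates, x 2 ≠ 0 := fun x hx => hx.2.1.ne
  have hm : ∀ x ∈ regularStates, 1 - 2 * x 5 / x 0 ≠ 0 := fun x hx =>
    (one_sub_pos_of_mem_regularStates hx).ne'
  have hh : ContDiffOn ℝ 1 (fun x : Fin 6 → ℝ => 1 - 2 * x 5 / x 0) regularStates :=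
    contDiffOn_const.sub ((by fun_prop : ContDiffOn ℝ 1 (fun x : Fin 6 → ℝ => 2 * x 5) _).div
      (by fun_prop) h0)
  have hs : ContDiffOn ℝ 1 radiusSource regularStates := by
    refine ContDiffOn.mul (by fun_prop) (ContDiffOn.div (by fun_prop)
      (ContDiffOn.mul (by fun_prop) hh) fun x hx => ?_)
    exact mul_ne_zero (pow_ne_zero _ (h0 x hx)) (hm x hx)
  have hφ : ContDiffOn ℝ 1 (fun x : Fin 6 → ℝ => x 3 / x 0) regularStates :=
    ContDiffOn.div (by fun_prop) (by fun_prop) h0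
  refine contDiffOn_pi.2 fun i => ?_
  fin_cases i
  · exact (by fun_prop : ContDiff ℝ 1 fun x : Fin 6 → ℝ => x 1).contDiffOn
  · exact hs
  · exact hs
  · exact (by fun_prop : ContDiff ℝ 1 fun x : Fin 6 → ℝ => x 4).contDiffOn
  · exact hs.mul hφ
  · refine ContDiffOn.div ((contDiffOn_const.mul hh).mul ?_) (by fun_prop) h2
    exact ContDiffOn.pow (ContDiffOn.sub (by fun_prop) (ContDiffOn.mul (by fun_prop) hφ)) 2

/-- The regular set is given by strict linear inequalities, whose minimum is concave. Superlevel
sets of that minimum, intersected with a ball, are convex and compact. -/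
theorem exists_convex_compact_regularStates {A : Set (Fin 6 → ℝ)} (hA : IsCompact A)
    (hA' : A ⊆ regularStates) :
    ∃ B, A ⊆ B ∧ B ⊆ regularStates ∧ Convex ℝ B ∧ IsCompact B := by
  rcases A.eq_empty_or_nonempty with rfl | hne
  · exact ⟨∅, subset_rfl, empty_subset _, convex_empty, isCompact_empty⟩
  have hcont : Continuous fun x : Fin 6 → ℝ => min (x 0) (min (-x 2) (x 0 - 2 * x 5)) := by
    fun_prop
  obtain ⟨x₀, hx₀, hmin⟩ := hA.exists_isMinOn hne hcont.continuousOn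
  obtain ⟨r, hr⟩ := hA.isBounded.subset_closedBall 0
  set ε := min (x₀ 0) (min (-x₀ 2) (x₀ 0 - 2 * x₀ 5))
  have hε : 0 < ε := lt_min (hA' hx₀).1 (lt_min (neg_pos.2 (hA' hx₀).2.1) (hA' hx₀).2.2)
  refine ⟨Metric.closedBall 0 r ∩ {x | ε ≤ min (x 0) (min (-x 2) (x 0 - 2 * x 5))},
    fun x hx => ⟨hr hx, hmin hx⟩, ?_, ?_, ?_⟩
  · rintro x ⟨-, hx⟩
    simp only [mem_ofPred_eq, le_min_iff] at hx
    exact ⟨by linarith, by linarith, by linarith⟩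
  · refine (convex_closedBall _ _).inter ?_
    intro x hx y hy a b ha hb hab
    simp only [mem_ofPred_eq, le_min_iff, Pi.add_apply, Pi.smul_apply, smul_eq_mul] at hx hy ⊢
    have hb' : b = 1 - a := by linarith
    subst hb'
    refine ⟨?_, ?_, ?_⟩ <;> nlinarith
  · exact (isCompact_closedBall _ _).inter_right (isClosed_le continuous_const hcont)

/-- A C¹ map is Lipschitz on a compact convex set, whereas the images of two solutions need not be
convex; hence the passage to a convex compact set containing both. -/
theorem exists_lipschitz_evolution {A B : Set (Fin 6 → ℝ)} (hA : IsCompact A) (hB : IsCompact B)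
    (hA' : A ⊆ regularStates) (hB' : B ⊆ regularStates) :
    ∃ K : ℝ, 0 ≤ K ∧ ∀ x ∈ A, ∀ y ∈ B, ‖evolution x - evolution y‖ ≤ K * ‖x - y‖ := by
  obtain ⟨E, hABE, hE, hconv, hcomp⟩ :=
    exists_convex_compact_regularStates (hA.union hB) (union_subset hA' hB')
  obtain ⟨K, hK⟩ := (contDiffOn_evolution.mono hE).exists_lipschitzOnWith one_ne_zero hconv hcomp
  exact ⟨K, K.2, fun x hx y hy => hK.norm_sub_le (hABE (Or.inl hx)) (hABE (Or.inr hy))⟩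

theorem pos_of_continuousOn_of_ne_zero {f : ℝ → ℝ} {a b : ℝ} (hab : a ≤ b)
    (hf : ContinuousOn f (uIcc a b)) (h0 : ∀ x ∈ uIcc a b, f x ≠ 0) (ha : 0 < f a) : 0 < f b := by
  by_contra! h
  rw [uIcc_of_le hab] at *
  obtain ⟨x, hx, hx0⟩ := intermediate_value_Icc' hab hf ⟨h, ha.le⟩
  exact h0 x hx hx0

theorem uniqueDiffOn_wedge (R : ℝ) : UniqueDiffOn ℝ (wedge R) :=
  (uniqueDiffOn_Iic _).prod (uniqueDiffOn_Ici _)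

/-! ### Partial derivatives on relatively open subsets of the wedge. -/

section Slices

variable {R : ℝ} {D : Set (ℝ × ℝ)} {f : ℝ → ℝ → ℝ} {n : ℕ}

theorem preimage_slice_mem_nhdsWithin {U : Set (ℝ × ℝ)} (hU : IsOpen U) (hD : D = U ∩ wedge R)
    {u v : ℝ} (h : (u, v) ∈ D) :
    {u' | (u', v) ∈ D} ∈ nhdsWithin u (Iic (-R)) ∧ {v' | (u, v') ∈ D} ∈ nhdsWithin v (Ici R) := by
  subst hD
  constructor
  · have : {u' | (u', v) ∈ U} ∈ nhds u :=
      (hU.preimage (by fun_prop : Continuous fun u' : ℝ => (u', v))).mem_nhds h.1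
    filter_upwards [mem_nhdsWithin_of_mem_nhds this, self_mem_nhdsWithin] with u' h1 h2
    exact ⟨h1, h2, h.2.2⟩
  · have : {v' | (u, v') ∈ U} ∈ nhds v :=
      (hU.preimage (by fun_prop : Continuous fun v' : ℝ => (u, v'))).mem_nhds h.1
    filter_upwards [mem_nhdsWithin_of_mem_nhds this, self_mem_nhdsWithin] with v' h1 h2
    exact ⟨h1, h.2.1, h2⟩

theorem hasDerivWithinAt_slices (hD : ∃ U, IsOpen U ∧ D = U ∩ wedge R)
    (hf : DifferentiableOn ℝ (Function.uncurry f) D) {u v : ℝ} (h : (u, v) ∈ D) :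
    HasDerivWithinAt (fun u' => f u' v) (fderivWithin ℝ (Function.uncurry f) D (u, v) (1, 0))
        (Iic (-R)) u ∧
      HasDerivWithinAt (fun v' => f u v') (fderivWithin ℝ (Function.uncurry f) D (u, v) (0, 1))
        (Ici R) v := by
  obtain ⟨U, hU, hDU⟩ := hD
  obtain ⟨h1, h2⟩ := preimage_slice_mem_nhdsWithin hU hDU h
  have hfd := (hf (u, v) h).hasFDerivWithinAt
  constructor
  · have hc : HasDerivWithinAt (fun u' : ℝ => (u', v)) ((1 : ℝ), (0 : ℝ)) {u' | (u', v) ∈ D} u :=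
      ((hasDerivAt_id u).prodMk (hasDerivAt_const u v)).hasDerivWithinAt
    exact (hfd.comp_hasDerivWithinAt u hc fun x hx => hx).mono_of_mem_nhdsWithin h1
  · have hc : HasDerivWithinAt (fun v' : ℝ => (u, v')) ((0 : ℝ), (1 : ℝ)) {v' | (u, v') ∈ D} v :=
      ((hasDerivAt_const v u).prodMk (hasDerivAt_id v)).hasDerivWithinAt
    exact (hfd.comp_hasDerivWithinAt v hc fun x hx => hx).mono_of_mem_nhdsWithin h2

theorem partialU_eq (hD : ∃ U, IsOpen U ∧ D = U ∩ wedge R)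
    (hf : DifferentiableOn ℝ (Function.uncurry f) D) {u v : ℝ} (h : (u, v) ∈ D) :
    HasDerivWithinAt (fun u' => f u' v) (partialU R f u v) (Iic (-R)) u := by
  exact (hasDerivWithinAt_slices hD hf h).1.differentiableWithinAt.hasDerivWithinAt

theorem partialV_eq (hD : ∃ U, IsOpen U ∧ D = U ∩ wedge R)
    (hf : DifferentiableOn ℝ (Function.uncurry f) D) {u v : ℝ} (h : (u, v) ∈ D) :
    HasDerivWithinAt (fun v' => f u v') (partialV R f u v) (Ici R) v := by
  exact (hasDerivWithinAt_slices hD hf h).2.differentiableWithinAt.hasDerivWithinAt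

theorem continuousOn_partials (hD : ∃ U, IsOpen U ∧ D = U ∩ wedge R)
    (hf : ContDiffOn ℝ 1 (Function.uncurry f) D) :
    ContinuousOn (Function.uncurry (partialU R f)) D ∧
      ContinuousOn (Function.uncurry (partialV R f)) D := by
  have hu : UniqueDiffOn ℝ D := by
    obtain ⟨U, hU, rfl⟩ := hD
    rw [inter_comm]
    exact (uniqueDiffOn_wedge R).inter hU
  have hsub : D ⊆ wedge R := by
    obtain ⟨U, hU, rfl⟩ := hD
    exact inter_subset_right
  have hc := hf.continuousOn_fderivWithin hu le_rfl
  have hd := hf.differentiableOn one_ne_zero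
  constructor
  · refine (hc.clm_apply (continuousOn_const (c := ((1 : ℝ), (0 : ℝ))))).congr fun p hp => ?_
    exact (hasDerivWithinAt_slices hD hd hp).1.derivWithin
      (uniqueDiffOn_Iic _ _ (hsub hp).1)
  · refine (hc.clm_apply (continuousOn_const (c := ((0 : ℝ), (1 : ℝ))))).congr fun p hp => ?_
    exact (hasDerivWithinAt_slices hD hd hp).2.derivWithin
      (uniqueDiffOn_Ici _ _ (hsub hp).2)

end Slices

namespace CharData

variable {R C M m₀ : ℝ} (d : CharData R C M m₀)

theorem rOut_eq {v : ℝ} (hv : v ∈ Ici R) : d.rOut v = v := by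
  have h := (isLineRetract_Ici R).integral_eq_sub d.rOut_deriv continuousOn_const self_mem_Ici hv
  rw [d.rOut_corner] at h
  simp at h
  linarith

theorem rIn_eq {u : ℝ} (hu : u ∈ Iic (-R)) : d.rIn u = -u := by
  have h := (isLineRetract_Iic (-R)).integral_eq_sub d.rIn_deriv continuousOn_const
    self_mem_Iic hu
  rw [d.rIn_corner] at h
  simp at h
  linarith

end CharData

end GammaProblem

/-! ### Uniqueness of developments. -/

namespace GammaProblem

namespace IsDevelopment

variable {R C M m₀ : ℝ} {d : CharData R C M m₀} {D : Set (ℝ × ℝ)} {S : Fields}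

theorem mem_of_le (h : IsDevelopment d D S) {u v u' v' : ℝ} (hD : (u, v) ∈ D)
    (hu : u' ∈ Icc u (-R)) (hv : v' ∈ Icc R v) : (u', v') ∈ D :=
  h.past_set u v u' v' hD ⟨hu.2, hv.1⟩ hu.1 hv.2

theorem hasDerivWithinAt_r (h : IsDevelopment d D S) {u v : ℝ} (hD : (u, v) ∈ D) :
    HasDerivWithinAt (fun u' => S.r u' v) (S.nu R u v) (Iic (-R)) u ∧
      HasDerivWithinAt (fun v' => S.r u v') (S.lam R u v) (Ici R) v :=
  ⟨partialU_eq h.rel_open (h.regular.r_c2.differentiableOn two_ne_zero) hD,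
    partialV_eq h.rel_open (h.regular.r_c2.differentiableOn two_ne_zero) hD⟩

theorem hasDerivWithinAt_phi (h : IsDevelopment d D S) {u v : ℝ} (hD : (u, v) ∈ D) :
    HasDerivWithinAt (fun u' => S.φ u' v) (S.zeta R u v / S.r u v) (Iic (-R)) u ∧
      HasDerivWithinAt (fun v' => S.φ u v') (S.theta R u v / S.r u v) (Ici R) v := by
  have h0 := (h.solves.r_pos u v hD).ne'
  rw [Fields.zeta, Fields.theta, mul_div_cancel_left₀ _ h0, mul_div_cancel_left₀ _ h0]
  exact ⟨partialU_eq h.rel_open (h.regular.phi_c2.differentiableOn two_ne_zero) hD,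
    partialV_eq h.rel_open (h.regular.phi_c2.differentiableOn two_ne_zero) hD⟩

theorem continuousOn_state (h : IsDevelopment d D S) :
    ContinuousOn (Function.uncurry (S.state R)) D := by
  have hr := continuousOn_partials h.rel_open (h.regular.r_c2.of_le one_le_two)
  have hφ := continuousOn_partials h.rel_open (h.regular.phi_c2.of_le one_le_two)
  have cr := h.regular.r_c2.continuousOn
  have cφ := h.regular.phi_c2.continuousOn
  refine continuousOn_pi.2 fun i => ?_
  fin_cases i
  · exact cr
  · exact hr.2
  · exact hr.1
  · exact cr.mul cφ
  · exact (hr.1.mul cφ).add (cr.mul hφ.1)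
  · exact h.regular.m_c2.continuousOn

theorem hasDerivWithinAt_state_u (h : IsDevelopment d D S) {u v : ℝ} (hD : (u, v) ∈ D)
    {i : Fin 6} (hi : evolvesInU i = true) :
    HasDerivWithinAt (fun u' => S.state R u' v i) (evolution (S.state R u v) i) (Iic (-R)) u := by
  have hr := (h.solves.r_pos u v hD).ne'
  have hμ := h.solves.one_sub_mu_ne u v hD
  have hν := h.solves.nu_ne u v hD
  fin_cases i
  · simp [evolvesInU] at hi
  · refine (h.solves.du_lam u v hD).congr_deriv ?_
    simp [evolution, radiusSource, Fields.state]
    change _ = _ * (_ / (_ * (1 - S.mu u v)))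
    field_simp
  · simp [evolvesInU] at hi
  · refine ((h.hasDerivWithinAt_r hD).1.mul (h.hasDerivWithinAt_phi hD).1).congr_deriv ?_
    simp [evolution, Fields.state]
    field_simp
  · simp [evolvesInU] at hi
  · refine (h.solves.du_m u v hD).congr_deriv ?_
    simp [evolution, Fields.state]
    change _ = _ * (1 - S.mu u v) * _ ^ 2 / _
    field_simp
    ring

/-- In component 4 the term νθ/r from ∂_v(νφ) cancels ∂_vζ, leaving φ ∂_vν. Thus θ drops out and the
state forms a closed system. -/
theorem hasDerivWithinAt_state_v (h : IsDevelopment d D S) {u v : ℝ} (hD : (u, v) ∈ D)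
    {i : Fin 6} (hi : evolvesInU i = false) :
    HasDerivWithinAt (fun v' => S.state R u v' i) (evolution (S.state R u v) i) (Ici R) v := by
  have hr := (h.solves.r_pos u v hD).ne'
  have hμ := h.solves.one_sub_mu_ne u v hD
  fin_cases i
  · exact (h.hasDerivWithinAt_r hD).2
  · simp [evolvesInU] at hi
  · refine (h.solves.dv_nu u v hD).congr_deriv ?_
    simp [evolution, radiusSource, Fields.state]
    change _ = _ * (_ / (_ * (1 - S.mu u v)))
    field_simp
  · simp [evolvesInU] at hi
  · refine (((h.solves.dv_nu u v hD).mul (h.hasDerivWithinAt_phi hD).2).add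
      (h.solves.dv_zeta u v hD)).congr_deriv ?_
    simp [evolution, radiusSource, Fields.state]
    change _ = _ * (_ / (_ * (1 - S.mu u v))) * _
    field_simp
    ring
  · simp [evolvesInU] at hi

theorem lam_out (h : IsDevelopment d D S) {v : ℝ} (hv : v ∈ Ici R) : S.lam R (-R) v = 1 := by
  have : HasDerivWithinAt (fun v' => S.r (-R) v') 1 (Ici R) v :=
    (d.rOut_deriv v hv).congr (fun v' hv' => h.r_out v' hv') (h.r_out v hv)
  exact this.derivWithin (uniqueDiffOn_Ici _ _ hv)

theorem nu_in (h : IsDevelopment d D S) {u : ℝ} (hu : u ∈ Iic (-R)) : S.nu R u R = -1 := by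
  have : HasDerivWithinAt (fun u' => S.r u' R) (-1) (Iic (-R)) u :=
    (d.rIn_deriv u hu).congr (fun u' hu' => h.r_in u' hu') (h.r_in u hu)
  exact this.derivWithin (uniqueDiffOn_Iic _ _ hu)

theorem zeta_in (h : IsDevelopment d D S) {u : ℝ} (hu : u ∈ Iic (-R)) :
    S.zeta R u R = d.rIn u * derivWithin d.φIn (Iic (-R)) u := by
  rw [Fields.zeta, h.r_in u hu]
  congr 1
  exact derivWithin_congr (fun u' hu' => h.φ_in u' hu') (h.φ_in u hu)

theorem state_out (h : IsDevelopment d D S) {v : ℝ} (hv : v ∈ Ici R) {i : Fin 6}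
    (hi : evolvesInU i = true) :
    S.state R (-R) v i = ![0, 1, 0, d.rOut v * d.φOut v, 0, d.mOut v] i := by
  fin_cases i
  · simp [evolvesInU] at hi
  · exact h.lam_out hv
  · simp [evolvesInU] at hi
  · simp [Fields.state, h.r_out v hv, h.φ_out v hv]
  · simp [evolvesInU] at hi
  · exact h.m_out v hv

theorem state_in (h : IsDevelopment d D S) {u : ℝ} (hu : u ∈ Iic (-R)) {i : Fin 6}
    (hi : evolvesInU i = false) :
    S.state R u R i = ![d.rIn u, 0, -1, 0,
      -1 * d.φIn u + d.rIn u * derivWithin d.φIn (Iic (-R)) u, 0] i := by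
  fin_cases i
  · exact h.r_in u hu
  · simp [evolvesInU] at hi
  · exact h.nu_in hu
  · simp [evolvesInU] at hi
  · simp [Fields.state, h.nu_in hu, h.zeta_in hu, h.φ_in u hu]
  · simp [evolvesInU] at hi

/-- A development only assumes that ν and 1 - μ do not vanish. Continuity turns this into signs: ν =
-1 on v = R, and on u = -R one has r = v ≥ R > 2M ≥ 2m. The domain contains the connecting null
segments because it is a past set. -/
theorem state_mem_regularStates (h : IsDevelopment d D S) (hR : 2 * M < R)
    {u v : ℝ} (hD : (u, v) ∈ D) : S.state R u v ∈ regularStates := by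
  have hw := h.subset_wedge hD
  have hu : u ≤ -R := hw.1
  have hv : R ≤ v := hw.2
  have hc := h.continuousOn_state
  have hcu : ContinuousOn (fun v' => S.state R u v') (uIcc R v) := by
    rw [uIcc_of_le hv]
    exact hc.comp (f := fun v' : ℝ => (u, v')) (by fun_prop)
      fun v' hv' => h.mem_of_le hD ⟨le_rfl, hu⟩ hv'
  have hcv : ContinuousOn (fun u' => S.state R (-u') v) (uIcc R (-u)) := by
    rw [uIcc_of_le (by linarith)]
    exact hc.comp (f := fun u' : ℝ => (-u', v)) (by fun_prop)
      fun u' hu' => h.mem_of_le hD ⟨by linarith [hu'.2], by linarith [hu'.1]⟩ ⟨hv, le_rfl⟩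
  have hr := h.solves.r_pos u v hD
  refine ⟨hr, ?_, ?_⟩
  · have := pos_of_continuousOn_of_ne_zero (f := fun v' => -(S.state R u v' 2)) hv
      (((continuous_apply 2).comp_continuousOn hcu).neg) (fun v' hv' => by
        rw [uIcc_of_le hv] at hv'
        exact neg_ne_zero.2 (h.solves.nu_ne u v' (h.mem_of_le hD ⟨le_rfl, hu⟩ hv'))) (by
        change 0 < -(S.nu R u R)
        rw [h.nu_in hu]; norm_num)
    exact neg_pos.1 this
  · have := pos_of_continuousOn_of_ne_zero
      (f := fun u' => S.state R (-u') v 0 - 2 * S.state R (-u') v 5) (a := R) (b := -u)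
      (by linarith) (((continuous_apply 0).comp_continuousOn hcv).sub
        (((continuous_apply 5).comp_continuousOn hcv).const_mul 2)) (fun u' hu' => by
        rw [uIcc_of_le (by linarith)] at hu'
        have hm := h.mem_of_le hD (u' := -u') (v' := v)
          ⟨by linarith [hu'.2], by linarith [hu'.1]⟩ ⟨hv, le_rfl⟩
        have h1 := h.solves.one_sub_mu_ne _ _ hm
        have h2 := (h.solves.r_pos _ _ hm).ne'
        intro h3
        apply h1
        have h4 : S.r (-u') v = 2 * S.m (-u') v := sub_eq_zero.1 h3
        rw [Fields.mu, ← h4, div_self h2, sub_self]) (by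
        change 0 < S.r (-R) v - 2 * S.m (-R) v
        rw [h.r_out v hv, h.m_out v hv, d.rOut_eq hv]
        linarith [d.mOut_le v hv])
    simpa using this

/-- The rectangle between the point and the initial segments lies in both domains and is compact, so
`evolution` is Lipschitz between the two images. The initial values cancel, and the difference
satisfies a homogeneous Goursat inequality. -/
theorem state_eq {D' : Set (ℝ × ℝ)} {S' : Fields} (h : IsDevelopment d D S)
    (h' : IsDevelopment d D' S') (hR : 2 * M < R) {u v : ℝ} (hD : (u, v) ∈ D)
    (hD' : (u, v) ∈ D') : S.state R u v = S'.state R u v := by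
  have hw := h.subset_wedge hD
  have hu : u ≤ -R := hw.1
  have hv : R ≤ v := hw.2
  set Q := Icc u (-R) ×ˢ Icc R v with hQ
  have hQc : IsCompact Q := isCompact_Icc.prod isCompact_Icc
  have hQD : Q ⊆ D := fun p hp => h.mem_of_le hD hp.1 hp.2
  have hQD' : Q ⊆ D' := fun p hp => h'.mem_of_le hD' hp.1 hp.2
  have hc := h.continuousOn_state.mono hQD
  have hc' := h'.continuousOn_state.mono hQD'
  have hreg : Function.uncurry (S.state R) '' Q ⊆ regularStates := by
    rintro _ ⟨p, hp, rfl⟩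
    exact h.state_mem_regularStates hR (hQD hp)
  have hreg' : Function.uncurry (S'.state R) '' Q ⊆ regularStates := by
    rintro _ ⟨p, hp, rfl⟩
    exact h'.state_mem_regularStates hR (hQD' hp)
  obtain ⟨K, hK0, hK⟩ := exists_lipschitz_evolution (hQc.image_of_continuousOn hc)
    (hQc.image_of_continuousOn hc') hreg hreg'
  have hKi : ∀ i, ∀ p ∈ Q, |evolution (S.state R p.1 p.2) i - evolution (S'.state R p.1 p.2) i|
      ≤ K * ‖S.state R p.1 p.2 - S'.state R p.1 p.2‖ := fun i p hp =>
    (norm_le_pi_norm (evolution (S.state R p.1 p.2) - evolution (S'.state R p.1 p.2)) i).trans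
      (hK _ ⟨p, hp, rfl⟩ _ ⟨p, hp, rfl⟩)
  have hce : ContinuousOn (fun p : ℝ × ℝ => evolution (S.state R p.1 p.2)) Q :=
    contDiffOn_evolution.continuousOn.comp hc fun p hp => hreg ⟨p, hp, rfl⟩
  have hce' : ContinuousOn (fun p : ℝ × ℝ => evolution (S'.state R p.1 p.2)) Q :=
    contDiffOn_evolution.continuousOn.comp hc' fun p hp => hreg' ⟨p, hp, rfl⟩
  have key := eq_zero_of_goursat_inequality hu hv
    (fun u v => S.state R u v - S'.state R u v) (hc.sub hc') hK0 ?_ u ⟨le_rfl, hu⟩ v ⟨hv, le_rfl⟩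
  · exact sub_eq_zero.1 key
  intro i x hx y hy
  have hxy : (x, y) ∈ Q := ⟨hx, hy⟩
  rcases hi : evolvesInU i with _ | _
  · right
    have hsub : ∀ s ∈ Icc R y, (x, s) ∈ Q := fun s hs => ⟨hx, hs.1, hs.2.trans hy.2⟩
    have hu1 := hy.1
    have e : ∫ s in R..y, (evolution (S.state R x s) i - evolution (S'.state R x s) i)
        = (S.state R x y i - S'.state R x y i) - (S.state R x R i - S'.state R x R i) := by
      refine intervalIntegral.integral_eq_sub_of_hasDeriv_right
        (f := fun s => S.state R x s i - S'.state R x s i) ?_ ?_ ?_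
      · rw [uIcc_of_le hu1]
        exact (continuous_apply i).comp_continuousOn ((hc.sub hc').comp
          (f := fun s : ℝ => (x, s)) (by fun_prop) hsub)
      · intro s hs
        rw [min_eq_left hu1, max_eq_right hu1] at hs
        have hm := hsub s ⟨hs.1.le, hs.2.le⟩
        exact ((h.hasDerivWithinAt_state_v (hQD hm) hi).sub
          (h'.hasDerivWithinAt_state_v (hQD' hm) hi)).mono fun z hz => hs.1.le.trans (le_of_lt hz)
      · apply ContinuousOn.intervalIntegrable
        rw [uIcc_of_le hu1]
        exact (continuous_apply i).comp_continuousOn ((hce.sub hce').comp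
          (f := fun s : ℝ => (x, s)) (by fun_prop) hsub)
    rw [h.state_in hx.2 hi, h'.state_in hx.2 hi, sub_self, sub_zero] at e
    rw [Pi.sub_apply, ← e, ← intervalIntegral.integral_const_mul, ← Real.norm_eq_abs]
    refine intervalIntegral.norm_integral_le_of_norm_le hu1
      (Filter.Eventually.of_forall fun s hs => hKi i (x, s) (hsub s ⟨hs.1.le, hs.2⟩)) ?_
    apply ContinuousOn.intervalIntegrable
    rw [uIcc_of_le hu1]
    exact ((hc.sub hc').norm.comp (f := fun s : ℝ => (x, s)) (by fun_prop) hsub).const_mul K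
  · left
    have hsub : ∀ s ∈ Icc x (-R), (s, y) ∈ Q := fun s hs => ⟨⟨hx.1.trans hs.1, hs.2⟩, hy⟩
    have hu1 := hx.2
    have e : ∫ s in x..(-R), (evolution (S.state R s y) i - evolution (S'.state R s y) i)
        = (S.state R (-R) y i - S'.state R (-R) y i) - (S.state R x y i - S'.state R x y i) := by
      refine intervalIntegral.integral_eq_sub_of_hasDeriv_right
        (f := fun s => S.state R s y i - S'.state R s y i) ?_ ?_ ?_
      · rw [uIcc_of_le hu1]
        exact (continuous_apply i).comp_continuousOn ((hc.sub hc').comp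
          (f := fun s : ℝ => (s, y)) (by fun_prop) hsub)
      · intro s hs
        rw [min_eq_left hu1, max_eq_right hu1] at hs
        have hm := hsub s ⟨hs.1.le, hs.2.le⟩
        exact (((h.hasDerivWithinAt_state_u (hQD hm) hi).sub
          (h'.hasDerivWithinAt_state_u (hQD' hm) hi)).hasDerivAt
          (Iic_mem_nhds hs.2)).hasDerivWithinAt
      · apply ContinuousOn.intervalIntegrable
        rw [uIcc_of_le hu1]
        exact (continuous_apply i).comp_continuousOn ((hce.sub hce').comp
          (f := fun s : ℝ => (s, y)) (by fun_prop) hsub)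
    rw [h.state_out hy.1 hi, h'.state_out hy.1 hi, sub_self, zero_sub] at e
    rw [Pi.sub_apply, ← abs_neg, ← e, ← intervalIntegral.integral_const_mul, ← Real.norm_eq_abs]
    refine intervalIntegral.norm_integral_le_of_norm_le hu1
      (Filter.Eventually.of_forall fun s hs => hKi i (s, y) (hsub s ⟨hs.1.le, hs.2⟩)) ?_
    apply ContinuousOn.intervalIntegrable
    rw [uIcc_of_le hu1]
    exact ((hc.sub hc').norm.comp (f := fun s : ℝ => (s, y)) (by fun_prop) hsub).const_mul K

/-- Two developments of the same data agree on the intersection of their domains. -/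
theorem fields_eq {D' : Set (ℝ × ℝ)} {S' : Fields} (h : IsDevelopment d D S)
    (h' : IsDevelopment d D' S') (hR : 2 * M < R) {u v : ℝ} (hD : (u, v) ∈ D)
    (hD' : (u, v) ∈ D') :
    S.r u v = S'.r u v ∧ S.φ u v = S'.φ u v ∧ S.m u v = S'.m u v := by
  have e := h.state_eq h' hR hD hD'
  have e0 : S.r u v = S'.r u v := congr_fun e 0
  have e3 : S.r u v * S.φ u v = S'.r u v * S'.φ u v := congr_fun e 3
  refine ⟨e0, ?_, congr_fun e 5⟩
  rw [← e0] at e3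
  exact mul_left_cancel₀ (h.solves.r_pos u v hD).ne' e3

end IsDevelopment

end GammaProblem

/-! ### Integrals of inverse powers, and growth with an integrable rate. -/

section Scalar

open MeasureTheory

/-- The bound is the integral up to infinity, hence uniform in b. The shift s carries the frozen
null coordinate, since x + s will be the lower bound v - R - u for r. -/
theorem abs_integral_le_of_inv_sq_bound {a b s q : ℝ} (hab : a ≤ b) (has : 0 < a + s) (hq : 0 ≤ q)
    {g : ℝ → ℝ} (hg : ∀ x ∈ Icc a b, |g x| ≤ q / (x + s) ^ 2) :
    |∫ x in a..b, g x| ≤ q / (a + s) := by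
  have hpos : ∀ x ∈ Icc a b, 0 < x + s := fun x hx => by linarith [hx.1]
  have hint : IntervalIntegrable (fun x => q / (x + s) ^ 2) volume a b := by
    apply ContinuousOn.intervalIntegrable
    rw [uIcc_of_le hab]
    exact ContinuousOn.div (by fun_prop) (by fun_prop) fun x hx => (pow_pos (hpos x hx) 2).ne'
  have h1 : |∫ x in a..b, g x| ≤ ∫ x in a..b, q / (x + s) ^ 2 := by
    rw [← Real.norm_eq_abs]
    exact intervalIntegral.norm_integral_le_of_norm_le hab
      (Filter.Eventually.of_forall fun x hx => hg x (Ioc_subset_Icc_self hx)) hint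
  have h2 : ∫ x in a..b, q / (x + s) ^ 2 = -(q / (b + s)) - -(q / (a + s)) := by
    refine intervalIntegral.integral_eq_sub_of_hasDerivAt (f := fun x => -(q / (x + s))) ?_ hint
    intro x hx
    rw [uIcc_of_le hab] at hx
    have h0 := (hpos x hx).ne'
    refine (((hasDerivAt_const x q).div ((hasDerivAt_id x).add_const s) h0).neg).congr_deriv ?_
    simp only [id]
    field_simp
    ring
  have h3 : 0 ≤ q / (b + s) := div_nonneg hq (by linarith)
  linarith

theorem abs_integral_le_of_inv_cube_bound {a b s q : ℝ} (hab : a ≤ b) (has : 0 < a + s)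
    (hq : 0 ≤ q) {g : ℝ → ℝ} (hg : ∀ x ∈ Icc a b, |g x| ≤ 2 * q / (x + s) ^ 3) :
    |∫ x in a..b, g x| ≤ q / (a + s) ^ 2 := by
  have hpos : ∀ x ∈ Icc a b, 0 < x + s := fun x hx => by linarith [hx.1]
  have hint : IntervalIntegrable (fun x => 2 * q / (x + s) ^ 3) volume a b := by
    apply ContinuousOn.intervalIntegrable
    rw [uIcc_of_le hab]
    exact ContinuousOn.div (by fun_prop) (by fun_prop) fun x hx => (pow_pos (hpos x hx) 3).ne'
  have h1 : |∫ x in a..b, g x| ≤ ∫ x in a..b, 2 * q / (x + s) ^ 3 := by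
    rw [← Real.norm_eq_abs]
    exact intervalIntegral.norm_integral_le_of_norm_le hab
      (Filter.Eventually.of_forall fun x hx => hg x (Ioc_subset_Icc_self hx)) hint
  have h2 : ∫ x in a..b, 2 * q / (x + s) ^ 3 = -(q / (b + s) ^ 2) - -(q / (a + s) ^ 2) := by
    refine intervalIntegral.integral_eq_sub_of_hasDerivAt (f := fun x => -(q / (x + s) ^ 2)) ?_ hint
    intro x hx
    rw [uIcc_of_le hab] at hx
    have h0 := (hpos x hx).ne'
    refine (((hasDerivAt_const x q).div (((hasDerivAt_id x).add_const s).pow 2)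
      (pow_ne_zero 2 h0)).neg).congr_deriv ?_
    simp only [id, Pi.pow_apply]
    field_simp
    ring
  have h3 : 0 ≤ q / (b + s) ^ 2 := by positivity
  linarith

theorem integral_reflect (g : ℝ → ℝ) (R u : ℝ) :
    ∫ s in (-R)..u, g s = -∫ x in R..(-u), g (-x) := by
  rw [intervalIntegral.integral_comp_neg, neg_neg, intervalIntegral.integral_symm]

theorem abs_integral_le_of_inv_sq_bound' {R u s q : ℝ} (hu : u ≤ -R) (has : 0 < R + s) (hq : 0 ≤ q)
    {g : ℝ → ℝ} (hg : ∀ x ∈ Icc u (-R), |g x| ≤ q / (s - x) ^ 2) :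
    |∫ x in (-R)..u, g x| ≤ q / (R + s) := by
  rw [integral_reflect, abs_neg]
  refine abs_integral_le_of_inv_sq_bound (by linarith) has hq fun x hx => ?_
  have := hg (-x) ⟨by linarith [hx.2], by linarith [hx.1]⟩
  rwa [sub_neg_eq_add, add_comm] at this

theorem abs_integral_le_of_inv_cube_bound' {R u s q : ℝ} (hu : u ≤ -R) (has : 0 < R + s)
    (hq : 0 ≤ q) {g : ℝ → ℝ} (hg : ∀ x ∈ Icc u (-R), |g x| ≤ 2 * q / (s - x) ^ 3) :
    |∫ x in (-R)..u, g x| ≤ q / (R + s) ^ 2 := by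
  rw [integral_reflect, abs_neg]
  refine abs_integral_le_of_inv_cube_bound (by linarith) has hq fun x hx => ?_
  have := hg (-x) ⟨by linarith [hx.2], by linarith [hx.1]⟩
  rwa [sub_neg_eq_add, add_comm] at this

/-- Linear growth with the integrable rate `q / (x + s) ^ 2`. -/
theorem le_exp_of_growth {a s q : ℝ} (has : 0 < a + s) {y g : ℝ → ℝ} (hg : Continuous g)
    (hy : ∀ x ∈ Ici a, y x = 1 + ∫ t in a..x, g t)
    (hgy : ∀ x ∈ Ici a, g x ≤ y x * (q / (x + s) ^ 2)) (hq : 0 ≤ q) {x : ℝ} (hx : a ≤ x) :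
    y x ≤ Real.exp (q / (a + s)) := by
  have hpos : ∀ x ∈ Ici a, 0 < x + s := fun x hx => by linarith [mem_Ici.1 hx]
  have hder : ∀ x ∈ Ici a, HasDerivAt
      (fun x => (1 + ∫ t in a..x, g t) * Real.exp (q / (x + s)))
      ((g x - (1 + ∫ t in a..x, g t) * (q / (x + s) ^ 2)) * Real.exp (q / (x + s))) x := by
    intro x hx
    have h0 := (hpos x hx).ne'
    have h1 := ((hg.integral_hasStrictDerivAt a x).hasDerivAt).const_add 1
    have h2 := ((hasDerivAt_const x q).div ((hasDerivAt_id x).add_const s) h0).exp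
    refine (h1.mul h2).congr_deriv ?_
    simp only [id, Pi.div_apply]
    field_simp
    ring
  -- The factor exp(q/(x + s)) has logarithmic derivative -q/(x + s)², which exactly absorbs the
  -- growth rate. Being at least 1, it can be dropped at the end.
  have hanti : AntitoneOn (fun x => (1 + ∫ t in a..x, g t) * Real.exp (q / (x + s))) (Ici a) := by
    refine antitoneOn_of_deriv_nonpos (convex_Ici a)
      (fun x hx => (hder x hx).continuousAt.continuousWithinAt)
      (fun x hx => (hder x (interior_subset hx)).differentiableAt.differentiableWithinAt) ?_
    intro x hx
    have hx' := interior_subset hx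
    rw [(hder x hx').deriv]
    refine mul_nonpos_of_nonpos_of_nonneg ?_ (Real.exp_pos _).le
    have := hgy x hx'
    rw [hy x hx'] at this
    linarith
  have h1 := hanti self_mem_Ici hx hx
  simp only [intervalIntegral.integral_same, add_zero, one_mul] at h1
  rw [← hy x hx] at h1
  rcases le_or_gt (y x) 0 with h2 | h2
  · exact h2.trans (Real.exp_pos _).le
  · have h3 : 1 ≤ Real.exp (q / (x + s)) := Real.one_le_exp (div_nonneg hq (hpos x hx).le)
    nlinarith

end Scalar

/-! ### Bounded Lipschitz functions and clamping. -/

/-- Uniform boundedness and Lipschitz continuity of a family of functions. -/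
def IsBddLip {P E : Type*} [NormedAddCommGroup E] (f : P → E → ℝ) : Prop :=
  ∃ B K, 0 ≤ B ∧ 0 ≤ K ∧ ∀ p x y, |f p x| ≤ B ∧ |f p x - f p y| ≤ K * ‖x - y‖

namespace IsBddLip

variable {P E : Type*} [NormedAddCommGroup E] {f g : P → E → ℝ}

theorem const (c : ℝ) : IsBddLip (fun (_ : P) (_ : E) => c) :=
  ⟨|c|, 0, abs_nonneg c, le_rfl, fun _ _ _ => ⟨le_rfl, by simp⟩⟩

theorem sub (hf : IsBddLip f) (hg : IsBddLip g) : IsBddLip fun p x => f p x - g p x := by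
  obtain ⟨B, K, hB, hK, h⟩ := hf
  obtain ⟨B', K', hB', hK', h'⟩ := hg
  refine ⟨B + B', K + K', by positivity, by positivity, fun p x y => ⟨?_, ?_⟩⟩
  · exact (abs_sub _ _).trans (add_le_add (h p x y).1 (h' p x y).1)
  · rw [show f p x - g p x - (f p y - g p y) = (f p x - f p y) - (g p x - g p y) by ring, add_mul]
    exact (abs_sub _ _).trans (add_le_add (h p x y).2 (h' p x y).2)

theorem mul (hf : IsBddLip f) (hg : IsBddLip g) : IsBddLip fun p x => f p x * g p x := by
  obtain ⟨B, K, hB, hK, h⟩ := hf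
  obtain ⟨B', K', hB', hK', h'⟩ := hg
  refine ⟨B * B', K * B' + B * K', by positivity, by positivity, fun p x y => ⟨?_, ?_⟩⟩
  · rw [abs_mul]
    exact mul_le_mul (h p x y).1 (h' p x y).1 (abs_nonneg _) hB
  · rw [show f p x * g p x - f p y * g p y
      = (f p x - f p y) * g p x + f p y * (g p x - g p y) by ring]
    refine (abs_add_le _ _).trans ?_
    rw [abs_mul, abs_mul, add_mul]
    refine add_le_add ?_ ?_
    · refine (mul_le_mul (h p x y).2 (h' p x y).1 (abs_nonneg _) (by positivity)).trans_eq ?_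
      ring
    · refine (mul_le_mul (h p y x).1 (h' p x y).2 (abs_nonneg _) hB).trans_eq ?_
      ring

/-- No upper bound on f is required: r is truncated from below only, and its reciprocal is still
bounded and Lipschitz. -/
theorem inv_of_lipschitz {ε K : ℝ} (hε : 0 < ε) (hK : 0 ≤ K) (h0 : ∀ p x, ε ≤ |f p x|)
    (h : ∀ p x y, |f p x - f p y| ≤ K * ‖x - y‖) : IsBddLip fun p x => (f p x)⁻¹ := by
  refine ⟨ε⁻¹, K / ε ^ 2, by positivity, by positivity, fun p x y => ⟨?_, ?_⟩⟩
  · rw [abs_inv]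
    exact inv_anti₀ hε (h0 p x)
  · have hx : 0 < |f p x| := hε.trans_le (h0 p x)
    have hy : 0 < |f p y| := hε.trans_le (h0 p y)
    rw [inv_sub_inv (abs_pos.1 hx) (abs_pos.1 hy), abs_div, abs_mul, abs_sub_comm,
      div_mul_eq_mul_div]
    refine div_le_div₀ (by positivity) (h p x y) (by positivity) ?_
    rw [sq]
    exact mul_le_mul (h0 p x) (h0 p y) hε.le hx.le

theorem inv (hf : IsBddLip f) {ε : ℝ} (hε : 0 < ε) (h0 : ∀ p x, ε ≤ |f p x|) :
    IsBddLip fun p x => (f p x)⁻¹ := by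
  obtain ⟨B, K, hB, hK, h⟩ := hf
  exact inv_of_lipschitz hε hK h0 fun p x y => (h p x y).2

end IsBddLip

/-- Truncation of a real number to `[a, b]`. -/
def clampTo (a b x : ℝ) : ℝ := max a (min b x)

theorem le_clampTo (a b x : ℝ) : a ≤ clampTo a b x := le_max_left _ _

theorem clampTo_le {a b : ℝ} (h : a ≤ b) (x : ℝ) : clampTo a b x ≤ b := max_le h (min_le_left _ _)

theorem clampTo_eq {a b x : ℝ} (h1 : a ≤ x) (h2 : x ≤ b) : clampTo a b x = x := by
  rw [clampTo, min_eq_right h2, max_eq_right h1]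

theorem abs_clampTo_sub_le (a b x y : ℝ) : |clampTo a b x - clampTo a b y| ≤ |x - y| :=
  (abs_max_sub_max_le_max _ _ _ _).trans (max_le (by simp) ((abs_min_sub_min_le_max _ _ _ _).trans
    (max_le (by simp) le_rfl)))

theorem abs_clampTo_le {a b : ℝ} (h : a ≤ b) (x : ℝ) : |clampTo a b x| ≤ max |a| |b| :=
  abs_le_max_abs_abs (le_clampTo a b x) (clampTo_le h x)

theorem isBddLip_clampTo {P ι : Type*} [Fintype ι] {a b : P → ℝ} {A : ℝ} (hab : ∀ p, a p ≤ b p)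
    (ha : ∀ p, |a p| ≤ A) (hb : ∀ p, |b p| ≤ A) (i : ι) :
    IsBddLip fun p (x : ι → ℝ) => clampTo (a p) (b p) (x i) := by
  rcases isEmpty_or_nonempty P with hP | ⟨⟨p₀⟩⟩
  · exact ⟨0, 0, le_rfl, le_rfl, fun p => hP.elim p⟩
  refine ⟨A, 1, (abs_nonneg _).trans (ha p₀), zero_le_one, fun p x y => ⟨?_, ?_⟩⟩
  · exact (abs_clampTo_le (hab p) _).trans (max_le (ha p) (hb p))
  · rw [one_mul]
    exact (abs_clampTo_sub_le _ _ _ _).trans (norm_le_pi_norm (x - y) i)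

/-! ### Consequences of the lower bound on R. -/

namespace GammaProblem

/-- The constant in the bound `|∂_u (r φ)| ≤ fieldConst / u ^ 2`. -/
noncomputable def fieldConst (α C M : ℝ) : ℝ := (1 + α ^ 4 * M) * C

/-- The consequences of the lower bound on `R` that the estimates need; `β` bounds `λ` and `|ν|`. -/
structure Smallness (α β R C M : ℝ) : Prop where
  one_lt_α : 1 < α
  one_le_β : 1 ≤ β
  β_le_α : β ≤ α
  R_pos : 0 < R
  C_pos : 0 < C
  M_pos : 0 < M
  growth : Real.exp (β * (4 * α * M) / R) ≤ β
  mass_le : 4 * α * M ≤ R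
  field : C + fieldConst α C M / R ≤ α * C
  mass : M + (fieldConst α C M ^ 2 / R ^ 2 + β * (α ^ 2 * C ^ 2)) / R ≤ α * M
  source : β ^ 2 * (2 * α * M) * (α * C) ≤ 2 * (α ^ 4 * M * C) * (1 - 2 * α * M / R)

/-- This closes the estimate of λ and |ν|: growth at a rate computed with β stays below β. If √α ≤
3/2, it reduces to √α ≤ α. Otherwise log α ≤ α/e gives q ≤ 1/5, and 3/10 < 1/3 ≤ log(3/2). -/
theorem exp_mul_min_le {α q : ℝ} (hα : 1 < α) (hq : q ≤ Real.log α / (2 * α)) :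
    Real.exp (min (3 / 2) √α * q) ≤ min (3 / 2) √α := by
  have hα0 : 0 < α := by linarith
  have hlog : 0 < Real.log α := Real.log_pos hα
  have hsα : √α * √α = α := Real.mul_self_sqrt hα0.le
  have hs0 : 0 < √α := Real.sqrt_pos.2 hα0
  rw [← Real.le_log_iff_exp_le (by positivity)]
  rcases le_total (3 / 2) √α with h | h
  · rw [min_eq_left h]
    have h1 := Real.log_le_sub_one_of_pos (x := α / Real.exp 1) (by positivity)
    rw [Real.log_div hα0.ne' (Real.exp_pos 1).ne', Real.log_exp] at h1
    have h2 : α / Real.exp 1 ≤ α / (27 / 10) := by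
      gcongr
      linarith [Real.exp_one_gt_d9]
    have h3 : Real.log α / (2 * α) ≤ 1 / 5 := by
      rw [div_le_div_iff₀ (by positivity) (by norm_num)]
      linarith
    have h4 := Real.one_sub_inv_le_log_of_pos (x := (3 / 2 : ℝ)) (by norm_num)
    norm_num at h4
    linarith
  · rw [min_eq_right h, Real.log_sqrt hα0.le]
    refine (mul_le_mul_of_nonneg_left hq hs0.le).trans ?_
    have hle : √α ≤ α := Real.sqrt_le_iff.2 ⟨hα0.le, by nlinarith⟩
    rw [mul_div_assoc', div_le_div_iff₀ (by positivity) two_pos]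
    have := mul_le_mul_of_nonneg_right hle hlog.le
    linarith

/-- The first two entries of `radiusBound` control `fieldConst` and give `field`; the third gives
`growth`; the fourth, with R > 16 and β ≤ 3/2, gives `mass`; the fifth gives `mass_le` and, with β²
≤ α, `source`. -/
theorem smallness_of_radiusBound {α R C M : ℝ} (hα : 1 < α) (hR₀ : 0 < R) (hC : 0 < C) (hM : 0 < M)
    (hR : radiusBound α C M < R) : Smallness α (min (3 / 2) √α) R C M := by
  simp only [radiusBound, max_lt_iff] at hR
  obtain ⟨h1, h2, h3, h4, h5⟩ := hR
  have hα0 : 0 < α := by linarith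
  have hα1 : 0 < α - 1 := by linarith
  have hsR : 0 < √R := Real.sqrt_pos.2 hR₀
  have hRR : √R * √R = R := Real.mul_self_sqrt hR₀.le
  have h1' : 4 * α < (α - 1) * √R := by
    have := Real.lt_sqrt_of_sq_lt h1
    rw [div_lt_iff₀ hα1] at this
    linarith
  have h2' : 1 + 16 * α ^ 4 * M < α * √R := by
    have := Real.lt_sqrt_of_sq_lt h2
    rw [div_lt_iff₀ hα0] at this
    linarith
  have h3' : 8 * α ^ 2 * M < Real.log α * R := by
    rw [div_lt_iff₀ (Real.log_pos hα)] at h3; linarith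
  have h4' : 6 * α ^ 2 * C ^ 2 < (α - 1) * M * R := by
    rw [div_lt_iff₀ (by positivity)] at h4; linarith
  have hαinv : α⁻¹ < 1 := inv_lt_one_of_one_lt₀ hα
  have hαinv0 : 0 < α⁻¹ := inv_pos.2 hα0
  have h5' : 4 * α * M < (1 - α⁻¹) * R := by
    rw [div_lt_iff₀ (by linarith)] at h5; linarith
  clear h1 h2 h3 h4 h5
  have hsR4 : 4 < √R := by
    by_contra! h
    have := mul_le_mul_of_nonneg_left h hα1.le
    linarith
  have hR16 : 16 < R := by
    have := mul_lt_mul'' hsR4 hsR4 (by norm_num) (by norm_num)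
    linarith
  have hK : fieldConst α C M ≤ α * √R * C := by
    refine mul_le_mul_of_nonneg_right ?_ hC.le
    have : 0 < α ^ 4 * M := by positivity
    linarith
  have hK0 : 0 ≤ fieldConst α C M := by unfold fieldConst; positivity
  have hβα : min (3 / 2) √α ^ 2 ≤ α := by
    calc min (3 / 2) √α ^ 2 ≤ √α ^ 2 :=
          pow_le_pow_left₀ (by positivity) (min_le_right _ _) 2
      _ = α := Real.sq_sqrt hα0.le
  have hβ1 : 1 ≤ min (3 / 2) √α :=
    le_min (by norm_num) (Real.one_le_sqrt.2 hα.le)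
  have hβ3 : min (3 / 2) √α ≤ 3 / 2 := min_le_left _ _
  refine ⟨hα, hβ1, (le_self_pow₀ hβ1 two_ne_zero).trans hβα, hR₀, hC, hM, ?_, ?_, ?_, ?_, ?_⟩
  · rw [mul_div_assoc]
    refine exp_mul_min_le hα ?_
    rw [div_le_div_iff₀ hR₀ (by positivity)]
    linarith
  · have : α⁻¹ * R ≥ 0 := by positivity
    linarith
  · have : fieldConst α C M / R ≤ (α - 1) * C := by
      rw [div_le_iff₀ hR₀]
      calc fieldConst α C M ≤ α * (√R * C) := by linarith
        _ ≤ (α - 1) * √R * (√R * C) := by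
            refine mul_le_mul_of_nonneg_right (by linarith) (by positivity)
        _ = (α - 1) * C * (√R * √R) := by ring
        _ = _ := by rw [hRR]
    linarith
  · have h6 : fieldConst α C M ^ 2 / R ^ 2 ≤ α ^ 2 * C ^ 2 / 16 := by
      rw [div_le_div_iff₀ (by positivity) (by norm_num)]
      have : fieldConst α C M ^ 2 ≤ α ^ 2 * C ^ 2 * R := by
        calc fieldConst α C M ^ 2 ≤ (α * √R * C) ^ 2 := pow_le_pow_left₀ hK0 hK 2
          _ = α ^ 2 * C ^ 2 * (√R * √R) := by ring
          _ = _ := by rw [hRR]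
      have h7 : α ^ 2 * C ^ 2 * R * 16 ≤ α ^ 2 * C ^ 2 * R * R :=
        mul_le_mul_of_nonneg_left hR16.le (by positivity)
      linarith
    have h7 : min (3 / 2) √α * (α ^ 2 * C ^ 2) ≤ 3 / 2 * (α ^ 2 * C ^ 2) :=
      mul_le_mul_of_nonneg_right hβ3 (by positivity)
    have h8 : (fieldConst α C M ^ 2 / R ^ 2 + min (3 / 2) √α * (α ^ 2 * C ^ 2)) / R
        ≤ (α - 1) * M := by
      rw [div_le_iff₀ hR₀]
      have : 0 ≤ α ^ 2 * C ^ 2 := by positivity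
      linarith
    linarith
  -- Thus 1 - 2αM/R ≥ (1 + α⁻¹)/2, and `source` reduces to 2β² ≤ α² + α, which follows from β² ≤ α ≤
  -- α².
  · have h6 : 2 * α * M / R ≤ (1 - α⁻¹) / 2 := by
      rw [div_le_div_iff₀ hR₀ two_pos]
      linarith
    have h8 : 2 * (α ^ 4 * M * C) * ((1 + α⁻¹) / 2) ≤ 2 * (α ^ 4 * M * C) * (1 - 2 * α * M / R) :=
      mul_le_mul_of_nonneg_left (by linarith) (by positivity)
    have h9 : 2 * (α ^ 4 * M * C) * ((1 + α⁻¹) / 2) = M * C * α ^ 2 * (α ^ 2 + α) := by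
      field_simp
    rw [h9] at h8
    have h10 : min (3 / 2) √α ^ 2 * (2 * α * M) * (α * C)
        = M * C * α ^ 2 * (2 * min (3 / 2) √α ^ 2) := by ring
    rw [h10]
    refine le_trans (mul_le_mul_of_nonneg_left ?_ (by positivity)) h8
    have : α ≤ α ^ 2 := le_self_pow₀ hα.le two_ne_zero
    linarith

/-! ### Estimates of the right-hand sides inside the box. -/

/-- The box to which the state is confined; `c` bounds `∂_u (r φ)`. -/
def InBox (α β R C M c : ℝ) (y : Fin 6 → ℝ) : Prop :=
  R ≤ y 0 ∧ 1 ≤ y 1 ∧ y 1 ≤ β ∧ -β ≤ y 2 ∧ y 2 ≤ -1 ∧ |y 3| ≤ α * C ∧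
    |y 4| ≤ c ∧ 0 ≤ y 5 ∧ y 5 ≤ α * M

namespace InBox

variable {α β R C M c : ℝ} {y : Fin 6 → ℝ}

theorem r_ge (h : InBox α β R C M c y) : R ≤ y 0 := h.1

theorem one_le_lam (h : InBox α β R C M c y) : 1 ≤ y 1 := h.2.1

theorem lam_le (h : InBox α β R C M c y) : y 1 ≤ β := h.2.2.1

theorem le_nu (h : InBox α β R C M c y) : -β ≤ y 2 := h.2.2.2.1

theorem nu_le (h : InBox α β R C M c y) : y 2 ≤ -1 := h.2.2.2.2.1

theorem rphi_le (h : InBox α β R C M c y) : |y 3| ≤ α * C := h.2.2.2.2.2.1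

theorem du_rphi_le (h : InBox α β R C M c y) : |y 4| ≤ c := h.2.2.2.2.2.2.1

theorem m_nonneg (h : InBox α β R C M c y) : 0 ≤ y 5 := h.2.2.2.2.2.2.2.1

theorem m_le (h : InBox α β R C M c y) : y 5 ≤ α * M := h.2.2.2.2.2.2.2.2

theorem r_pos (h : InBox α β R C M c y) (hs : Smallness α β R C M) : 0 < y 0 :=
  hs.R_pos.trans_le h.r_ge

theorem mu_le_of_le (h : InBox α β R C M c y) (hs : Smallness α β R C M) :
    2 * y 5 / y 0 ≤ 2 * α * M / R := by
  have := h.r_pos hs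
  have := h.m_nonneg
  refine div_le_div₀ ?_ ?_ hs.R_pos h.r_ge
  · have := hs.one_lt_α; have := hs.M_pos; positivity
  · linarith [h.m_le]

theorem mu_nonneg (h : InBox α β R C M c y) (hs : Smallness α β R C M) :
    0 ≤ 2 * y 5 / y 0 :=
  div_nonneg (by linarith [h.m_nonneg]) (h.r_pos hs).le

theorem half_le_one_sub_mu (h : InBox α β R C M c y) (hs : Smallness α β R C M) :
    1 / 2 ≤ 1 - 2 * y 5 / y 0 := by
  have h1 := h.mu_le_of_le hs
  have h2 : 2 * α * M / R ≤ 1 / 2 := by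
    rw [div_le_div_iff₀ hs.R_pos two_pos]; linarith [hs.mass_le]
  linarith

theorem mem_regularStates (h : InBox α β R C M c y) (hs : Smallness α β R C M) :
    y ∈ regularStates := by
  refine ⟨h.r_pos hs, by linarith [h.nu_le], ?_⟩
  have h1 := h.half_le_one_sub_mu hs
  have h2 := h.r_pos hs
  have h3 : 2 * y 5 / y 0 ≤ 1 / 2 := by linarith
  rw [div_le_iff₀ h2] at h3
  linarith

/-- The factor `2m / (r² (1 - μ))` is nonnegative and at most `4 α M / ρ²` for `ρ ≤ r`. -/
theorem coeff_bounds (h : InBox α β R C M c y) (hs : Smallness α β R C M) {ρ : ℝ} (hρ : 0 < ρ)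
    (hρr : ρ ≤ y 0) :
    0 ≤ 2 * y 5 / (y 0 ^ 2 * (1 - 2 * y 5 / y 0)) ∧
      2 * y 5 / (y 0 ^ 2 * (1 - 2 * y 5 / y 0)) ≤ 4 * α * M / ρ ^ 2 ∧
      2 * y 5 / (y 0 ^ 2 * (1 - 2 * y 5 / y 0)) ≤ 2 * α * M / (1 - 2 * α * M / R) / ρ ^ 2 := by
  have h0 := h.r_pos hs
  have h1 := h.half_le_one_sub_mu hs
  have h2 : 1 - 2 * α * M / R ≤ 1 - 2 * y 5 / y 0 := by linarith [h.mu_le_of_le hs]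
  have h3 : 1 / 2 ≤ 1 - 2 * α * M / R := by
    have : 2 * α * M / R ≤ 1 / 2 := by
      rw [div_le_div_iff₀ hs.R_pos two_pos]; linarith [hs.mass_le]
    linarith
  have h4 := h.m_nonneg
  have h5 := h.m_le
  have hα := hs.one_lt_α
  have hM := hs.M_pos
  have hsq : ρ ^ 2 ≤ y 0 ^ 2 := pow_le_pow_left₀ hρ.le hρr 2
  refine ⟨?_, ?_, ?_⟩
  · have : 0 < 1 - 2 * y 5 / y 0 := by linarith
    positivity
  · rw [show 4 * α * M / ρ ^ 2 = 2 * (α * M) / (ρ ^ 2 * (1 / 2)) by field_simp; ring]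
    exact div_le_div₀ (by positivity) (by linarith) (by positivity)
      (mul_le_mul hsq h1 (by norm_num) (by positivity))
  -- Keeping 1 - 2αM/R instead of replacing it by 1/2 is what allows `abs_source_le` to reach the
  -- constant α⁴MC.
  · rw [div_div, mul_comm (1 - 2 * α * M / R)]
    exact div_le_div₀ (by positivity) (by linarith) (by positivity)
      (mul_le_mul hsq h2 (by linarith) (by positivity))

theorem radiusSource_nonpos (h : InBox α β R C M c y) (hs : Smallness α β R C M) :
    radiusSource y ≤ 0 := by
  refine mul_nonpos_of_nonpos_of_nonneg ?_ (h.coeff_bounds hs (h.r_pos hs) le_rfl).1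
  exact mul_nonpos_of_nonneg_of_nonpos (by linarith [h.one_le_lam]) (by linarith [h.nu_le])

/-- The source is a product of λ and ν; bounding one factor by β leaves an inequality linear in the
other. The two forms serve the growth estimates of λ in u and of ν in v. -/
theorem neg_radiusSource_le (h : InBox α β R C M c y) (hs : Smallness α β R C M) {ρ : ℝ}
    (hρ : 0 < ρ) (hρr : ρ ≤ y 0) :
    -radiusSource y ≤ y 1 * (β * (4 * α * M) / ρ ^ 2) ∧
      -radiusSource y ≤ -y 2 * (β * (4 * α * M) / ρ ^ 2) := by
  obtain ⟨k0, k1, -⟩ := h.coeff_bounds hs hρ hρr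
  have a1 := h.one_le_lam
  have a2 := h.lam_le
  have a3 := h.le_nu
  have a4 := h.nu_le
  have e : -radiusSource y = y 1 * -y 2 * (2 * y 5 / (y 0 ^ 2 * (1 - 2 * y 5 / y 0))) := by
    rw [radiusSource]; ring
  rw [e, mul_div_assoc β]
  constructor
  · rw [mul_assoc]
    exact mul_le_mul_of_nonneg_left (mul_le_mul (by linarith) k1 k0 (by linarith)) (by linarith)
  · rw [mul_comm (y 1), mul_assoc]
    exact mul_le_mul_of_nonneg_left (mul_le_mul (by linarith) k1 k0 (by linarith)) (by linarith)

/-- This is ∂_u∂_v(rφ) = φ ∂_u∂_v r, where writing φ as rφ/r supplies the third power of decay. The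
factor 2 is what integrating ρ⁻³ removes. -/
theorem abs_source_le (h : InBox α β R C M c y) (hs : Smallness α β R C M) {ρ : ℝ}
    (hρ : 0 < ρ) (hρr : ρ ≤ y 0) :
    |radiusSource y * (y 3 / y 0)| ≤ 2 * (α ^ 4 * M * C) / ρ ^ 3 := by
  obtain ⟨k0, -, k1⟩ := h.coeff_bounds hs hρ hρr
  have a1 := h.one_le_lam
  have a2 := h.lam_le
  have a3 := h.le_nu
  have a4 := h.nu_le
  have h0 := h.r_pos hs
  have hβ := hs.one_le_β
  have hα := hs.one_lt_α
  have hM := hs.M_pos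
  have hC := hs.C_pos
  have h3 : 0 < 1 - 2 * α * M / R := by
    have : 2 * α * M / R ≤ 1 / 2 := by
      rw [div_le_div_iff₀ hs.R_pos two_pos]; linarith [hs.mass_le]
    linarith
  have e : |radiusSource y| = y 1 * -y 2 * (2 * y 5 / (y 0 ^ 2 * (1 - 2 * y 5 / y 0))) := by
    rw [abs_of_nonpos (h.radiusSource_nonpos hs), radiusSource]; ring
  have b1 : |radiusSource y| ≤ β * β * (2 * α * M / (1 - 2 * α * M / R) / ρ ^ 2) := by
    rw [e]
    exact mul_le_mul (mul_le_mul a2 (by linarith) (by linarith) (by linarith)) k1 k0 (by positivity)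
  have b2 : |y 3 / y 0| ≤ α * C / ρ := by
    rw [abs_div, abs_of_pos h0]
    exact div_le_div₀ (by positivity) h.rphi_le hρ hρr
  rw [abs_mul]
  calc |radiusSource y| * |y 3 / y 0|
      ≤ β * β * (2 * α * M / (1 - 2 * α * M / R) / ρ ^ 2) * (α * C / ρ) :=
        mul_le_mul b1 b2 (abs_nonneg _) (by positivity)
    _ = β ^ 2 * (2 * α * M) * (α * C) / (1 - 2 * α * M / R) / ρ ^ 3 := by field_simp
    _ ≤ 2 * (α ^ 4 * M * C) / ρ ^ 3 := by
        gcongr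
        rw [div_le_iff₀ h3]
        exact hs.source

/-- Here ζ = ∂_u(rφ) - νφ, so ζ² ≤ 2(∂_u(rφ))² + 2ν²φ². Dividing by |ν| uses |ν| ≥ 1 for the first
term and |ν| ≤ β for the second. -/
theorem mass_source_bounds (h : InBox α β R C M c y) (hs : Smallness α β R C M) {ρ : ℝ}
    (hρ : 0 < ρ) (hρr : ρ ≤ y 0) :
    evolution y 5 ≤ 0 ∧ |evolution y 5| ≤ c ^ 2 + β * (α ^ 2 * C ^ 2) / ρ ^ 2 := by
  have a3 := h.le_nu
  have a4 := h.nu_le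
  have h0 := h.r_pos hs
  have hα := hs.one_lt_α
  have hC := hs.C_pos
  have h1 := h.half_le_one_sub_mu hs
  have h2 : 1 - 2 * y 5 / y 0 ≤ 1 := by linarith [h.mu_nonneg hs]
  have hn : 0 < -y 2 := by linarith
  have b2 : |y 3 / y 0| ≤ α * C / ρ := by
    rw [abs_div, abs_of_pos h0]
    exact div_le_div₀ (by positivity) h.rphi_le hρ hρr
  have e : evolution y 5 = -(1 / 2 * (1 - 2 * y 5 / y 0) * (y 4 - y 2 * (y 3 / y 0)) ^ 2 / -y 2) := by
    rw [div_neg, neg_neg]; rfl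
  have p0 : 0 ≤ 1 / 2 * (1 - 2 * y 5 / y 0) * (y 4 - y 2 * (y 3 / y 0)) ^ 2 / -y 2 := by positivity
  refine ⟨by rw [e]; linarith, ?_⟩
  rw [e, abs_neg, abs_of_nonneg p0, div_le_iff₀ hn]
  have s1 : (y 3 / y 0) ^ 2 ≤ (α * C / ρ) ^ 2 := sq_le_sq' (by linarith [abs_le.1 b2]) (abs_le.1 b2).2
  have s2 : (y 4) ^ 2 ≤ c ^ 2 := sq_le_sq' (by linarith [abs_le.1 h.du_rphi_le])
    (abs_le.1 h.du_rphi_le).2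
  have s3 : (y 4 - y 2 * (y 3 / y 0)) ^ 2 ≤ 2 * y 4 ^ 2 + 2 * (y 2) ^ 2 * (y 3 / y 0) ^ 2 := by
    linarith [sq_nonneg (y 4 + y 2 * (y 3 / y 0))]
  have s4 : 1 / 2 * (1 - 2 * y 5 / y 0) * (y 4 - y 2 * (y 3 / y 0)) ^ 2
      ≤ 1 / 2 * 1 * (2 * y 4 ^ 2 + 2 * (y 2) ^ 2 * (y 3 / y 0) ^ 2) := by
    gcongr
  refine s4.trans ?_
  have s5 : β * (α ^ 2 * C ^ 2) / ρ ^ 2 = β * (α * C / ρ) ^ 2 := by field_simp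
  rw [s5]
  have s6 : (y 2) ^ 2 * (y 3 / y 0) ^ 2 ≤ (-y 2) * β * (α * C / ρ) ^ 2 := by
    refine mul_le_mul ?_ s1 (sq_nonneg _) (mul_nonneg hn.le (by linarith))
    have := mul_le_mul_of_nonneg_left (show -y 2 ≤ β by linarith) hn.le
    linarith
  have s7 : y 4 ^ 2 ≤ c ^ 2 * (-y 2) :=
    s2.trans (le_mul_of_one_le_right (sq_nonneg c) (by linarith))
  linarith

end InBox

end GammaProblem

/-! ### The truncated system and its global solution. -/

namespace GammaProblem

/-- Truncation of a state to the box `InBox α β R C M c`. -/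
noncomputable def truncate (α β R C M c : ℝ) (x : Fin 6 → ℝ) : Fin 6 → ℝ :=
  ![max (x 0) R, clampTo 1 β (x 1), clampTo (-β) (-1) (x 2), clampTo (-(α * C)) (α * C) (x 3),
    clampTo (-c) c (x 4), clampTo 0 (α * M) (x 5)]

/-- The bound on `∂_u (r φ)` at `u`, extended to all real `u`. -/
noncomputable def fieldBound (α R C M u : ℝ) : ℝ := fieldConst α C M / max (-u) R ^ 2

section Truncation

variable {α β R C M : ℝ}

theorem Smallness.fieldConst_pos (hs : Smallness α β R C M) : 0 < fieldConst α C M := by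
  have := hs.one_lt_α
  have := hs.M_pos
  have := hs.C_pos
  unfold fieldConst
  positivity

theorem fieldBound_nonneg (hs : Smallness α β R C M) (u : ℝ) : 0 ≤ fieldBound α R C M u :=
  div_nonneg hs.fieldConst_pos.le (sq_nonneg _)

theorem fieldBound_le (hs : Smallness α β R C M) (u : ℝ) :
    fieldBound α R C M u ≤ fieldConst α C M / R ^ 2 :=
  div_le_div_of_nonneg_left hs.fieldConst_pos.le (pow_pos hs.R_pos 2)
    (pow_le_pow_left₀ hs.R_pos.le (le_max_right _ _) 2)

theorem fieldBound_eq {u : ℝ} (hu : u ≤ -R) : fieldBound α R C M u = fieldConst α C M / u ^ 2 := by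
  rw [fieldBound, max_eq_left (by linarith), neg_sq]

theorem continuous_fieldBound (hs : Smallness α β R C M) : Continuous (fieldBound α R C M) :=
  continuous_const.div (by fun_prop)
    fun _ => (pow_pos (hs.R_pos.trans_le (le_max_right _ _)) 2).ne'

theorem inBox_truncate (hs : Smallness α β R C M) {c : ℝ} (hc : 0 ≤ c) (x : Fin 6 → ℝ) :
    InBox α β R C M c (truncate α β R C M c x) := by
  have h1 := hs.one_le_β
  have h2 : 0 ≤ α * C := mul_nonneg (by linarith [hs.one_lt_α]) hs.C_pos.le
  have h3 : 0 ≤ α * M := mul_nonneg (by linarith [hs.one_lt_α]) hs.M_pos.le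
  refine ⟨le_max_right _ _, le_clampTo _ _ _, clampTo_le h1 _, le_clampTo _ _ _,
    clampTo_le (by linarith) _, ?_, ?_, le_clampTo _ _ _, clampTo_le h3 _⟩
  · exact abs_le.2 ⟨le_clampTo _ _ _, clampTo_le (by linarith) _⟩
  · exact abs_le.2 ⟨le_clampTo _ _ _, clampTo_le (by linarith) _⟩

theorem truncate_eq_self {c : ℝ} {x : Fin 6 → ℝ} (h : InBox α β R C M c x) :
    truncate α β R C M c x = x := by
  ext i
  fin_cases i
  · exact max_eq_left h.r_ge
  · exact clampTo_eq h.one_le_lam h.lam_le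
  · exact clampTo_eq h.le_nu h.nu_le
  · exact clampTo_eq (abs_le.1 h.rphi_le).1 (abs_le.1 h.rphi_le).2
  · exact clampTo_eq (abs_le.1 h.du_rphi_le).1 (abs_le.1 h.du_rphi_le).2
  · exact clampTo_eq h.m_nonneg h.m_le

theorem continuous_truncated_evolution (hs : Smallness α β R C M) :
    Continuous fun q : ℝ × (Fin 6 → ℝ) =>
      evolution (truncate α β R C M (fieldBound α R C M q.1) q.2) := by
  have hb := (continuous_fieldBound hs).comp (continuous_fst (X := ℝ) (Y := Fin 6 → ℝ))
  refine contDiffOn_evolution.continuousOn.comp_continuous ?_ fun q =>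
    (inBox_truncate hs (fieldBound_nonneg hs q.1) q.2).mem_regularStates hs
  refine continuous_pi fun i => ?_
  fin_cases i
  · exact (by fun_prop : Continuous fun q : ℝ × (Fin 6 → ℝ) => max (q.2 0) R)
  · exact (by fun_prop : Continuous fun q : ℝ × (Fin 6 → ℝ) => max 1 (min β (q.2 1)))
  · exact (by fun_prop : Continuous fun q : ℝ × (Fin 6 → ℝ) => max (-β) (min (-1) (q.2 2)))
  · exact (by fun_prop : Continuous fun q : ℝ × (Fin 6 → ℝ) =>
      max (-(α * C)) (min (α * C) (q.2 3)))
  · exact hb.neg.max (hb.min (by fun_prop))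
  · exact (by fun_prop : Continuous fun q : ℝ × (Fin 6 → ℝ) => max 0 (min (α * M) (q.2 5)))

/-- The truncated right-hand side is a polynomial in the clamped components and the reciprocals of
r, 1 - μ and ν, which the box keeps away from zero uniformly. The clamp on ∂_u(rφ) varies with u but
stays below its value at R. -/
theorem isBddLip_truncated_evolution (hs : Smallness α β R C M) (i : Fin 6) :
    IsBddLip fun (u : ℝ) x => evolution (truncate α β R C M (fieldBound α R C M u) x) i := by
  have hbox := fun (u : ℝ) x => inBox_truncate hs (fieldBound_nonneg hs u) x
  have hβ := hs.one_le_β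
  have hαC : 0 ≤ α * C := mul_nonneg (by linarith [hs.one_lt_α]) hs.C_pos.le
  have hαM : 0 ≤ α * M := mul_nonneg (by linarith [hs.one_lt_α]) hs.M_pos.le
  set y : ℝ → (Fin 6 → ℝ) → Fin 6 → ℝ :=
    fun u x => truncate α β R C M (fieldBound α R C M u) x
  have y0 : IsBddLip fun u x => (y u x 0)⁻¹ := by
    refine IsBddLip.inv_of_lipschitz hs.R_pos zero_le_one
      (fun u x => (hbox u x).r_ge.trans (le_abs_self _)) fun u x x' => ?_
    rw [one_mul]
    exact (abs_max_sub_max_le_max _ _ _ _).trans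
      (max_le (norm_le_pi_norm (x - x') 0) (by simp))
  have y1 : IsBddLip fun u x => y u x 1 :=
    isBddLip_clampTo (A := β) (a := fun _ => 1) (b := fun _ => β) (fun _ => hβ)
      (fun _ => by simpa using hβ) (fun _ => (abs_of_nonneg (by linarith)).le) 1
  have y2 : IsBddLip fun u x => y u x 2 :=
    isBddLip_clampTo (A := β) (a := fun _ => -β) (b := fun _ => -1) (fun _ => by linarith)
      (fun _ => by rw [abs_neg, abs_of_nonneg (by linarith)]) (fun _ => by simpa using hβ) 2
  have y3 : IsBddLip fun u x => y u x 3 :=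
    isBddLip_clampTo (A := α * C) (a := fun _ => -(α * C)) (b := fun _ => α * C)
      (fun _ => by linarith) (fun _ => by rw [abs_neg, abs_of_nonneg hαC])
      (fun _ => (abs_of_nonneg hαC).le) 3
  have y4 : IsBddLip fun u x => y u x 4 :=
    isBddLip_clampTo (A := fieldConst α C M / R ^ 2) (a := fun u => -fieldBound α R C M u)
      (b := fieldBound α R C M) (fun u => by linarith [fieldBound_nonneg hs u])
      (fun u => by rw [abs_neg, abs_of_nonneg (fieldBound_nonneg hs u)]; exact fieldBound_le hs u)
      (fun u => by rw [abs_of_nonneg (fieldBound_nonneg hs u)]; exact fieldBound_le hs u) 4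
  have y5 : IsBddLip fun u x => y u x 5 :=
    isBddLip_clampTo (A := α * M) (a := fun _ => 0) (b := fun _ => α * M)
      (fun _ => hαM) (fun _ => by simpa using hαM) (fun _ => (abs_of_nonneg hαM).le) 5
  have hμ : IsBddLip fun u x => 1 - 2 * y u x 5 / y u x 0 := by
    simpa only [div_eq_mul_inv] using
      (IsBddLip.const 1).sub (((IsBddLip.const 2).mul y5).mul y0)
  have hμi : IsBddLip fun u x => (1 - 2 * y u x 5 / y u x 0)⁻¹ :=
    hμ.inv one_half_pos fun u x => ((hbox u x).half_le_one_sub_mu hs).trans (le_abs_self _)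
  have y2i : IsBddLip fun u x => (y u x 2)⁻¹ := by
    refine y2.inv one_pos fun u x => ?_
    rw [abs_of_neg (by linarith [(hbox u x).nu_le])]
    linarith [(hbox u x).nu_le]
  have hφ : IsBddLip fun u x => y u x 3 / y u x 0 := by
    simpa only [div_eq_mul_inv] using y3.mul y0
  have hsrc : IsBddLip fun u x => radiusSource (y u x) := by
    have := (y1.mul y2).mul (((IsBddLip.const 2).mul y5).mul ((y0.mul y0).mul hμi))
    simpa only [radiusSource, div_eq_mul_inv, mul_inv, sq] using this
  have hm : IsBddLip fun u x => 1 / 2 * (1 - 2 * y u x 5 / y u x 0)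
      * (y u x 4 - y u x 2 * (y u x 3 / y u x 0)) ^ 2 / y u x 2 := by
    have hz := y4.sub (y2.mul hφ)
    have := ((((IsBddLip.const (1 / 2)).mul hμ).mul (hz.mul hz)).mul y2i)
    simpa only [div_eq_mul_inv, sq] using this
  fin_cases i
  · exact y1
  · exact hsrc
  · exact hsrc
  · exact y4
  · exact hsrc.mul hφ
  · exact hm

theorem exists_bounds_truncated_evolution (hs : Smallness α β R C M) :
    ∃ B K : ℝ, ∀ (i : Fin 6) (u : ℝ) (x y : Fin 6 → ℝ),
      |evolution (truncate α β R C M (fieldBound α R C M u) x) i| ≤ B ∧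
      |evolution (truncate α β R C M (fieldBound α R C M u) x) i
        - evolution (truncate α β R C M (fieldBound α R C M u) y) i| ≤ K * ‖x - y‖ := by
  choose B K hB hK h using isBddLip_truncated_evolution hs
  refine ⟨∑ i, B i, ∑ i, K i, fun i u x y => ⟨?_, ?_⟩⟩
  · exact ((h i u x y).1).trans (Finset.single_le_sum (fun j _ => hB j) (Finset.mem_univ i))
  · exact ((h i u x y).2).trans (mul_le_mul_of_nonneg_right
      (Finset.single_le_sum (fun j _ => hK j) (Finset.mem_univ i)) (norm_nonneg _))

end Truncation

namespace CharData

variable {R C M m₀ : ℝ} (d : CharData R C M m₀)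

/-- The characteristic data of the state, each component on the segment from which it evolves;
extended to the plane. -/
noncomputable def base (u v : ℝ) : Fin 6 → ℝ :=
  ![-u, 1, -1, d.rOut (max v R) * d.φOut (max v R),
    derivWithin (fun u' => d.rIn u' * d.φIn u') (Iic (-R)) (min u (-R)), d.mOut (max v R)]

theorem continuousOn_mOut : ContinuousOn d.mOut (Ici R) :=
  fun v hv => (d.mOut_deriv v hv).continuousWithinAt

theorem continuous_base (i : Fin 6) : Continuous fun p : ℝ × ℝ => d.base p.1 p.2 i := by
  have hmax : Continuous fun p : ℝ × ℝ => max p.2 R := by fun_prop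
  have hmin : Continuous fun p : ℝ × ℝ => min p.1 (-R) := by fun_prop
  fin_cases i
  · exact (by fun_prop : Continuous fun p : ℝ × ℝ => -p.1)
  · exact continuous_const
  · exact continuous_const
  · exact (d.rOut_c2.continuousOn.mul d.φOut_c2.continuousOn).comp_continuous hmax
      fun p => mem_Ici.2 (le_max_right _ _)
  · exact ((d.rIn_c2.mul d.φIn_c2).continuousOn_derivWithin (uniqueDiffOn_Iic _)
      one_le_two).comp_continuous hmin fun p => mem_Iic.2 (min_le_right _ _)
  · exact d.continuousOn_mOut.comp_continuous hmax fun p => mem_Ici.2 (le_max_right _ _)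

/-- On u = -R one has m ≤ M < R/2 ≤ r/2, so 1 - μ is nonnegative and the mass equation makes m
nondecreasing from m₀. -/
theorem mOut_nonneg (hm₀ : 0 ≤ m₀) (hM : 0 < M) (hR : 2 * M < R) {v : ℝ} (hv : v ∈ Ici R) :
    0 ≤ d.mOut v := by
  have hmono : MonotoneOn d.mOut (Ici R) := by
    refine monotoneOn_of_deriv_nonneg (convex_Ici R) d.continuousOn_mOut ?_ ?_
    · exact fun x hx => ((d.mOut_deriv x (interior_subset hx)).mono
        interior_subset).differentiableWithinAt
    · intro x hx
      have hxR : x ∈ Ici R := interior_subset hx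
      rw [((d.mOut_deriv x hxR).hasDerivAt (mem_interior_iff_mem_nhds.1 hx)).deriv]
      have h1 : 0 ≤ 1 - 2 * d.mOut x / d.rOut x := by
        have hx0 : R ≤ x := hxR
        rw [d.rOut_eq hxR, sub_nonneg, div_le_one (by linarith)]
        linarith [d.mOut_le x hxR]
      positivity
  have := hmono self_mem_Ici hv hv
  rw [d.mOut_corner] at this
  exact hm₀.trans this

set_option maxHeartbeats 400000 in
/-- Global solution of the integrated evolution equations, with the asserted bounds. -/
theorem exists_state {α β : ℝ} (hs : Smallness α β R C M) (hm₀ : 0 ≤ m₀) :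
    ∃ X : ℝ → ℝ → Fin 6 → ℝ, Continuous (Function.uncurry X) ∧
      (∀ u ∈ Iic (-R), ∀ v ∈ Ici R, v - R - u ≤ X u v 0) ∧
      (∀ u ∈ Iic (-R), ∀ v ∈ Ici R, InBox α β R C M (fieldConst α C M / u ^ 2) (X u v)) ∧
      ∀ u ∈ Iic (-R), ∀ v ∈ Ici R, ∀ i, X u v i = d.base u v i +
        if evolvesInU i then ∫ s in (-R)..u, evolution (X s v) i
        else ∫ s in R..v, evolution (X u s) i := by
  have hR := hs.R_pos
  have hα := hs.one_lt_α
  have hM := hs.M_pos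
  have hC := hs.C_pos
  have hβ := hs.one_le_β
  have hK := hs.fieldConst_pos
  set τ : ℝ → (Fin 6 → ℝ) → Fin 6 → ℝ := fun u x => truncate α β R C M (fieldBound α R C M u) x
    with hτ
  obtain ⟨B, K, hBK⟩ := exists_bounds_truncated_evolution hs
  have hFc : ∀ i, Continuous fun q : ℝ × ℝ × (Fin 6 → ℝ) => evolution (τ q.1 q.2.2) i := by
    intro i
    have hq : Continuous fun q : ℝ × ℝ × (Fin 6 → ℝ) => (q.1, q.2.2) := by fun_prop
    have := (continuous_truncated_evolution hs).comp hq
    exact continuous_pi_iff.1 this i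
  -- X solves the truncated system. All sources below are evaluated at τ, which lies in the box by
  -- construction, so none of the bounds on X is circular.
  obtain ⟨X, hXc, hX⟩ := exists_goursat_solution (-R) R evolvesInU (fun i u v => d.base u v i)
    d.continuous_base (fun i u _ x => evolution (τ u x) i) hFc B K
    (fun i u _ x => (hBK i u x x).1) (fun i u _ x y => (hBK i u x y).2)
  have hbox : ∀ u v, InBox α β R C M (fieldBound α R C M u) (τ u (X u v)) := fun u v =>
    inBox_truncate hs (fieldBound_nonneg hs u) _
  have hEc : Continuous fun p : ℝ × ℝ => evolution (τ p.1 (X p.1 p.2)) :=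
    (continuous_truncated_evolution hs).comp (continuous_fst.prodMk hXc)
  have hEu : ∀ v i, Continuous fun s => evolution (τ s (X s v)) i := fun v i =>
    (continuous_apply i).comp (hEc.comp (by fun_prop : Continuous fun s : ℝ => (s, v)))
  have hEv : ∀ u i, Continuous fun s => evolution (τ u (X u s)) i := fun u i =>
    (continuous_apply i).comp (hEc.comp (by fun_prop : Continuous fun s : ℝ => (u, s)))
  have e0 : ∀ u v, X u v 0 = -u + ∫ s in R..v, τ u (X u s) 1 := fun u v => hX 0 u v
  have e1 : ∀ u v, X u v 1 = 1 + ∫ s in (-R)..u, radiusSource (τ s (X s v)) := fun u v => hX 1 u v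
  have e2 : ∀ u v, X u v 2 = -1 + ∫ s in R..v, radiusSource (τ u (X u s)) := fun u v => hX 2 u v
  have e3 : ∀ u v, X u v 3 = d.rOut (max v R) * d.φOut (max v R) + ∫ s in (-R)..u, τ s (X s v) 4 :=
    fun u v => hX 3 u v
  have e4 : ∀ u v, X u v 4 = derivWithin (fun u' => d.rIn u' * d.φIn u') (Iic (-R)) (min u (-R))
      + ∫ s in R..v, radiusSource (τ u (X u s)) * (τ u (X u s) 3 / τ u (X u s) 0) :=
    fun u v => hX 4 u v
  have e5 : ∀ u v, X u v 5 = d.mOut (max v R) + ∫ s in (-R)..u, evolution (τ s (X s v)) 5 :=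
    fun u v => hX 5 u v
  -- the area radius
  have r0 : ∀ u ∈ Iic (-R), ∀ v ∈ Ici R, v - R - u ≤ X u v 0 := by
    intro u hu v hv
    have h1 : ∫ _ in R..v, (1 : ℝ) ≤ ∫ s in R..v, τ u (X u s) 1 :=
      intervalIntegral.integral_mono_on hv (by simp) ((hEv u 0).intervalIntegrable _ _)
        fun s _ => (hbox u s).one_le_lam
    rw [e0]
    simp at h1
    linarith
  have hρ : ∀ u ∈ Iic (-R), ∀ v ∈ Ici R, R ≤ v - R - u := fun u hu v hv => by
    linarith [mem_Iic.1 hu, mem_Ici.1 hv]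
  have r1 : ∀ u ∈ Iic (-R), ∀ v ∈ Ici R, v - R - u ≤ τ u (X u v) 0 := fun u hu v hv =>
    (r0 u hu v hv).trans (le_max_left _ _)
  -- signs
  have l1 : ∀ u ∈ Iic (-R), ∀ v, 1 ≤ X u v 1 := by
    intro u hu v
    rw [e1, intervalIntegral.integral_symm]
    have : ∫ s in u..(-R), radiusSource (τ s (X s v)) ≤ 0 := by
      rw [← neg_nonneg, ← intervalIntegral.integral_neg]
      exact intervalIntegral.integral_nonneg hu fun s _ =>
        neg_nonneg.2 ((hbox s v).radiusSource_nonpos hs)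
    linarith
  have n1 : ∀ u, ∀ v ∈ Ici R, X u v 2 ≤ -1 := by
    intro u v hv
    rw [e2]
    have : ∫ s in R..v, radiusSource (τ u (X u s)) ≤ 0 := by
      rw [← neg_nonneg, ← intervalIntegral.integral_neg]
      exact intervalIntegral.integral_nonneg hv fun s _ =>
        neg_nonneg.2 ((hbox u s).radiusSource_nonpos hs)
    linarith
  have hq0 : 0 ≤ β * (4 * α * M) := by positivity
  have hexp : ∀ x, R ≤ x → Real.exp (β * (4 * α * M) / x) ≤ β := fun x hx =>
    (Real.exp_le_exp.2 (div_le_div_of_nonneg_left hq0 hR hx)).trans hs.growth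
  -- growth of `ν` and `λ`
  have n2 : ∀ u ∈ Iic (-R), ∀ v ∈ Ici R, -β ≤ X u v 2 := by
    intro u hu v hv
    have hu' := mem_Iic.1 hu
    have := le_exp_of_growth (a := R) (s := -R - u) (q := β * (4 * α * M)) (y := fun v => -X u v 2)
      (g := fun t => -radiusSource (τ u (X u t))) (by linarith) (hEv u 2).neg
      (fun x _ => by simp only [e2, intervalIntegral.integral_neg]; ring)
      (fun x hx => by
        have h1 := ((hbox u x).neg_radiusSource_le hs (hR.trans_le (hρ u hu x hx))
          (r1 u hu x hx)).2
        -- Since ν ≤ -1 is already known, clamping can only decrease |ν|, so the growth inequality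
        -- also holds with the untruncated ν on the right.
        have h2 : X u x 2 ≤ τ u (X u x) 2 := by
          change X u x 2 ≤ max (-β) (min (-1) (X u x 2))
          rw [min_eq_right (n1 u x hx)]
          exact le_max_right _ _
        refine h1.trans ?_
        rw [show x + (-R - u) = x - R - u by ring]
        exact mul_le_mul_of_nonneg_right (by linarith) (by positivity)) hq0 hv
    have h3 := hexp (R + (-R - u)) (by linarith)
    linarith
  have l2 : ∀ u ∈ Iic (-R), ∀ v ∈ Ici R, X u v 1 ≤ β := by
    intro u hu v hv
    have hu' := mem_Iic.1 hu
    have hv' := mem_Ici.1 hv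
    have := le_exp_of_growth (a := R) (s := v - R) (q := β * (4 * α * M))
      (y := fun x => X (-x) v 1) (x := -u)
      (g := fun t => -radiusSource (τ (-t) (X (-t) v))) (by linarith)
      ((hEu v 1).comp continuous_neg).neg
      (fun x _ => by
        simp only [e1, integral_reflect _ R, intervalIntegral.integral_neg, neg_neg])
      (fun x hx => by
        have hx' : -x ∈ Iic (-R) := neg_le_neg (mem_Ici.1 hx)
        have h1 := ((hbox (-x) v).neg_radiusSource_le hs (hR.trans_le (hρ _ hx' v hv))
          (r1 _ hx' v hv)).1
        -- As for ν: λ ≥ 1 is known, so clamping only decreases λ.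
        have h2 : τ (-x) (X (-x) v) 1 ≤ X (-x) v 1 :=
          max_le (l1 _ hx' v) (min_le_right _ _)
        refine h1.trans ?_
        rw [show x + (v - R) = v - R - -x by ring]
        exact mul_le_mul_of_nonneg_right h2 (by positivity)) hq0 (by linarith)
    have h3 := hexp (R + (v - R)) (by linarith)
    simp only [neg_neg] at this
    linarith
  -- the scalar field
  have f1 : ∀ u ∈ Iic (-R), ∀ v ∈ Ici R, |X u v 3| ≤ α * C := by
    intro u hu v hv
    have h1 := abs_integral_le_of_inv_sq_bound' (s := 0) (q := fieldConst α C M) hu (by linarith)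
      hK.le (g := fun s => τ s (X s v) 4) (fun x hx => by
        have := (hbox x v).du_rphi_le
        rwa [fieldBound_eq hx.2, ← neg_sq, ← zero_sub] at this)
    rw [add_zero] at h1
    rw [e3, max_eq_left (mem_Ici.1 hv)]
    exact (abs_add_le _ _).trans ((add_le_add (d.rφOut_le v hv) h1).trans hs.field)
  have z1 : ∀ u ∈ Iic (-R), ∀ v ∈ Ici R, |X u v 4| ≤ fieldConst α C M / u ^ 2 := by
    intro u hu v hv
    have hu' := mem_Iic.1 hu
    -- At v = R the lower bound for r equals -u, so the integral contributes α⁴MC/u², which adds to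
    -- the data bound C/u² to give exactly `fieldConst`/u².
    have h1 := abs_integral_le_of_inv_cube_bound (s := -R - u) (q := α ^ 4 * M * C)
      (mem_Ici.1 hv) (by linarith) (by positivity)
      (g := fun s => radiusSource (τ u (X u s)) * (τ u (X u s) 3 / τ u (X u s) 0)) (fun x hx => by
        have := (hbox u x).abs_source_le hs (hR.trans_le (hρ u hu x hx.1)) (r1 u hu x hx.1)
        rwa [show x + (-R - u) = x - R - u by ring])
    have h2 := d.rφIn_deriv_le u hu
    rw [show R + (-R - u) = -u by ring, neg_sq] at h1
    rw [sq_abs] at h2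
    rw [e4, min_eq_left hu']
    refine (abs_add_le _ _).trans ((add_le_add h2 h1).trans_eq ?_)
    rw [fieldConst]; ring
  -- the mass
  have m1 : ∀ u ∈ Iic (-R), ∀ v ∈ Ici R, 0 ≤ X u v 5 := by
    intro u hu v hv
    rw [e5, max_eq_left (mem_Ici.1 hv), intervalIntegral.integral_symm]
    have h1 := d.mOut_nonneg hm₀ hM (by
      have := hs.mass_le
      nlinarith) hv
    have : ∫ s in u..(-R), evolution (τ s (X s v)) 5 ≤ 0 := by
      rw [← neg_nonneg, ← intervalIntegral.integral_neg]
      exact intervalIntegral.integral_nonneg hu fun s _ =>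
        neg_nonneg.2 ((hbox s v).mass_source_bounds hs ((hbox s v).r_pos hs) le_rfl).1
    linarith
  have m2 : ∀ u ∈ Iic (-R), ∀ v ∈ Ici R, X u v 5 ≤ α * M := by
    intro u hu v hv
    rw [e5, max_eq_left (mem_Ici.1 hv)]
    have h1 := abs_integral_le_of_inv_sq_bound' (s := 0)
      (q := fieldConst α C M ^ 2 / R ^ 2 + β * (α ^ 2 * C ^ 2)) hu (by linarith)
      (by positivity) (g := fun s => evolution (τ s (X s v)) 5) (fun x hx => by
        have hxR : x ≤ -R := hx.2
        have hx0 : 0 < -x := by linarith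
        have hr := r1 x hxR v hv
        have h2 := ((hbox x v).mass_source_bounds hs hx0
          (by linarith [mem_Ici.1 hv])).2
        refine h2.trans ?_
        rw [fieldBound_eq hxR, zero_sub, add_div, ← neg_sq x, div_pow, div_div]
        gcongr ?_ + _
        refine div_le_div_of_nonneg_left (by positivity) (by positivity) ?_
        -- The square of the bound on ∂_u(rφ) decays like u⁻⁴; two of these powers are traded for
        -- R⁻².
        have h3 : R ^ 2 ≤ (-x) ^ 2 := pow_le_pow_left₀ hR.le (by linarith) 2
        calc R ^ 2 * (-x) ^ 2 ≤ (-x) ^ 2 * (-x) ^ 2 :=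
              mul_le_mul_of_nonneg_right h3 (sq_nonneg _)
          _ = ((-x) ^ 2) ^ 2 := by ring)
    rw [add_zero] at h1
    have h2 := le_abs_self (∫ s in (-R)..u, evolution (τ s (X s v)) 5)
    linarith [hs.mass, d.mOut_le v hv]
  have hXbox : ∀ u ∈ Iic (-R), ∀ v ∈ Ici R,
      InBox α β R C M (fieldConst α C M / u ^ 2) (X u v) := fun u hu v hv =>
    ⟨(hρ u hu v hv).trans (r0 u hu v hv), l1 u hu v, l2 u hu v hv, n2 u hu v hv, n1 u v hv,
      f1 u hu v hv, z1 u hu v hv, m1 u hu v hv, m2 u hu v hv⟩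
  -- The solution lies in the box, so the truncation is inactive on the wedge and the original
  -- equations hold.
  have hτX : ∀ u ∈ Iic (-R), ∀ v ∈ Ici R, τ u (X u v) = X u v := by
    intro u hu v hv
    have h := hXbox u hu v hv
    rw [← fieldBound_eq (mem_Iic.1 hu)] at h
    exact truncate_eq_self h
  refine ⟨X, hXc, r0, hXbox, fun u hu v hv i => ?_⟩
  rw [hX i u v]
  congr 1
  rcases hi : evolvesInU i with _ | _
  · simp only [Bool.false_eq_true, if_false]
    refine intervalIntegral.integral_congr fun s hs => ?_
    simp only [hτX u hu s ((isLineRetract_Ici R).uIcc_subset self_mem_Ici hv hs)]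
  · simp only [if_true]
    refine intervalIntegral.integral_congr fun s hs => ?_
    simp only [hτX s ((isLineRetract_Iic (-R)).uIcc_subset self_mem_Iic hu hs) v hv]

end CharData

end GammaProblem

/-! ### Propagation of the equation for ∂_v m. -/

namespace GammaProblem

/-- A continuous solution on the wedge of the first order system, without the equation for
`∂_v m`; here `ph = φ`, `ze = ζ`, `th = θ`. -/
structure ReducedSystem (R : ℝ) (r lam nu ph ze th m : ℝ → ℝ → ℝ) : Prop where
  r_cont : ContinuousOn (fun p : ℝ × ℝ => r p.1 p.2) (Iic (-R) ×ˢ Ici R)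
  lam_cont : ContinuousOn (fun p : ℝ × ℝ => lam p.1 p.2) (Iic (-R) ×ˢ Ici R)
  nu_cont : ContinuousOn (fun p : ℝ × ℝ => nu p.1 p.2) (Iic (-R) ×ˢ Ici R)
  ze_cont : ContinuousOn (fun p : ℝ × ℝ => ze p.1 p.2) (Iic (-R) ×ˢ Ici R)
  th_cont : ContinuousOn (fun p : ℝ × ℝ => th p.1 p.2) (Iic (-R) ×ˢ Ici R)
  m_cont : ContinuousOn (fun p : ℝ × ℝ => m p.1 p.2) (Iic (-R) ×ˢ Ici R)
  r_pos : ∀ u ∈ Iic (-R), ∀ v ∈ Ici R, 0 < r u v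
  lam_pos : ∀ u ∈ Iic (-R), ∀ v ∈ Ici R, 0 < lam u v
  nu_neg : ∀ u ∈ Iic (-R), ∀ v ∈ Ici R, nu u v < 0
  mu_lt : ∀ u ∈ Iic (-R), ∀ v ∈ Ici R, 0 < 1 - 2 * m u v / r u v
  du_r : ∀ u ∈ Iic (-R), ∀ v ∈ Ici R, HasDerivWithinAt (fun x => r x v) (nu u v) (Iic (-R)) u
  dv_r : ∀ u ∈ Iic (-R), ∀ v ∈ Ici R, HasDerivWithinAt (fun y => r u y) (lam u v) (Ici R) v
  du_lam : ∀ u ∈ Iic (-R), ∀ v ∈ Ici R, HasDerivWithinAt (fun x => lam x v)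
    (lam u v * nu u v * (2 * m u v / (r u v ^ 2 * (1 - 2 * m u v / r u v)))) (Iic (-R)) u
  dv_nu : ∀ u ∈ Iic (-R), ∀ v ∈ Ici R, HasDerivWithinAt (fun y => nu u y)
    (lam u v * nu u v * (2 * m u v / (r u v ^ 2 * (1 - 2 * m u v / r u v)))) (Ici R) v
  du_ph : ∀ u ∈ Iic (-R), ∀ v ∈ Ici R,
    HasDerivWithinAt (fun x => ph x v) (ze u v / r u v) (Iic (-R)) u
  dv_ph : ∀ u ∈ Iic (-R), ∀ v ∈ Ici R,
    HasDerivWithinAt (fun y => ph u y) (th u v / r u v) (Ici R) v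
  dv_ze : ∀ u ∈ Iic (-R), ∀ v ∈ Ici R,
    HasDerivWithinAt (fun y => ze u y) (-(th u v * nu u v / r u v)) (Ici R) v
  du_th : ∀ u ∈ Iic (-R), ∀ v ∈ Ici R,
    HasDerivWithinAt (fun x => th x v) (-(ze u v * lam u v / r u v)) (Iic (-R)) u
  du_m : ∀ u ∈ Iic (-R), ∀ v ∈ Ici R, HasDerivWithinAt (fun x => m x v)
    (1 / 2 * (1 - 2 * m u v / r u v) * ze u v ^ 2 / nu u v) (Iic (-R)) u

namespace ReducedSystem

variable {R : ℝ} {r lam nu ph ze th m : ℝ → ℝ → ℝ}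

section
variable (h : ReducedSystem R r lam nu ph ze th m)
include h

theorem r_ne : ∀ p ∈ Iic (-R) ×ˢ Ici R, r p.1 p.2 ≠ 0 := fun _ hp => (h.r_pos _ hp.1 _ hp.2).ne'

theorem lam_ne : ∀ p ∈ Iic (-R) ×ˢ Ici R, lam p.1 p.2 ≠ 0 := fun _ hp =>
  (h.lam_pos _ hp.1 _ hp.2).ne'

theorem nu_ne : ∀ p ∈ Iic (-R) ×ˢ Ici R, nu p.1 p.2 ≠ 0 := fun _ hp => (h.nu_neg _ hp.1 _ hp.2).ne

theorem one_sub_mu_cont :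
    ContinuousOn (fun p : ℝ × ℝ => 1 - 2 * m p.1 p.2 / r p.1 p.2) (Iic (-R) ×ˢ Ici R) :=
  continuousOn_const.sub ((h.m_cont.const_mul 2).div h.r_cont h.r_ne)

theorem coeff_cont :
    ContinuousOn (fun p : ℝ × ℝ =>
      2 * m p.1 p.2 / (r p.1 p.2 ^ 2 * (1 - 2 * m p.1 p.2 / r p.1 p.2))) (Iic (-R) ×ˢ Ici R) :=
  (h.m_cont.const_mul 2).div ((h.r_cont.pow 2).mul h.one_sub_mu_cont) fun p hp =>
    mul_ne_zero (pow_ne_zero 2 (h.r_ne p hp)) (h.mu_lt _ hp.1 _ hp.2).ne'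

end

theorem slice_left {f : ℝ → ℝ → ℝ} (hf : ContinuousOn (fun p : ℝ × ℝ => f p.1 p.2)
    (Iic (-R) ×ˢ Ici R)) {v : ℝ} (hv : v ∈ Ici R) : ContinuousOn (fun x => f x v) (Iic (-R)) :=
  hf.comp (f := fun x : ℝ => (x, v)) (by fun_prop) fun _ hx => ⟨hx, hv⟩

theorem slice_right {f : ℝ → ℝ → ℝ} (hf : ContinuousOn (fun p : ℝ × ℝ => f p.1 p.2)
    (Iic (-R) ×ˢ Ici R)) {u : ℝ} (hu : u ∈ Iic (-R)) : ContinuousOn (fun y => f u y) (Ici R) :=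
  hf.comp (f := fun y : ℝ => (u, y)) (by fun_prop) fun _ hy => ⟨hu, hy⟩

/-- Propagation of the constraint `∂_v m = ½ (1 - μ) θ² / λ` from the initial segment. -/
theorem dv_m (h : ReducedSystem R r lam nu ph ze th m)
    (h0 : ∀ v ∈ Ici R, HasDerivWithinAt (fun y => m (-R) y)
      (1 / 2 * (1 - 2 * m (-R) v / r (-R) v) * th (-R) v ^ 2 / lam (-R) v) (Ici R) v) :
    ∀ u ∈ Iic (-R), ∀ v ∈ Ici R, HasDerivWithinAt (fun y => m u y)
      (1 / 2 * (1 - 2 * m u v / r u v) * th u v ^ 2 / lam u v) (Ici R) v := by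
  have hs := isLineRetract_Iic (-R)
  have ht := isLineRetract_Ici R
  set a : ℝ → ℝ → ℝ := fun u v => ze u v ^ 2 / (nu u v * r u v) with ha
  -- With a = ζ²/(νr) the mass equation in u is linear, ∂_u m + a m = ra/2, and `av` is ∂_v a.
  set av : ℝ → ℝ → ℝ := fun u v => -2 * ze u v * th u v / r u v ^ 2
    - ze u v ^ 2 * (lam u v * (2 * m u v / (r u v ^ 2 * (1 - 2 * m u v / r u v))))
      / (nu u v * r u v) - ze u v ^ 2 * lam u v / (nu u v * r u v ^ 2) with hav
  have hνr : ∀ p ∈ Iic (-R) ×ˢ Ici R, nu p.1 p.2 * r p.1 p.2 ≠ 0 := fun p hp =>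
    mul_ne_zero (h.nu_ne p hp) (h.r_ne p hp)
  have a_cont : ContinuousOn (fun p : ℝ × ℝ => a p.1 p.2) (Iic (-R) ×ˢ Ici R) :=
    (h.ze_cont.pow 2).div (h.nu_cont.mul h.r_cont) hνr
  have av_cont : ContinuousOn (fun p : ℝ × ℝ => av p.1 p.2) (Iic (-R) ×ˢ Ici R) := by
    refine ((((h.ze_cont.const_mul (-2)).mul h.th_cont).div (h.r_cont.pow 2) fun p hp =>
      pow_ne_zero 2 (h.r_ne p hp)).sub (((h.ze_cont.pow 2).mul (h.lam_cont.mul h.coeff_cont)).div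
        (h.nu_cont.mul h.r_cont) hνr)).sub (((h.ze_cont.pow 2).mul h.lam_cont).div
        (h.nu_cont.mul (h.r_cont.pow 2)) fun p hp =>
          mul_ne_zero (h.nu_ne p hp) (pow_ne_zero 2 (h.r_ne p hp)))
  have dv_a : ∀ u ∈ Iic (-R), ∀ v ∈ Ici R,
      HasDerivWithinAt (fun y => a u y) (av u v) (Ici R) v := by
    intro u hu v hv
    have r0 := (h.r_pos u hu v hv).ne'
    have n0 := (h.nu_neg u hu v hv).ne
    refine (((h.dv_ze u hu v hv).pow 2).div ((h.dv_nu u hu v hv).mul (h.dv_r u hu v hv))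
      (mul_ne_zero n0 r0)).congr_deriv ?_
    simp only [hav, Pi.pow_apply, Pi.mul_apply]
    generalize 2 * m u v / (r u v ^ 2 * (1 - 2 * m u v / r u v)) = k
    field_simp
    ring
  set A : ℝ → ℝ → ℝ := fun u v => ∫ s in (-R)..u, a s v with hA
  set Av : ℝ → ℝ → ℝ := fun u v => ∫ s in (-R)..u, av s v with hAv
  have A_cont : ContinuousOn (fun p : ℝ × ℝ => A p.1 p.2) (Iic (-R) ×ˢ Ici R) :=
    hs.continuousOn_integral_left ht (H := a) a_cont self_mem_Iic
  have Av_cont : ContinuousOn (fun p : ℝ × ℝ => Av p.1 p.2) (Iic (-R) ×ˢ Ici R) :=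
    hs.continuousOn_integral_left ht (H := av) av_cont self_mem_Iic
  have du_A : ∀ u ∈ Iic (-R), ∀ v ∈ Ici R,
      HasDerivWithinAt (fun x => A x v) (a u v) (Iic (-R)) u := fun u hu v hv =>
    hs.hasDerivWithinAt_integral (slice_left a_cont hv) self_mem_Iic hu
  have du_Av : ∀ u ∈ Iic (-R), ∀ v ∈ Ici R,
      HasDerivWithinAt (fun x => Av x v) (av u v) (Iic (-R)) u := fun u hu v hv =>
    hs.hasDerivWithinAt_integral (slice_left av_cont hv) self_mem_Iic hu
  have dv_A : ∀ u ∈ Iic (-R), ∀ v ∈ Ici R,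
      HasDerivWithinAt (fun y => A u y) (Av u v) (Ici R) v := fun u hu v hv =>
    hs.hasDerivWithinAt_integral_left ht (A := a) (H := av) a_cont av_cont dv_a self_mem_Iic hu hv
  have A_zero : ∀ v, A (-R) v = 0 := fun v => intervalIntegral.integral_same
  have Av_zero : ∀ v, Av (-R) v = 0 := fun v => intervalIntegral.integral_same
  set g : ℝ → ℝ → ℝ := fun u v => 1 / 2 * Real.exp (A u v) * (r u v * a u v) with hg
  set gv : ℝ → ℝ → ℝ := fun u v =>
    1 / 2 * Real.exp (A u v) * (Av u v * (r u v * a u v) + lam u v * a u v + r u v * av u v)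
    with hgv
  have exp_cont : ContinuousOn (fun p : ℝ × ℝ => 1 / 2 * Real.exp (A p.1 p.2))
      (Iic (-R) ×ˢ Ici R) := (Real.continuous_exp.comp_continuousOn A_cont).const_mul (1 / 2)
  have g_cont : ContinuousOn (fun p : ℝ × ℝ => g p.1 p.2) (Iic (-R) ×ˢ Ici R) :=
    exp_cont.mul (h.r_cont.mul a_cont)
  have gv_cont : ContinuousOn (fun p : ℝ × ℝ => gv p.1 p.2) (Iic (-R) ×ˢ Ici R) :=
    exp_cont.mul (((Av_cont.mul (h.r_cont.mul a_cont)).add (h.lam_cont.mul a_cont)).add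
      (h.r_cont.mul av_cont))
  have dv_g : ∀ u ∈ Iic (-R), ∀ v ∈ Ici R,
      HasDerivWithinAt (fun y => g u y) (gv u v) (Ici R) v := by
    intro u hu v hv
    refine (((dv_A u hu v hv).exp.const_mul (1 / 2)).mul
      ((h.dv_r u hu v hv).mul (dv_a u hu v hv))).congr_deriv ?_
    simp only [hgv, Pi.mul_apply]
    ring
  -- Integrating factor: ∂_u(e^A m) = g with ∂_u A = a. The right-hand side is visibly
  -- differentiable in v, which is not yet known for m.
  have hP : ∀ u ∈ Iic (-R), ∀ v ∈ Ici R,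
      Real.exp (A u v) * m u v = m (-R) v + ∫ s in (-R)..u, g s v := by
    intro u hu v hv
    have := hs.integral_eq_sub (f := fun x => Real.exp (A x v) * m x v) (f' := fun x => g x v)
      (fun x hx => by
        have r0 := (h.r_pos x hx v hv).ne'
        have n0 := (h.nu_neg x hx v hv).ne
        refine ((du_A x hx v hv).exp.mul (h.du_m x hx v hv)).congr_deriv ?_
        simp only [hg, ha]
        field_simp
        ring) (slice_left g_cont hv) self_mem_Iic hu
    rw [this, A_zero, Real.exp_zero]
    ring
  set N : ℝ → ℝ → ℝ := fun u v => 1 / 2 * (1 - 2 * m u v / r u v) * th u v ^ 2 / lam u v with hN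
  -- The expected v-derivative of e^A m is e^A(A_v m + N), with N the claimed value of ∂_v m. The
  -- system shows that its u-derivative is ∂_v g, so it equals the v-derivative of the right-hand
  -- side of `hP`.
  have hQ : ∀ u ∈ Iic (-R), ∀ v ∈ Ici R,
      Real.exp (A u v) * (Av u v * m u v + N u v) = N (-R) v + ∫ s in (-R)..u, gv s v := by
    intro u hu v hv
    have := hs.integral_eq_sub (f := fun x => Real.exp (A x v) * (Av x v * m x v + N x v))
      (f' := fun x => gv x v)
      (fun x hx => by
        have r0 := (h.r_pos x hx v hv).ne'
        have n0 := (h.nu_neg x hx v hv).ne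
        have l0 := (h.lam_pos x hx v hv).ne'
        have k0 := (h.mu_lt x hx v hv).ne'
        have hNu := ((((((h.du_m x hx v hv).const_mul 2).div (h.du_r x hx v hv) r0).const_sub
          1).const_mul (1 / 2)).mul ((h.du_th x hx v hv).pow 2)).div (h.du_lam x hx v hv) l0
        refine ((du_A x hx v hv).exp.mul (((du_Av x hx v hv).mul (h.du_m x hx v hv)).add
          hNu)).congr_deriv ?_
        have hk : 2 * m x v / (r x v ^ 2 * (1 - 2 * m x v / r x v))
            = (1 - (1 - 2 * m x v / r x v)) / (r x v * (1 - 2 * m x v / r x v)) := by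
          rw [div_eq_div_iff (mul_ne_zero (pow_ne_zero 2 r0) k0) (mul_ne_zero r0 k0)]
          field_simp
          ring
        have hm : m x v = r x v * (1 - (1 - 2 * m x v / r x v)) / 2 := by
          field_simp
          ring
        simp only [hgv, ha, hav, Pi.add_apply, Pi.mul_apply, Pi.pow_apply, Pi.div_apply, hk]
        -- With κ = 1 - μ as a free variable and m = r(1 - κ)/2, the identity becomes rational in
        -- independent quantities.
        generalize hκ : 1 - 2 * m x v / r x v = κ at k0 hm
        rw [hm]
        generalize Real.exp (A x v) = E
        field_simp
        ring) (slice_left gv_cont hv) self_mem_Iic hu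
    rw [this, A_zero, Av_zero, Real.exp_zero]
    ring
  intro u hu v hv
  have hPv : HasDerivWithinAt (fun y => m (-R) y + ∫ s in (-R)..u, g s y)
      (N (-R) v + ∫ s in (-R)..u, gv s v) (Ici R) v :=
    (h0 v hv).add (hs.hasDerivWithinAt_integral_left ht (A := g) (H := gv) g_cont gv_cont dv_g self_mem_Iic hu hv)
  have hm : ∀ y ∈ Ici R, m u y = Real.exp (-A u y) * (m (-R) y + ∫ s in (-R)..u, g s y) := by
    intro y hy
    rw [← hP u hu y hy, ← mul_assoc, ← Real.exp_add, neg_add_cancel, Real.exp_zero, one_mul]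
  refine HasDerivWithinAt.congr (((dv_A u hu v hv).neg.exp.mul hPv).congr_deriv ?_) hm (hm v hv)
  simp only [Pi.neg_apply]
  rw [← hQ u hu v hv, ← hP u hu v hv, Real.exp_neg]
  have := (Real.exp_pos (A u v)).ne'
  field_simp
  ring

end ReducedSystem

end GammaProblem

/-! ### C² regularity of solutions. -/

theorem contDiffOn_one_of_partials {s t : Set ℝ} (hs : Convex ℝ s)
    (hsu : UniqueDiffOn ℝ s) (htu : UniqueDiffOn ℝ t) {f fu fv : ℝ → ℝ → ℝ}
    (hu : ∀ x ∈ s, ∀ y ∈ t, HasDerivWithinAt (fun x' => f x' y) (fu x y) s x)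
    (hv : ∀ x ∈ s, ∀ y ∈ t, HasDerivWithinAt (fun y' => f x y') (fv x y) t y)
    (hfu : ContinuousOn (fun p : ℝ × ℝ => fu p.1 p.2) (s ×ˢ t))
    (hfv : ContinuousOn (fun p : ℝ × ℝ => fv p.1 p.2) (s ×ˢ t)) :
    ContDiffOn ℝ 1 (fun p : ℝ × ℝ => f p.1 p.2) (s ×ˢ t) := by
  have := contDiffOn_succ_of_partials (n := 0) hs hsu htu hu hv (contDiffOn_zero.2 hfu)
    (contDiffOn_zero.2 hfv)
  rw [Nat.cast_zero, zero_add] at this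
  exact this

/-- Dependence on the parameter `x` of the solution of `∂_y f = f κ` with constant initial value. -/
theorem IsLineRetract.hasDerivWithinAt_of_linear {s t : Set ℝ} (hs : IsLineRetract s)
    (ht : IsLineRetract t) {f κ κx : ℝ → ℝ → ℝ}
    (hκ : ContinuousOn (fun p : ℝ × ℝ => κ p.1 p.2) (s ×ˢ t))
    (hκx : ContinuousOn (fun p : ℝ × ℝ => κx p.1 p.2) (s ×ˢ t))
    (dκ : ∀ x ∈ s, ∀ y ∈ t, HasDerivWithinAt (fun x' => κ x' y) (κx x y) s x)
    (df : ∀ x ∈ s, ∀ y ∈ t, HasDerivWithinAt (fun y' => f x y') (f x y * κ x y) t y)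
    {c k : ℝ} (hc : c ∈ t) (hk : ∀ x ∈ s, f x c = k) :
    ∀ x ∈ s, ∀ y ∈ t,
      HasDerivWithinAt (fun x' => f x' y) (f x y * ∫ w in c..y, κx x w) s x := by
  -- The explicit solution moves the x-dependence into κ, so no differentiability of f in x is
  -- presupposed.
  have hf : ∀ x ∈ s, ∀ y ∈ t, f x y = k * Real.exp (∫ w in c..y, κ x w) := by
    intro x hx y hy
    have hκs : ContinuousOn (κ x) t :=
      hκ.comp (f := fun y : ℝ => (x, y)) (by fun_prop) fun y hy => ⟨hx, hy⟩
    have := ht.integral_eq_sub (f := fun y => f x y * Real.exp (-∫ w in c..y, κ x w))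
      (f' := fun _ => 0) (fun y hy => by
        refine ((df x hx y hy).mul
          (ht.hasDerivWithinAt_integral hκs hc hy).neg.exp).congr_deriv ?_
        simp only [Pi.neg_apply]
        ring) continuousOn_const hc hy
    rw [intervalIntegral.integral_zero, intervalIntegral.integral_same, neg_zero, Real.exp_zero,
      hk x hx, mul_one, eq_comm, sub_eq_zero] at this
    rw [← this, mul_assoc, ← Real.exp_add, neg_add_cancel, Real.exp_zero, mul_one]
  intro x hx y hy
  have h1 := ((hs.hasDerivWithinAt_integral_right ht (A := κ) (H := κx) hκ hκx dκ hc hx hy).exp).const_mul k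
  refine HasDerivWithinAt.congr (h1.congr_deriv ?_) (fun x' hx' => hf x' hx' y hy) (hf x hx y hy)
  rw [hf x hx y hy]
  ring

namespace GammaProblem

/-- The derivative of `2m / (r² (1 - 2m/r))` in a direction in which `m' = ∂ m`, `r' = ∂ r`. -/
noncomputable def coeffDeriv (m r m' r' : ℝ) : ℝ :=
  (2 * m' * (r ^ 2 * (1 - 2 * m / r))
    - 2 * m * (2 * r * r' * (1 - 2 * m / r) - (2 * m' * r - 2 * m * r')))
    / (r ^ 2 * (1 - 2 * m / r)) ^ 2

theorem hasDerivWithinAt_coeff {m r : ℝ → ℝ} {m' r' x : ℝ} {s : Set ℝ}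
    (hm : HasDerivWithinAt m m' s x) (hr : HasDerivWithinAt r r' s x) (r0 : r x ≠ 0)
    (k0 : 1 - 2 * m x / r x ≠ 0) :
    HasDerivWithinAt (fun x => 2 * m x / (r x ^ 2 * (1 - 2 * m x / r x)))
      (coeffDeriv (m x) (r x) m' r') s x := by
  refine ((hm.const_mul 2).div ((hr.pow 2).mul (((hm.const_mul 2).div hr r0).const_sub 1))
    (mul_ne_zero (pow_ne_zero 2 r0) k0)).congr_deriv ?_
  simp only [coeffDeriv, Pi.pow_apply, Pi.mul_apply, Pi.div_apply]
  congr 1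
  field_simp
  ring

theorem continuousOn_coeffDeriv {m r m' r' : ℝ × ℝ → ℝ} {s : Set (ℝ × ℝ)} (hm : ContinuousOn m s)
    (hr : ContinuousOn r s) (hm' : ContinuousOn m' s) (hr' : ContinuousOn r' s)
    (r0 : ∀ p ∈ s, r p ≠ 0) (k0 : ∀ p ∈ s, 1 - 2 * m p / r p ≠ 0) :
    ContinuousOn (fun p => coeffDeriv (m p) (r p) (m' p) (r' p)) s := by
  have hk : ContinuousOn (fun p => 1 - 2 * m p / r p) s :=
    continuousOn_const.sub ((hm.const_mul 2).div hr r0)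
  refine ContinuousOn.div ?_ (((hr.pow 2).mul hk).pow 2) fun p hp =>
    pow_ne_zero 2 (mul_ne_zero (pow_ne_zero 2 (r0 p hp)) (k0 p hp))
  exact ((hm'.const_mul 2).mul ((hr.pow 2).mul hk)).sub ((hm.const_mul 2).mul
    ((((hr.const_mul 2).mul hr').mul hk).sub (((hm'.const_mul 2).mul hr).sub
      ((hm.const_mul 2).mul hr'))))

namespace ReducedSystem

variable {R : ℝ} {r lam nu ph ze th m : ℝ → ℝ → ℝ}

section
variable (h : ReducedSystem R r lam nu ph ze th m)
include h

theorem mu_ne : ∀ p ∈ Iic (-R) ×ˢ Ici R, 1 - 2 * m p.1 p.2 / r p.1 p.2 ≠ 0 := fun _ hp =>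
  (h.mu_lt _ hp.1 _ hp.2).ne'

theorem du_m_cont : ContinuousOn (fun p : ℝ × ℝ =>
    1 / 2 * (1 - 2 * m p.1 p.2 / r p.1 p.2) * ze p.1 p.2 ^ 2 / nu p.1 p.2)
    (Iic (-R) ×ˢ Ici R) :=
  ((h.one_sub_mu_cont.const_mul (1 / 2)).mul (h.ze_cont.pow 2)).div h.nu_cont h.nu_ne

theorem dv_m_cont : ContinuousOn (fun p : ℝ × ℝ =>
    1 / 2 * (1 - 2 * m p.1 p.2 / r p.1 p.2) * th p.1 p.2 ^ 2 / lam p.1 p.2)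
    (Iic (-R) ×ˢ Ici R) :=
  ((h.one_sub_mu_cont.const_mul (1 / 2)).mul (h.th_cont.pow 2)).div h.lam_cont h.lam_ne

theorem source_cont : ContinuousOn (fun p : ℝ × ℝ => lam p.1 p.2 * nu p.1 p.2 *
    (2 * m p.1 p.2 / (r p.1 p.2 ^ 2 * (1 - 2 * m p.1 p.2 / r p.1 p.2)))) (Iic (-R) ×ˢ Ici R) :=
  (h.lam_cont.mul h.nu_cont).mul h.coeff_cont

/-- The system gives ∂_vν but no equation for ∂_uν. As ∂_vν = νκ with ν = -1 on v = R, ν is an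
explicit exponential of ∫κ, and κ involves only r, λ, m, whose u-derivatives are known. -/
theorem exists_du_nu (hin : ∀ u ∈ Iic (-R), nu u R = -1) :
    ∃ nuU : ℝ → ℝ → ℝ, ContinuousOn (fun p : ℝ × ℝ => nuU p.1 p.2) (Iic (-R) ×ˢ Ici R) ∧
      ∀ u ∈ Iic (-R), ∀ v ∈ Ici R,
        HasDerivWithinAt (fun x => nu x v) (nuU u v) (Iic (-R)) u := by
  have hs := isLineRetract_Iic (-R)
  have ht := isLineRetract_Ici R
  set κ : ℝ → ℝ → ℝ := fun u v => lam u v * (2 * m u v / (r u v ^ 2 * (1 - 2 * m u v / r u v)))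
    with hκ
  set κu : ℝ → ℝ → ℝ := fun u v =>
    lam u v * nu u v * (2 * m u v / (r u v ^ 2 * (1 - 2 * m u v / r u v)))
      * (2 * m u v / (r u v ^ 2 * (1 - 2 * m u v / r u v)))
    + lam u v * coeffDeriv (m u v) (r u v)
      (1 / 2 * (1 - 2 * m u v / r u v) * ze u v ^ 2 / nu u v) (nu u v) with hκu
  have κ_cont : ContinuousOn (fun p : ℝ × ℝ => κ p.1 p.2) (Iic (-R) ×ˢ Ici R) :=
    h.lam_cont.mul h.coeff_cont
  have κu_cont : ContinuousOn (fun p : ℝ × ℝ => κu p.1 p.2) (Iic (-R) ×ˢ Ici R) :=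
    (h.source_cont.mul h.coeff_cont).add (h.lam_cont.mul (continuousOn_coeffDeriv h.m_cont
      h.r_cont h.du_m_cont h.nu_cont h.r_ne h.mu_ne))
  refine ⟨fun u v => nu u v * ∫ w in R..v, κu u w, ?_, ?_⟩
  · exact h.nu_cont.mul (hs.continuousOn_integral_right ht (H := κu) κu_cont self_mem_Ici)
  · refine hs.hasDerivWithinAt_of_linear ht κ_cont κu_cont (fun u hu v hv => ?_)
      (fun u hu v hv => ?_) self_mem_Ici hin
    · exact (h.du_lam u hu v hv).mul (hasDerivWithinAt_coeff (h.du_m u hu v hv) (h.du_r u hu v hv)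
        (h.r_ne (u, v) ⟨hu, hv⟩) (h.mu_ne (u, v) ⟨hu, hv⟩))
    · refine (h.dv_nu u hu v hv).congr_deriv ?_
      simp only [hκ]
      ring

/-- The mirror image for λ. Here κ is differentiated in v, so the propagated equation for ∂_v m is
needed. -/
theorem exists_dv_lam (dvm : ∀ u ∈ Iic (-R), ∀ v ∈ Ici R, HasDerivWithinAt (fun y => m u y)
      (1 / 2 * (1 - 2 * m u v / r u v) * th u v ^ 2 / lam u v) (Ici R) v)
    (hout : ∀ v ∈ Ici R, lam (-R) v = 1) :
    ∃ lamV : ℝ → ℝ → ℝ, ContinuousOn (fun p : ℝ × ℝ => lamV p.1 p.2) (Iic (-R) ×ˢ Ici R) ∧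
      ∀ u ∈ Iic (-R), ∀ v ∈ Ici R,
        HasDerivWithinAt (fun y => lam u y) (lamV u v) (Ici R) v := by
  have hs := isLineRetract_Iic (-R)
  have ht := isLineRetract_Ici R
  have hswap : ∀ {f : ℝ → ℝ → ℝ}, ContinuousOn (fun p : ℝ × ℝ => f p.1 p.2) (Iic (-R) ×ˢ Ici R) →
      ContinuousOn (fun p : ℝ × ℝ => f p.2 p.1) (Ici R ×ˢ Iic (-R)) := fun hf =>
    hf.comp continuous_swap.continuousOn fun _ hp => ⟨hp.2, hp.1⟩
  set κ : ℝ → ℝ → ℝ := fun u v => nu u v * (2 * m u v / (r u v ^ 2 * (1 - 2 * m u v / r u v)))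
    with hκ
  set κv : ℝ → ℝ → ℝ := fun u v =>
    lam u v * nu u v * (2 * m u v / (r u v ^ 2 * (1 - 2 * m u v / r u v)))
      * (2 * m u v / (r u v ^ 2 * (1 - 2 * m u v / r u v)))
    + nu u v * coeffDeriv (m u v) (r u v)
      (1 / 2 * (1 - 2 * m u v / r u v) * th u v ^ 2 / lam u v) (lam u v) with hκv
  have κ_cont : ContinuousOn (fun p : ℝ × ℝ => κ p.1 p.2) (Iic (-R) ×ˢ Ici R) :=
    h.nu_cont.mul h.coeff_cont
  have κv_cont : ContinuousOn (fun p : ℝ × ℝ => κv p.1 p.2) (Iic (-R) ×ˢ Ici R) :=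
    (h.source_cont.mul h.coeff_cont).add (h.nu_cont.mul (continuousOn_coeffDeriv h.m_cont
      h.r_cont h.dv_m_cont h.lam_cont h.r_ne h.mu_ne))
  refine ⟨fun u v => lam u v * ∫ w in (-R)..u, κv w v, ?_, ?_⟩
  · exact h.lam_cont.mul (hs.continuousOn_integral_left ht (H := κv) κv_cont self_mem_Iic)
  · intro u hu v hv
    refine ht.hasDerivWithinAt_of_linear hs (f := fun y x => lam x y) (κ := fun y x => κ x y)
      (κx := fun y x => κv x y) (hswap κ_cont) (hswap κv_cont) (fun v hv u hu => ?_)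
      (fun v hv u hu => ?_) self_mem_Iic hout v hv u hu
    · exact (h.dv_nu u hu v hv).mul (hasDerivWithinAt_coeff (dvm u hu v hv) (h.dv_r u hu v hv)
        (h.r_ne (u, v) ⟨hu, hv⟩) (h.mu_ne (u, v) ⟨hu, hv⟩))
    · refine (h.du_lam u hu v hv).congr_deriv ?_
      simp only [hκ]
      ring

/-- The missing derivative ∂_uζ is obtained by differentiating the v-integral of -θν/r under the
integral sign, which uses ∂_uν. -/
theorem contDiffOn_ze {nuU : ℝ → ℝ → ℝ}
    (nuU_cont : ContinuousOn (fun p : ℝ × ℝ => nuU p.1 p.2) (Iic (-R) ×ˢ Ici R))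
    (du_nu : ∀ u ∈ Iic (-R), ∀ v ∈ Ici R,
      HasDerivWithinAt (fun x => nu x v) (nuU u v) (Iic (-R)) u)
    {zi' : ℝ → ℝ} (zi'_cont : ContinuousOn zi' (Iic (-R)))
    (hzi : ∀ u ∈ Iic (-R), HasDerivWithinAt (fun x => ze x R) (zi' u) (Iic (-R)) u) :
    ContDiffOn ℝ 1 (fun p : ℝ × ℝ => ze p.1 p.2) (Iic (-R) ×ˢ Ici R) := by
  have hs := isLineRetract_Iic (-R)
  have ht := isLineRetract_Ici R
  set w : ℝ → ℝ → ℝ := fun u v => -(th u v * nu u v / r u v) with hw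
  set wu : ℝ → ℝ → ℝ := fun u v => -(((-(ze u v * lam u v / r u v) * nu u v + th u v * nuU u v)
    * r u v - th u v * nu u v * nu u v) / r u v ^ 2) with hwu
  have w_cont : ContinuousOn (fun p : ℝ × ℝ => w p.1 p.2) (Iic (-R) ×ˢ Ici R) :=
    ((h.th_cont.mul h.nu_cont).div h.r_cont h.r_ne).neg
  have wu_cont : ContinuousOn (fun p : ℝ × ℝ => wu p.1 p.2) (Iic (-R) ×ˢ Ici R) :=
    ((((((h.ze_cont.mul h.lam_cont).div h.r_cont h.r_ne).neg.mul h.nu_cont).add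
      (h.th_cont.mul nuU_cont)).mul h.r_cont).sub ((h.th_cont.mul h.nu_cont).mul h.nu_cont)).div
      (h.r_cont.pow 2) (fun p hp => pow_ne_zero 2 (h.r_ne p hp)) |>.neg
  have du_w : ∀ u ∈ Iic (-R), ∀ v ∈ Ici R,
      HasDerivWithinAt (fun x => w x v) (wu u v) (Iic (-R)) u := fun u hu v hv =>
    (((h.du_th u hu v hv).mul (du_nu u hu v hv)).div (h.du_r u hu v hv)
      (h.r_ne (u, v) ⟨hu, hv⟩)).neg
  have hze : ∀ u ∈ Iic (-R), ∀ v ∈ Ici R, ze u v = ze u R + ∫ y in R..v, w u y := by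
    intro u hu v hv
    rw [ht.integral_eq_sub (f' := fun y => w u y) (h.dv_ze u hu) (slice_right w_cont hu)
      self_mem_Ici hv]
    ring
  refine contDiffOn_one_of_partials (convex_Iic _) (uniqueDiffOn_Iic _) (uniqueDiffOn_Ici _)
    (fu := fun u v => zi' u + ∫ y in R..v, wu u y) (fv := w) (fun u hu v hv => ?_) h.dv_ze ?_ w_cont
  · exact ((hzi u hu).add (hs.hasDerivWithinAt_integral_right ht (A := w) (H := wu) w_cont wu_cont
      du_w self_mem_Ici hu hv)).congr (fun x hx => hze x hx v hv) (hze u hu v hv)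
  · exact (zi'_cont.comp continuousOn_fst fun p hp => hp.1).add
      (hs.continuousOn_integral_right ht (H := wu) wu_cont self_mem_Ici)

theorem contDiffOn_th {lamV : ℝ → ℝ → ℝ}
    (lamV_cont : ContinuousOn (fun p : ℝ × ℝ => lamV p.1 p.2) (Iic (-R) ×ˢ Ici R))
    (dv_lam : ∀ u ∈ Iic (-R), ∀ v ∈ Ici R,
      HasDerivWithinAt (fun y => lam u y) (lamV u v) (Ici R) v)
    {ti' : ℝ → ℝ} (ti'_cont : ContinuousOn ti' (Ici R))
    (hti : ∀ v ∈ Ici R, HasDerivWithinAt (fun y => th (-R) y) (ti' v) (Ici R) v) :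
    ContDiffOn ℝ 1 (fun p : ℝ × ℝ => th p.1 p.2) (Iic (-R) ×ˢ Ici R) := by
  have hs := isLineRetract_Iic (-R)
  have ht := isLineRetract_Ici R
  set w : ℝ → ℝ → ℝ := fun u v => -(ze u v * lam u v / r u v) with hw
  set wv : ℝ → ℝ → ℝ := fun u v => -(((-(th u v * nu u v / r u v) * lam u v + ze u v * lamV u v)
    * r u v - ze u v * lam u v * lam u v) / r u v ^ 2) with hwv
  have w_cont : ContinuousOn (fun p : ℝ × ℝ => w p.1 p.2) (Iic (-R) ×ˢ Ici R) :=
    ((h.ze_cont.mul h.lam_cont).div h.r_cont h.r_ne).neg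
  have wv_cont : ContinuousOn (fun p : ℝ × ℝ => wv p.1 p.2) (Iic (-R) ×ˢ Ici R) :=
    ((((((h.th_cont.mul h.nu_cont).div h.r_cont h.r_ne).neg.mul h.lam_cont).add
      (h.ze_cont.mul lamV_cont)).mul h.r_cont).sub ((h.ze_cont.mul h.lam_cont).mul h.lam_cont)).div
      (h.r_cont.pow 2) (fun p hp => pow_ne_zero 2 (h.r_ne p hp)) |>.neg
  have dv_w : ∀ u ∈ Iic (-R), ∀ v ∈ Ici R,
      HasDerivWithinAt (fun y => w u y) (wv u v) (Ici R) v := fun u hu v hv =>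
    (((h.dv_ze u hu v hv).mul (dv_lam u hu v hv)).div (h.dv_r u hu v hv)
      (h.r_ne (u, v) ⟨hu, hv⟩)).neg
  have hth : ∀ u ∈ Iic (-R), ∀ v ∈ Ici R, th u v = th (-R) v + ∫ x in (-R)..u, w x v := by
    intro u hu v hv
    rw [hs.integral_eq_sub (f' := fun x => w x v) (fun x hx => h.du_th x hx v hv)
      (slice_left w_cont hv) self_mem_Iic hu]
    ring
  refine contDiffOn_one_of_partials (convex_Iic _) (uniqueDiffOn_Iic _) (uniqueDiffOn_Ici _)
    (fu := w) (fv := fun u v => ti' v + ∫ x in (-R)..u, wv x v) h.du_th (fun u hu v hv => ?_) w_cont ?_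
  · exact ((hti v hv).add (hs.hasDerivWithinAt_integral_left ht (A := w) (H := wv) w_cont wv_cont
      dv_w self_mem_Iic hu hv)).congr (fun y hy => hth u hu y hy) (hth u hu v hv)
  · exact (ti'_cont.comp continuousOn_snd fun p hp => hp.2).add
      (hs.continuousOn_integral_left ht (H := wv) wv_cont self_mem_Iic)

/-- Solutions with `C²` data are `C²`. -/
theorem contDiffOn_two
    (dvm : ∀ u ∈ Iic (-R), ∀ v ∈ Ici R, HasDerivWithinAt (fun y => m u y)
      (1 / 2 * (1 - 2 * m u v / r u v) * th u v ^ 2 / lam u v) (Ici R) v)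
    (hin : ∀ u ∈ Iic (-R), nu u R = -1) (hout : ∀ v ∈ Ici R, lam (-R) v = 1)
    {zi' : ℝ → ℝ} (zi'_cont : ContinuousOn zi' (Iic (-R)))
    (hzi : ∀ u ∈ Iic (-R), HasDerivWithinAt (fun x => ze x R) (zi' u) (Iic (-R)) u)
    {ti' : ℝ → ℝ} (ti'_cont : ContinuousOn ti' (Ici R))
    (hti : ∀ v ∈ Ici R, HasDerivWithinAt (fun y => th (-R) y) (ti' v) (Ici R) v) :
    ContDiffOn ℝ 2 (Function.uncurry r) (Iic (-R) ×ˢ Ici R) ∧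
      ContDiffOn ℝ 2 (Function.uncurry ph) (Iic (-R) ×ˢ Ici R) ∧
      ContDiffOn ℝ 2 (Function.uncurry m) (Iic (-R) ×ˢ Ici R) := by
  have cs := convex_Iic (𝕜 := ℝ) (-R)
  have us := uniqueDiffOn_Iic (-R)
  have ut := uniqueDiffOn_Ici R
  obtain ⟨nuU, nuU_cont, du_nu⟩ := h.exists_du_nu hin
  obtain ⟨lamV, lamV_cont, dv_lam⟩ := h.exists_dv_lam dvm hout
  have r1 := contDiffOn_one_of_partials cs us ut h.du_r h.dv_r h.nu_cont h.lam_cont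
  have m1 := contDiffOn_one_of_partials cs us ut (fu := fun u v =>
    1 / 2 * (1 - 2 * m u v / r u v) * ze u v ^ 2 / nu u v) (fv := fun u v =>
    1 / 2 * (1 - 2 * m u v / r u v) * th u v ^ 2 / lam u v) h.du_m dvm h.du_m_cont h.dv_m_cont
  have nu1 := contDiffOn_one_of_partials cs us ut (fv := fun u v =>
    lam u v * nu u v * (2 * m u v / (r u v ^ 2 * (1 - 2 * m u v / r u v)))) du_nu h.dv_nu nuU_cont
    h.source_cont
  have lam1 := contDiffOn_one_of_partials cs us ut (fu := fun u v =>
    lam u v * nu u v * (2 * m u v / (r u v ^ 2 * (1 - 2 * m u v / r u v)))) h.du_lam dv_lam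
    h.source_cont lamV_cont
  have ze1 := h.contDiffOn_ze nuU_cont du_nu zi'_cont hzi
  have th1 := h.contDiffOn_th lamV_cont dv_lam ti'_cont hti
  have k1 : ContDiffOn ℝ 1 (fun p : ℝ × ℝ => 1 / 2 * (1 - 2 * m p.1 p.2 / r p.1 p.2))
      (Iic (-R) ×ˢ Ici R) :=
    contDiffOn_const.mul (contDiffOn_const.sub ((contDiffOn_const.mul m1).div r1 h.r_ne))
  refine ⟨?_, ?_, ?_⟩
  · exact contDiffOn_succ_of_partials (n := 1) cs us ut h.du_r h.dv_r nu1 lam1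
  · exact contDiffOn_succ_of_partials (n := 1) cs us ut h.du_ph h.dv_ph (ze1.div r1 h.r_ne)
      (th1.div r1 h.r_ne)
  · exact contDiffOn_succ_of_partials (n := 1) cs us ut (fu := fun u v =>
      1 / 2 * (1 - 2 * m u v / r u v) * ze u v ^ 2 / nu u v) (fv := fun u v =>
      1 / 2 * (1 - 2 * m u v / r u v) * th u v ^ 2 / lam u v) h.du_m dvm
      ((k1.mul (ze1.pow 2)).div nu1 h.nu_ne) ((k1.mul (th1.pow 2)).div lam1 h.lam_ne)

end

end ReducedSystem

end GammaProblem

/-! ### From the global state to the maximal development. -/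

namespace GammaProblem

/-- The fields described by a family of states. -/
noncomputable def Fields.ofState (X : ℝ → ℝ → Fin 6 → ℝ) : Fields where
  r u v := X u v 0
  φ u v := X u v 3 / X u v 0
  m u v := X u v 5

section evolution

variable (x : Fin 6 → ℝ)

theorem evolution_zero : evolution x 0 = x 1 := rfl

theorem evolution_one : evolution x 1 = radiusSource x := rfl

theorem evolution_two : evolution x 2 = radiusSource x := rfl

theorem evolution_three : evolution x 3 = x 4 := rfl

theorem evolution_four : evolution x 4 = radiusSource x * (x 3 / x 0) := rfl

theorem evolution_five : evolution x 5 =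
    1 / 2 * (1 - 2 * x 5 / x 0) * (x 4 - x 2 * (x 3 / x 0)) ^ 2 / x 2 := rfl

end evolution

namespace CharData

variable {R C M m₀ : ℝ} (d : CharData R C M m₀)

/-- `∂_v (r φ)` of the fields described by a family of states. -/
noncomputable def dvRPhi (X : ℝ → ℝ → Fin 6 → ℝ) (u v : ℝ) : ℝ :=
  derivWithin (fun v' => d.rOut v' * d.φOut v') (Ici R) v + ∫ s in (-R)..u, evolution (X s v) 4

theorem hasDerivWithinAt_φIn {u : ℝ} (hu : u ∈ Iic (-R)) :
    HasDerivWithinAt d.φIn (derivWithin d.φIn (Iic (-R)) u) (Iic (-R)) u :=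
  (d.φIn_c2.differentiableOn two_ne_zero u hu).hasDerivWithinAt

theorem hasDerivWithinAt_φOut {v : ℝ} (hv : v ∈ Ici R) :
    HasDerivWithinAt d.φOut (derivWithin d.φOut (Ici R) v) (Ici R) v :=
  (d.φOut_c2.differentiableOn two_ne_zero v hv).hasDerivWithinAt

theorem derivWithin_rφIn {u : ℝ} (hu : u ∈ Iic (-R)) :
    HasDerivWithinAt (fun u' => d.rIn u' * d.φIn u')
      (-d.φIn u + d.rIn u * derivWithin d.φIn (Iic (-R)) u) (Iic (-R)) u ∧
    derivWithin (fun u' => d.rIn u' * d.φIn u') (Iic (-R)) u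
      = -d.φIn u + d.rIn u * derivWithin d.φIn (Iic (-R)) u := by
  have : HasDerivWithinAt (fun u' => d.rIn u' * d.φIn u')
      (-d.φIn u + d.rIn u * derivWithin d.φIn (Iic (-R)) u) (Iic (-R)) u :=
    ((d.rIn_deriv u hu).mul (d.hasDerivWithinAt_φIn hu)).congr_deriv (by ring)
  exact ⟨this, this.derivWithin (uniqueDiffOn_Iic _ _ hu)⟩

theorem derivWithin_rφOut {v : ℝ} (hv : v ∈ Ici R) :
    HasDerivWithinAt (fun v' => d.rOut v' * d.φOut v')
      (d.φOut v + d.rOut v * derivWithin d.φOut (Ici R) v) (Ici R) v ∧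
    derivWithin (fun v' => d.rOut v' * d.φOut v') (Ici R) v
      = d.φOut v + d.rOut v * derivWithin d.φOut (Ici R) v := by
  have : HasDerivWithinAt (fun v' => d.rOut v' * d.φOut v')
      (d.φOut v + d.rOut v * derivWithin d.φOut (Ici R) v) (Ici R) v :=
    ((d.rOut_deriv v hv).mul (d.hasDerivWithinAt_φOut hv)).congr_deriv (by ring)
  exact ⟨this, this.derivWithin (uniqueDiffOn_Ici _ _ hv)⟩

theorem continuousOn_deriv_φIn : ContinuousOn (derivWithin d.φIn (Iic (-R))) (Iic (-R)) :=
  d.φIn_c2.continuousOn_derivWithin (uniqueDiffOn_Iic _) one_le_two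

/-- A solution of the integrated evolution equations with values in a box. -/
structure IsGlobalState {α β : ℝ} (X : ℝ → ℝ → Fin 6 → ℝ) : Prop where
  small : Smallness α β R C M
  cont : Continuous (Function.uncurry X)
  r_ge : ∀ u ∈ Iic (-R), ∀ v ∈ Ici R, v - R - u ≤ X u v 0
  box : ∀ u ∈ Iic (-R), ∀ v ∈ Ici R, InBox α β R C M (fieldConst α C M / u ^ 2) (X u v)
  eqn : ∀ u ∈ Iic (-R), ∀ v ∈ Ici R, ∀ i, X u v i = d.base u v i +
    if evolvesInU i then ∫ s in (-R)..u, evolution (X s v) i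
    else ∫ s in R..v, evolution (X u s) i

namespace IsGlobalState

variable {d} {α β : ℝ} {X : ℝ → ℝ → Fin 6 → ℝ}

section
variable (h : d.IsGlobalState (α := α) (β := β) X)
include h

theorem X_cont (i : Fin 6) :
    ContinuousOn (fun p : ℝ × ℝ => X p.1 p.2 i) (Iic (-R) ×ˢ Ici R) :=
  ((continuous_apply i).comp h.cont).continuousOn

theorem regular {u v : ℝ} (hu : u ∈ Iic (-R)) (hv : v ∈ Ici R) : X u v ∈ regularStates :=
  (h.box u hu v hv).mem_regularStates h.small

theorem E_cont (i : Fin 6) :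
    ContinuousOn (fun p : ℝ × ℝ => evolution (X p.1 p.2) i) (Iic (-R) ×ˢ Ici R) :=
  (continuous_apply i).comp_continuousOn (contDiffOn_evolution.continuousOn.comp
    h.cont.continuousOn fun _ hp => h.regular hp.1 hp.2)

theorem eqn_of_evolvesInU {u v : ℝ} (hu : u ∈ Iic (-R)) (hv : v ∈ Ici R) {i : Fin 6}
    (hi : evolvesInU i = true) :
    X u v i = d.base u v i + ∫ s in (-R)..u, evolution (X s v) i := by
  rw [h.eqn u hu v hv i, if_pos hi]

theorem eqn_of_not_evolvesInU {u v : ℝ} (hu : u ∈ Iic (-R)) (hv : v ∈ Ici R) {i : Fin 6}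
    (hi : ¬evolvesInU i = true) :
    X u v i = d.base u v i + ∫ s in R..v, evolution (X u s) i := by
  rw [h.eqn u hu v hv i, if_neg hi]

theorem r_eqn {u v : ℝ} (hu : u ∈ Iic (-R)) (hv : v ∈ Ici R) :
    X u v 0 = -u + ∫ s in R..v, X u s 1 := by
  have := h.eqn_of_not_evolvesInU hu hv (i := 0) (by decide)
  simp only [evolution_zero] at this
  exact this

theorem lam_eqn {u v : ℝ} (hu : u ∈ Iic (-R)) (hv : v ∈ Ici R) :
    X u v 1 = 1 + ∫ s in (-R)..u, radiusSource (X s v) := by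
  have := h.eqn_of_evolvesInU hu hv (i := 1) (by decide)
  simp only [evolution_one] at this
  exact this

theorem nu_eqn {u v : ℝ} (hu : u ∈ Iic (-R)) (hv : v ∈ Ici R) :
    X u v 2 = -1 + ∫ s in R..v, radiusSource (X u s) := by
  have := h.eqn_of_not_evolvesInU hu hv (i := 2) (by decide)
  simp only [evolution_two] at this
  exact this

theorem rphi_eqn {u v : ℝ} (hu : u ∈ Iic (-R)) (hv : v ∈ Ici R) :
    X u v 3 = d.rOut v * d.φOut v + ∫ s in (-R)..u, X s v 4 := by
  have := h.eqn_of_evolvesInU hu hv (i := 3) (by decide)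
  simp only [evolution_three] at this
  have e : d.base u v 3 = d.rOut (max v R) * d.φOut (max v R) := rfl
  rwa [e, max_eq_left (mem_Ici.1 hv)] at this

theorem duRPhi_eqn {u v : ℝ} (hu : u ∈ Iic (-R)) (hv : v ∈ Ici R) :
    X u v 4 = -d.φIn u + d.rIn u * derivWithin d.φIn (Iic (-R)) u
      + ∫ s in R..v, evolution (X u s) 4 := by
  have := h.eqn_of_not_evolvesInU hu hv (i := 4) (by decide)
  have e : d.base u v 4 = derivWithin (fun u' => d.rIn u' * d.φIn u') (Iic (-R)) (min u (-R)) :=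
    rfl
  rwa [e, min_eq_left (mem_Iic.1 hu), (d.derivWithin_rφIn hu).2] at this

theorem m_eqn {u v : ℝ} (hu : u ∈ Iic (-R)) (hv : v ∈ Ici R) :
    X u v 5 = d.mOut v + ∫ s in (-R)..u, evolution (X s v) 5 := by
  have := h.eqn_of_evolvesInU hu hv (i := 5) (by decide)
  have e : d.base u v 5 = d.mOut (max v R) := rfl
  rwa [e, max_eq_left (mem_Ici.1 hv)] at this

theorem hasDerivWithinAt_fst {u v : ℝ} (hu : u ∈ Iic (-R)) (hv : v ∈ Ici R) {i : Fin 6} {c : ℝ}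
    (e : ∀ x ∈ Iic (-R), X x v i = c + ∫ s in (-R)..x, evolution (X s v) i) :
    HasDerivWithinAt (fun x => X x v i) (evolution (X u v) i) (Iic (-R)) u :=
  (((isLineRetract_Iic (-R)).hasDerivWithinAt_integral
    (ReducedSystem.slice_left (f := fun u v => evolution (X u v) i) (h.E_cont i) hv)
    self_mem_Iic hu).const_add _).congr e (e u hu)

theorem hasDerivWithinAt_snd {u v : ℝ} (hu : u ∈ Iic (-R)) (hv : v ∈ Ici R) {i : Fin 6} {c : ℝ}
    (e : ∀ y ∈ Ici R, X u y i = c + ∫ s in R..y, evolution (X u s) i) :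
    HasDerivWithinAt (fun y => X u y i) (evolution (X u v) i) (Ici R) v :=
  (((isLineRetract_Ici R).hasDerivWithinAt_integral
    (ReducedSystem.slice_right (f := fun u v => evolution (X u v) i) (h.E_cont i) hu)
    self_mem_Ici hv).const_add _).congr e (e v hv)

theorem dv_r {u v : ℝ} (hu : u ∈ Iic (-R)) (hv : v ∈ Ici R) :
    HasDerivWithinAt (fun y => X u y 0) (X u v 1) (Ici R) v := by
  have := h.hasDerivWithinAt_snd hu hv (i := 0) (c := -u) fun y hy => by
    simpa only [evolution_zero] using h.r_eqn hu hy
  rwa [evolution_zero] at this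

theorem du_lam {u v : ℝ} (hu : u ∈ Iic (-R)) (hv : v ∈ Ici R) :
    HasDerivWithinAt (fun x => X x v 1) (radiusSource (X u v)) (Iic (-R)) u := by
  have := h.hasDerivWithinAt_fst hu hv (i := 1) (c := 1) fun x hx => by
    simpa only [evolution_one] using h.lam_eqn hx hv
  rwa [evolution_one] at this

theorem dv_nu {u v : ℝ} (hu : u ∈ Iic (-R)) (hv : v ∈ Ici R) :
    HasDerivWithinAt (fun y => X u y 2) (radiusSource (X u v)) (Ici R) v := by
  have := h.hasDerivWithinAt_snd hu hv (i := 2) (c := -1) fun y hy => by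
    simpa only [evolution_two] using h.nu_eqn hu hy
  rwa [evolution_two] at this

theorem du_rphi {u v : ℝ} (hu : u ∈ Iic (-R)) (hv : v ∈ Ici R) :
    HasDerivWithinAt (fun x => X x v 3) (X u v 4) (Iic (-R)) u := by
  have := h.hasDerivWithinAt_fst hu hv (i := 3) (c := d.rOut v * d.φOut v) fun x hx => by
    simpa only [evolution_three] using h.rphi_eqn hx hv
  rwa [evolution_three] at this

theorem dv_duRPhi {u v : ℝ} (hu : u ∈ Iic (-R)) (hv : v ∈ Ici R) :
    HasDerivWithinAt (fun y => X u y 4) (evolution (X u v) 4) (Ici R) v :=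
  h.hasDerivWithinAt_snd hu hv fun _ hy => h.duRPhi_eqn hu hy

theorem du_m {u v : ℝ} (hu : u ∈ Iic (-R)) (hv : v ∈ Ici R) :
    HasDerivWithinAt (fun x => X x v 5) (evolution (X u v) 5) (Iic (-R)) u :=
  h.hasDerivWithinAt_fst hu hv fun _ hx => h.m_eqn hx hv

/-- ν was evolved as an independent unknown. It is ∂_u r because ∂_uλ and ∂_vν are the same source,
so differentiating the v-integral of λ reproduces the integral equation of ν. -/
theorem du_r {u v : ℝ} (hu : u ∈ Iic (-R)) (hv : v ∈ Ici R) :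
    HasDerivWithinAt (fun x => X x v 0) (X u v 2) (Iic (-R)) u := by
  have e : ∀ x ∈ Iic (-R), X x v 0 = -x + ∫ s in R..v, X x s 1 := fun x hx => h.r_eqn hx hv
  have hc : ContinuousOn (fun p : ℝ × ℝ => radiusSource (X p.1 p.2)) (Iic (-R) ×ˢ Ici R) := by
    simpa only [evolution_one] using h.E_cont 1
  rw [h.nu_eqn hu hv]
  exact ((hasDerivAt_neg u).hasDerivWithinAt.add
    ((isLineRetract_Iic (-R)).hasDerivWithinAt_integral_right (isLineRetract_Ici R)
      (A := fun u v => X u v 1) (H := fun u v => radiusSource (X u v)) (h.X_cont 1) hc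
      (fun x hx y hy => h.du_lam hx hy) self_mem_Ici hu hv)).congr e (e u hu)

/-- ∂_v(rφ) is not a component of the state; it is found by differentiating the u-integral of
∂_u(rφ) in v. -/
theorem dv_rphi {u v : ℝ} (hu : u ∈ Iic (-R)) (hv : v ∈ Ici R) :
    HasDerivWithinAt (fun y => X u y 3) (d.dvRPhi X u v) (Ici R) v := by
  have e : ∀ y ∈ Ici R, X u y 3 = d.rOut y * d.φOut y + ∫ s in (-R)..u, X s y 4 :=
    fun y hy => h.rphi_eqn hu hy
  have h1 := (d.derivWithin_rφOut hv).1
  rw [← (d.derivWithin_rφOut hv).2] at h1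
  exact (h1.add ((isLineRetract_Iic (-R)).hasDerivWithinAt_integral_left (isLineRetract_Ici R)
      (A := fun u v => X u v 4) (H := fun u v => evolution (X u v) 4) (h.X_cont 4) (h.E_cont 4)
      (fun x hx y hy => h.dv_duRPhi hx hy) self_mem_Iic hu hv)).congr e (e v hv)

theorem du_dvRPhi {u v : ℝ} (hu : u ∈ Iic (-R)) (hv : v ∈ Ici R) :
    HasDerivWithinAt (fun x => d.dvRPhi X x v) (evolution (X u v) 4) (Iic (-R)) u :=
  ((isLineRetract_Iic (-R)).hasDerivWithinAt_integral
    (ReducedSystem.slice_left (f := fun u v => evolution (X u v) 4) (h.E_cont 4) hv)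
    self_mem_Iic hu).const_add _

theorem dvRPhi_cont :
    ContinuousOn (fun p : ℝ × ℝ => d.dvRPhi X p.1 p.2) (Iic (-R) ×ˢ Ici R) := by
  have h1 : ContinuousOn (derivWithin (fun v' => d.rOut v' * d.φOut v') (Ici R)) (Ici R) :=
    (d.rOut_c2.mul d.φOut_c2).continuousOn_derivWithin (uniqueDiffOn_Ici _) one_le_two
  exact (h1.comp continuousOn_snd fun p hp => hp.2).add
    ((isLineRetract_Iic (-R)).continuousOn_integral_left (isLineRetract_Ici R)
      (H := fun u v => evolution (X u v) 4) (h.E_cont 4) self_mem_Iic)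

theorem r_ne : ∀ p ∈ Iic (-R) ×ˢ Ici R, X p.1 p.2 0 ≠ 0 := fun _ hp =>
  (h.regular hp.1 hp.2).1.ne'

theorem phi_cont :
    ContinuousOn (fun p : ℝ × ℝ => X p.1 p.2 3 / X p.1 p.2 0) (Iic (-R) ×ˢ Ici R) :=
  (h.X_cont 3).div (h.X_cont 0) h.r_ne

/-- ζ and θ are recovered by subtracting νφ and λφ from the two derivatives of rφ. In their
equations the common term φ ∂_u∂_v r cancels. -/
theorem reducedSystem :
    ReducedSystem R (fun u v => X u v 0) (fun u v => X u v 1) (fun u v => X u v 2)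
      (fun u v => X u v 3 / X u v 0) (fun u v => X u v 4 - X u v 2 * (X u v 3 / X u v 0))
      (fun u v => d.dvRPhi X u v - X u v 1 * (X u v 3 / X u v 0)) (fun u v => X u v 5) := by
  have duph : ∀ u ∈ Iic (-R), ∀ v ∈ Ici R,
      HasDerivWithinAt (fun x => X x v 3 / X x v 0)
        ((X u v 4 - X u v 2 * (X u v 3 / X u v 0)) / X u v 0) (Iic (-R)) u := by
    intro u hu v hv
    have r0 := h.r_ne (u, v) ⟨hu, hv⟩
    refine ((h.du_rphi hu hv).div (h.du_r hu hv) r0).congr_deriv ?_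
    field_simp
  have dvph : ∀ u ∈ Iic (-R), ∀ v ∈ Ici R,
      HasDerivWithinAt (fun y => X u y 3 / X u y 0)
        ((d.dvRPhi X u v - X u v 1 * (X u v 3 / X u v 0)) / X u v 0) (Ici R) v := by
    intro u hu v hv
    have r0 := h.r_ne (u, v) ⟨hu, hv⟩
    refine ((h.dv_rphi hu hv).div (h.dv_r hu hv) r0).congr_deriv ?_
    field_simp
  constructor
  · exact h.X_cont 0
  · exact h.X_cont 1
  · exact h.X_cont 2
  · exact (h.X_cont 4).sub ((h.X_cont 2).mul h.phi_cont)
  · exact h.dvRPhi_cont.sub ((h.X_cont 1).mul h.phi_cont)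
  · exact h.X_cont 5
  · exact fun u hu v hv => (h.regular hu hv).1
  · exact fun u hu v hv => one_pos.trans_le (h.box u hu v hv).one_le_lam
  · exact fun u hu v hv => (h.regular hu hv).2.1
  · exact fun u hu v hv => one_sub_pos_of_mem_regularStates (h.regular hu hv)
  · exact fun u hu v hv => h.du_r hu hv
  · exact fun u hu v hv => h.dv_r hu hv
  · exact fun u hu v hv => h.du_lam hu hv
  · exact fun u hu v hv => h.dv_nu hu hv
  · exact duph
  · exact dvph
  · intro u hu v hv
    have r0 := h.r_ne (u, v) ⟨hu, hv⟩
    refine ((h.dv_duRPhi hu hv).sub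
      ((h.dv_nu hu hv).mul (dvph u hu v hv))).congr_deriv ?_
    rw [evolution_four, radiusSource]
    field_simp
    ring
  · intro u hu v hv
    have r0 := h.r_ne (u, v) ⟨hu, hv⟩
    refine ((h.du_dvRPhi hu hv).sub
      ((h.du_lam hu hv).mul (duph u hu v hv))).congr_deriv ?_
    rw [evolution_four, radiusSource]
    field_simp
    ring
  · intro u hu v hv
    rw [← evolution_five]
    exact h.du_m hu hv

theorem lam_out {v : ℝ} (hv : v ∈ Ici R) : X (-R) v 1 = 1 := by
  rw [h.lam_eqn self_mem_Iic hv, intervalIntegral.integral_same, add_zero]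

theorem r_out {v : ℝ} (hv : v ∈ Ici R) : X (-R) v 0 = d.rOut v := by
  have e : ∫ s in R..v, X (-R) s 1 = ∫ s in R..v, (1 : ℝ) :=
    intervalIntegral.integral_congr fun s hs =>
      h.lam_out ((isLineRetract_Ici R).uIcc_subset self_mem_Ici hv hs)
  rw [h.r_eqn self_mem_Iic hv, e, d.rOut_eq hv]
  simp

theorem nu_in {u : ℝ} (hu : u ∈ Iic (-R)) : X u R 2 = -1 := by
  rw [h.nu_eqn hu self_mem_Ici, intervalIntegral.integral_same, add_zero]

theorem r_in {u : ℝ} (hu : u ∈ Iic (-R)) : X u R 0 = d.rIn u := by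
  rw [h.r_eqn hu self_mem_Ici, d.rIn_eq hu, intervalIntegral.integral_same, add_zero]

theorem m_out {v : ℝ} (hv : v ∈ Ici R) : X (-R) v 5 = d.mOut v := by
  rw [h.m_eqn self_mem_Iic hv, intervalIntegral.integral_same, add_zero]

theorem rphi_out {v : ℝ} (hv : v ∈ Ici R) : X (-R) v 3 = d.rOut v * d.φOut v := by
  rw [h.rphi_eqn self_mem_Iic hv, intervalIntegral.integral_same, add_zero]

theorem phi_out {v : ℝ} (hv : v ∈ Ici R) : X (-R) v 3 / X (-R) v 0 = d.φOut v := by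
  have r0 := h.r_ne (-R, v) ⟨self_mem_Iic, hv⟩
  rw [div_eq_iff r0, h.rphi_out hv, h.r_out hv, mul_comm]

theorem duRPhi_in {u : ℝ} (hu : u ∈ Iic (-R)) :
    X u R 4 = -d.φIn u + d.rIn u * derivWithin d.φIn (Iic (-R)) u := by
  rw [h.duRPhi_eqn hu self_mem_Ici, intervalIntegral.integral_same, add_zero]

/-- The construction prescribes only ∂_u(rφ) on v = R; φ itself is recovered by integrating from the
corner, where the continuity of the data fixes the constant. -/
theorem phi_in {u : ℝ} (hu : u ∈ Iic (-R)) : X u R 3 / X u R 0 = d.φIn u := by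
  have r0 := h.r_ne (u, R) ⟨hu, self_mem_Ici⟩
  have e := (isLineRetract_Iic (-R)).integral_eq_sub
    (f := fun x => X x R 3 - d.rIn x * d.φIn x) (f' := fun _ => 0) (fun x hx => by
      refine ((h.du_rphi hx self_mem_Ici).sub
        (d.derivWithin_rφIn hx).1).congr_deriv ?_
      rw [← h.duRPhi_in hx]
      exact sub_self (X x R 4)) continuousOn_const self_mem_Iic hu
  rw [intervalIntegral.integral_zero, h.rphi_out self_mem_Ici, d.rOut_corner, d.rIn_corner,
    d.φ_corner, sub_self, sub_zero, eq_comm, sub_eq_zero] at e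
  rw [div_eq_iff r0, e, h.r_in hu, mul_comm]

theorem ze_in {u : ℝ} (hu : u ∈ Iic (-R)) :
    X u R 4 - X u R 2 * (X u R 3 / X u R 0) = d.rIn u * derivWithin d.φIn (Iic (-R)) u := by
  rw [h.phi_in hu, h.nu_in hu, h.duRPhi_in hu]
  ring

theorem th_out {v : ℝ} (hv : v ∈ Ici R) :
    d.dvRPhi X (-R) v - X (-R) v 1 * (X (-R) v 3 / X (-R) v 0)
      = d.rOut v * derivWithin d.φOut (Ici R) v := by
  rw [h.phi_out hv, h.lam_out hv, dvRPhi, (d.derivWithin_rφOut hv).2,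
    intervalIntegral.integral_same]
  ring

/-- The state was given m on u = -R only. On v = R the constructed and the prescribed mass solve the
same equation, affine in m, with the same corner value. -/
theorem m_in {u : ℝ} (hu : u ∈ Iic (-R)) : X u R 5 = d.mIn u := by
  have hs := isLineRetract_Iic (-R)
  have hrne : ∀ x ∈ Iic (-R), d.rIn x ≠ 0 := fun x hx => by
    rw [← h.r_in hx]
    exact h.r_ne (x, R) ⟨hx, self_mem_Ici⟩
  set a : ℝ → ℝ := fun x => (d.rIn x * derivWithin d.φIn (Iic (-R)) x) ^ 2 / d.rIn x with ha
  have a_cont : ContinuousOn a (Iic (-R)) :=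
    ((d.rIn_c2.continuousOn.mul d.continuousOn_deriv_φIn).pow 2).div d.rIn_c2.continuousOn hrne
  have e := hs.integral_eq_sub
    (f := fun x => (X x R 5 - d.mIn x) * Real.exp (-∫ s in (-R)..x, a s)) (f' := fun _ => 0)
    (fun x hx => by
      have r0 := hrne x hx
      have h1 := h.reducedSystem.du_m x hx R self_mem_Ici
      simp only [h.ze_in hx] at h1
      simp only [h.nu_in hx, h.r_in hx] at h1
      refine ((h1.sub (d.mIn_deriv x hx)).mul
        (hs.hasDerivWithinAt_integral a_cont self_mem_Iic hx).neg.exp).congr_deriv ?_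
      simp only [Pi.neg_apply, Pi.sub_apply, ha]
      field_simp
      ring) continuousOn_const self_mem_Iic hu
  rw [intervalIntegral.integral_zero, h.m_out self_mem_Ici, d.mOut_corner, d.mIn_corner, sub_self,
    zero_mul, sub_zero, eq_comm] at e
  exact sub_eq_zero.1 ((mul_eq_zero.1 e).resolve_right (Real.exp_pos _).ne')

theorem dv_m : ∀ u ∈ Iic (-R), ∀ v ∈ Ici R, HasDerivWithinAt (fun y => X u y 5)
      (1 / 2 * (1 - 2 * X u v 5 / X u v 0)
        * (d.dvRPhi X u v - X u v 1 * (X u v 3 / X u v 0)) ^ 2 / X u v 1) (Ici R) v := by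
  refine h.reducedSystem.dv_m fun v hv => ?_
  rw [h.th_out hv, h.lam_out hv, div_one, h.m_out hv, h.r_out hv]
  exact (d.mOut_deriv v hv).congr (fun y hy => h.m_out hy) (h.m_out hv)

/-- The C² assumption on the data enters here: ζ on v = R and θ on u = -R are r times a first
derivative of φ, hence C¹. -/
theorem contDiffOn_fields :
    ContDiffOn ℝ 2 (Function.uncurry fun u v => X u v 0) (Iic (-R) ×ˢ Ici R) ∧
      ContDiffOn ℝ 2 (Function.uncurry fun u v => X u v 3 / X u v 0) (Iic (-R) ×ˢ Ici R) ∧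
      ContDiffOn ℝ 2 (Function.uncurry fun u v => X u v 5) (Iic (-R) ×ˢ Ici R) := by
  have key : ∀ {f g : ℝ → ℝ} {s : Set ℝ}, UniqueDiffOn ℝ s → ContDiffOn ℝ 2 f s →
      ContDiffOn ℝ 2 g s → ContDiffOn ℝ 1 (fun x => f x * derivWithin g s x) s :=
    fun hs hf hg => (hf.of_le one_le_two).mul (hg.derivWithin hs le_rfl)
  have hz := key (uniqueDiffOn_Iic _) d.rIn_c2 d.φIn_c2
  have ht := key (uniqueDiffOn_Ici _) d.rOut_c2 d.φOut_c2
  refine h.reducedSystem.contDiffOn_two h.dv_m (fun u hu => h.nu_in hu) (fun v hv => h.lam_out hv)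
    (hz.continuousOn_derivWithin (uniqueDiffOn_Iic _) le_rfl) (fun u hu => ?_)
    (ht.continuousOn_derivWithin (uniqueDiffOn_Ici _) le_rfl) (fun v hv => ?_)
  · exact ((hz.differentiableOn one_ne_zero u hu).hasDerivWithinAt).congr
      (fun x hx => h.ze_in hx) (h.ze_in hu)
  · exact ((ht.differentiableOn one_ne_zero v hv).hasDerivWithinAt).congr
      (fun y hy => h.th_out hy) (h.th_out hv)

theorem nu_eq {u v : ℝ} (hu : u ∈ Iic (-R)) (hv : v ∈ Ici R) :
    (Fields.ofState X).nu R u v = X u v 2 :=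
  (h.du_r hu hv).derivWithin (uniqueDiffOn_Iic _ _ hu)

theorem lam_eq {u v : ℝ} (hu : u ∈ Iic (-R)) (hv : v ∈ Ici R) :
    (Fields.ofState X).lam R u v = X u v 1 :=
  (h.reducedSystem.dv_r u hu v hv).derivWithin (uniqueDiffOn_Ici _ _ hv)

theorem zeta_eq {u v : ℝ} (hu : u ∈ Iic (-R)) (hv : v ∈ Ici R) :
    (Fields.ofState X).zeta R u v = X u v 4 - X u v 2 * (X u v 3 / X u v 0) := by
  have e : partialU R (Fields.ofState X).φ u v = _ :=
    (h.reducedSystem.du_ph u hu v hv).derivWithin (uniqueDiffOn_Iic _ _ hu)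
  rw [Fields.zeta, e]
  exact mul_div_cancel₀ _ (h.r_ne (u, v) ⟨hu, hv⟩)

theorem theta_eq {u v : ℝ} (hu : u ∈ Iic (-R)) (hv : v ∈ Ici R) :
    (Fields.ofState X).theta R u v = d.dvRPhi X u v - X u v 1 * (X u v 3 / X u v 0) := by
  have e : partialV R (Fields.ofState X).φ u v = _ :=
    (h.reducedSystem.dv_ph u hu v hv).derivWithin (uniqueDiffOn_Ici _ _ hv)
  rw [Fields.theta, e]
  exact mul_div_cancel₀ _ (h.r_ne (u, v) ⟨hu, hv⟩)

theorem solves : (Fields.ofState X).SolvesEinsteinScalar R (wedge R) := by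
  have hsys := h.reducedSystem
  constructor
  · exact fun u v hw => (h.regular hw.1 hw.2).1
  · exact fun u v hw => (hsys.mu_lt u hw.1 v hw.2).ne'
  · intro u v hw
    rw [h.nu_eq hw.1 hw.2]
    exact (hsys.nu_neg u hw.1 v hw.2).ne
  · intro u v hw
    rw [h.lam_eq hw.1 hw.2]
    exact (hsys.lam_pos u hw.1 v hw.2).ne'
  · intro u v hw
    refine HasDerivWithinAt.congr ((hsys.du_lam u hw.1 v hw.2).congr_deriv ?_)
      (fun x hx => h.lam_eq hx hw.2) (h.lam_eq hw.1 hw.2)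
    rw [h.lam_eq hw.1 hw.2, h.nu_eq hw.1 hw.2]
    simp only [Fields.mu, Fields.ofState]
    have r0 := (hsys.r_pos u hw.1 v hw.2).ne'
    have k0 := (hsys.mu_lt u hw.1 v hw.2).ne'
    generalize 1 - 2 * X u v 5 / X u v 0 = k at k0 ⊢
    field_simp
  · intro u v hw
    refine HasDerivWithinAt.congr ((hsys.dv_nu u hw.1 v hw.2).congr_deriv ?_)
      (fun y hy => h.nu_eq hw.1 hy) (h.nu_eq hw.1 hw.2)
    rw [h.lam_eq hw.1 hw.2, h.nu_eq hw.1 hw.2]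
    simp only [Fields.mu, Fields.ofState]
    have r0 := (hsys.r_pos u hw.1 v hw.2).ne'
    have k0 := (hsys.mu_lt u hw.1 v hw.2).ne'
    generalize 1 - 2 * X u v 5 / X u v 0 = k at k0 ⊢
    field_simp
  · intro u v hw
    refine (hsys.du_m u hw.1 v hw.2).congr_deriv ?_
    rw [h.zeta_eq hw.1 hw.2, h.nu_eq hw.1 hw.2]
    simp only [Fields.mu, Fields.ofState]
    have n0 := (hsys.nu_neg u hw.1 v hw.2).ne
    generalize 1 - 2 * X u v 5 / X u v 0 = k
    generalize X u v 4 - X u v 2 * (X u v 3 / X u v 0) = z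
    field_simp
  · intro u v hw
    refine (h.dv_m u hw.1 v hw.2).congr_deriv ?_
    rw [h.theta_eq hw.1 hw.2, h.lam_eq hw.1 hw.2]
    simp only [Fields.mu, Fields.ofState]
    have l0 := (hsys.lam_pos u hw.1 v hw.2).ne'
    generalize 1 - 2 * X u v 5 / X u v 0 = k
    generalize d.dvRPhi X u v - X u v 1 * (X u v 3 / X u v 0) = z
    field_simp
  · intro u v hw
    refine HasDerivWithinAt.congr ((hsys.du_th u hw.1 v hw.2).congr_deriv ?_)
      (fun x hx => h.theta_eq hx hw.2) (h.theta_eq hw.1 hw.2)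
    rw [h.zeta_eq hw.1 hw.2, h.lam_eq hw.1 hw.2]
    rfl
  · intro u v hw
    refine HasDerivWithinAt.congr ((hsys.dv_ze u hw.1 v hw.2).congr_deriv ?_)
      (fun y hy => h.zeta_eq hw.1 hy) (h.zeta_eq hw.1 hw.2)
    rw [h.theta_eq hw.1 hw.2, h.nu_eq hw.1 hw.2]
    rfl

theorem isDevelopment : IsDevelopment d (wedge R) (Fields.ofState X) where
  subset_wedge := subset_rfl
  rel_open := ⟨univ, isOpen_univ, (univ_inter _).symm⟩
  out_mem _ hv := ⟨self_mem_Iic, hv⟩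
  in_mem _ hu := ⟨hu, self_mem_Ici⟩
  r_out _ hv := h.r_out hv
  φ_out _ hv := h.phi_out hv
  m_out _ hv := h.m_out hv
  r_in _ hu := h.r_in hu
  φ_in _ hu := h.phi_in hu
  m_in _ hu := h.m_in hu
  regular := ⟨h.contDiffOn_fields.1, h.contDiffOn_fields.2.1, h.contDiffOn_fields.2.2⟩
  solves := h.solves
  past_set _ _ _ _ _ hw _ _ := hw

theorem two_mul_M_lt : 2 * M < R := by
  have h1 := h.small.mass_le
  have h2 := h.small.one_lt_α
  have h3 := h.small.M_pos
  nlinarith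

theorem isMaximalDevelopment : IsMaximalDevelopment d (wedge R) (Fields.ofState X) where
  isDevelopment := h.isDevelopment
  maximal _ _ h' := ⟨h'.subset_wedge, fun _ _ hD =>
    h'.fields_eq h.isDevelopment h.two_mul_M_lt hD (h'.subset_wedge hD)⟩

/-- The source of rφ is now integrated in u. At u = -R the lower bound v - R - u for r equals v,
whence the decay v⁻². -/
theorem abs_dvRPhi_sub_le {u v : ℝ} (hu : u ∈ Iic (-R)) (hv : v ∈ Ici R) :
    |d.dvRPhi X u v - d.dvRPhi X (-R) v| ≤ α ^ 4 * M * C / v ^ 2 := by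
  have hα := h.small.one_lt_α
  have hM := h.small.M_pos
  have hC := h.small.C_pos
  have hR := h.small.R_pos
  have hv' := mem_Ici.1 hv
  have h1 := abs_integral_le_of_inv_cube_bound' (s := v - R) (q := α ^ 4 * M * C) hu (by linarith)
    (by positivity) (g := fun s => evolution (X s v) 4) (fun x hx => by
      exact (h.box x hx.2 v hv).abs_source_le h.small (ρ := v - R - x) (by linarith [hx.2])
        (h.r_ge x hx.2 v hv))
  simp only [dvRPhi, intervalIntegral.integral_same, add_zero, add_sub_cancel_left]
  rwa [add_sub_cancel] at h1

end

end IsGlobalState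

end CharData

/-- θ is not part of the state, so its uniqueness is deduced from that of φ on a v-slice. -/
theorem IsDevelopment.theta_eq {R C M m₀ : ℝ} {d : CharData R C M m₀} {S S' : Fields}
    (h : IsDevelopment d (wedge R) S) (h' : IsDevelopment d (wedge R) S') (hR : 2 * M < R)
    {u v : ℝ} (hD : (u, v) ∈ wedge R) : S.theta R u v = S'.theta R u v := by
  have e := fun y (hy : y ∈ Ici R) => h.fields_eq h' hR (u := u) (v := y) ⟨hD.1, hy⟩ ⟨hD.1, hy⟩
  rw [Fields.theta, Fields.theta, (e v hD.2).1]
  congr 1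
  exact derivWithin_congr (fun y hy => (e y hy).2.1) (e v hD.2).2.1

end GammaProblem

/-! ### Conclusion. -/

theorem proposition4 (α : ℝ) (hα : 1 < α) (R C M m₀ : ℝ) (hR₀ : 0 < R) (hC : 0 < C) (hM : 0 < M)
    (hm₀ : 0 ≤ m₀) (d : GammaProblem.CharData R C M m₀)
    (hR : GammaProblem.radiusBound α C M < R) :
    (∃ (D : Set (ℝ × ℝ)) (S : GammaProblem.Fields), GammaProblem.IsMaximalDevelopment d D S) ∧
    ∀ (D : Set (ℝ × ℝ)) (S : GammaProblem.Fields), GammaProblem.IsMaximalDevelopment d D S →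
      D = Set.Iic (-R) ×ˢ Set.Ici R ∧
      (∀ u v, (u, v) ∈ D →
        |S.r u v * S.φ u v| ≤ α * C ∧
        |S.nu R u v * S.φ u v + S.zeta R u v| ≤ (1 + α ^ 4 * M) * C / |u| ^ 2 ∧
        (-α ≤ S.nu R u v ∧ S.nu R u v ≤ -1) ∧
        (1 ≤ S.lam R u v ∧ S.lam R u v ≤ α) ∧
        (2 * α)⁻¹ ≤ 1 - S.mu u v) ∧
      ∀ Ct : ℝ,
        (∀ v ∈ Set.Ici R, |S.lam R (-R) v * S.φ (-R) v + S.theta R (-R) v| ≤ Ct / v ^ 2) →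
        ∀ u v, (u, v) ∈ D →
          |S.lam R u v * S.φ u v + S.theta R u v| ≤ (Ct + α ^ 4 * M * C) / v ^ 2 := by
  have hs := GammaProblem.smallness_of_radiusBound hα hR₀ hC hM hR
  obtain ⟨X, hXc, hr, hbox, heqn⟩ := d.exists_state hs hm₀
  have h : d.IsGlobalState X := ⟨hs, hXc, hr, hbox, heqn⟩
  refine ⟨⟨_, _, h.isMaximalDevelopment⟩, fun D S hS => ?_⟩
  -- A maximal development contains the constructed one, whose domain is already the whole wedge.
  have hD : D = GammaProblem.wedge R :=
    hS.isDevelopment.subset_wedge.antisymm (hS.maximal _ _ h.isDevelopment).1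
  subst hD
  have hdev := hS.isDevelopment
  have hMR := h.two_mul_M_lt
  have hX : ∀ {u v}, (u, v) ∈ GammaProblem.wedge R → S.state R u v = X u v := by
    intro u v hw
    rw [hdev.state_eq h.isDevelopment hMR hw hw]
    have r0 := h.r_ne (u, v) hw
    ext i
    fin_cases i
    · rfl
    · exact h.lam_eq hw.1 hw.2
    · exact h.nu_eq hw.1 hw.2
    · exact mul_div_cancel₀ _ r0
    · change (GammaProblem.Fields.ofState X).nu R u v * (X u v 3 / X u v 0)
        + (GammaProblem.Fields.ofState X).zeta R u v = X u v 4
      rw [h.nu_eq hw.1 hw.2, h.zeta_eq hw.1 hw.2, add_sub_cancel]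
    · rfl
  refine ⟨rfl, fun u v hw => ?_, fun Ct hCt => ?_⟩
  · have hb := hbox u hw.1 v hw.2
    rw [← hX hw] at hb
    refine ⟨hb.rphi_le, ?_, ⟨?_, hb.nu_le⟩, ⟨hb.one_le_lam, hb.lam_le.trans hs.β_le_α⟩, ?_⟩
    · rw [sq_abs]
      exact hb.du_rphi_le
    · exact (neg_le_neg hs.β_le_α).trans hb.le_nu
    · refine le_trans ?_ (hb.half_le_one_sub_mu hs)
      rw [one_div]
      exact inv_anti₀ two_pos (by linarith)
  -- Agreement on the whole wedge lets the hypothesis on u = -R be read as a bound on `dvRPhi`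
  -- there.
  · have hΘ : ∀ {u v}, (u, v) ∈ GammaProblem.wedge R →
        S.lam R u v * S.φ u v + S.theta R u v = d.dvRPhi X u v := by
      intro u v hw
      have e1 : S.lam R u v = X u v 1 := congr_fun (hX hw) 1
      have e2 : S.φ u v = X u v 3 / X u v 0 :=
        (hdev.fields_eq h.isDevelopment hMR hw hw).2.1
      rw [hdev.theta_eq h.isDevelopment hMR hw, h.theta_eq hw.1 hw.2, e1, e2, add_sub_cancel]
    intro u v hw
    have h1 := hCt v hw.2
    rw [hΘ ⟨self_mem_Iic, hw.2⟩] at h1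
    rw [hΘ hw, add_div]
    have h2 := h.abs_dvRPhi_sub_le hw.1 hw.2
    calc |d.dvRPhi X u v|
        = |d.dvRPhi X (-R) v + (d.dvRPhi X u v - d.dvRPhi X (-R) v)| := by rw [add_sub_cancel]
      _ ≤ |d.dvRPhi X (-R) v| + |d.dvRPhi X u v - d.dvRPhi X (-R) v| := abs_add_le _ _
      _ ≤ _ := add_le_add h1 h2
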